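/- Let $d\in\{2,3\}$, let $\Omega\subset\mathbb R^d$ be a convex polygonal (polyhedral) domain, let $\Omega_0$ be an open set with $\overline{\Omega_0}\subset\Omega$ and with $C^2$ boundary $\Gamma=\partial\Omega_0$, and let $\Omega_1=\Omega\setminus\overline{\Omega_0}$. Let $\mathcal T_h$ be a conforming triangulation of $\Omega$ into (open) simplices $K$, $\mathcal E_h$ the set of its $(d-1)$-dimensional faces (interior and boundary ones), $h_K,h_e$ the diameters of $K\in\mathcal T_h$ and $e\in\mathcal E_h$, and $h=\max_K h_K$. It is quasi-uniform with constant $\sigma$: $h\le\sigma\rho_K$ for all $K$, where $\rho_K$ is the inradius of $K$. Put $\mathcal T_h^{i,\circ}=\{K: K\subset\Omega_i\}$ for $i=0,1$, $\mathcal T_h^\Gamma=\{K:K\cap\Gamma\ne\varnothing\}$, $K^i=K\cap\Omega_i$, $\Gamma_K=K\cap\Gamma$, and $e^0=e\cap\Omega_0$, $e^1=e\setminus\overline{\Omega_0}$. Assume that for each $K\in\mathcal T_h^\Gamma$ there are elements $K_0^\circ\in\mathcal T_h^{0,\circ}$ and $K_1^\circ\in\mathcal T_h^{1,\circ}$ whose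 closures meet $\overline K$, and fix a choice of them. For $m\ge1$ and $i=0,1$ let $V_{h,i}^{m,\circ}$ be either the discontinuous or the $C^0$ space of piecewise polynomials of degree at most $m$ on $\mathcal T_h^{i,\circ}$. The space $V_h^m$ consists of all functions $E_h(v_0,v_1)$ with $v_i\in V_{h,i}^{m,\circ}$, where $E_h(v_0,v_1)$ equals $v_i$ on each $K\in\mathcal T_h^{i,\circ}$ and, for $K\in\mathcal T_h^\Gamma$, equals on $K^i$ the polynomial that has the same expression as $v_i|_{K_i^\circ}$ $(i=0,1)$. For piecewise $H^2$ functions $w$ define the energy norm by \[ \begin{aligned} |||w|||^2=&\sum_{K\in\mathcal T_h}\|\nabla w\|^2_{L^2(K^0\cup K^1)}+\sum_{e\in\mathcal E_h}h_e\|\{\nabla w\}\|^2_{L^2(e^0\cup e^1)}+\sum_{e\in\mathcal E_h}h_e^{-1}\|[w]\|^2_{L^2(e^0\cup e^1)}\\ &+\sum_{K\in\mathcal T_h^\Gamma}h_K\|\{\nabla w\}\|^2_{L^2(\Gamma_K)}+\sum_{K\in\mathcal T_h^\Gamma}h_K^{-1}\|[w]\|^2_{L^2(\Gamma_K)} . \end{aligned}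 \] Here, on an interior face with neighbours $K^\pm$ and outward unit normals $n^\pm$, $\{q\}=\tfrac12(q|_{K^+}+q|_{K^-})$ and $[w]=w|_{K^+}n^++w|_{K^-}n^-$; on a boundary face, $\{q\}=q$ and $[w]=wn$; on $\Gamma_K$, $\{q\}=\tfrac12(q|_{K^0}+q|_{K^1})$ and $[w]=(w|_{K^0}-w|_{K^1})n$, with $n$ the unit normal on $\Gamma$ pointing into $\Omega_1$; all values on hypersurfaces are traces. **Theorem.** For each $\sigma$ there is $h_0>0$, depending only on $d,\Omega,\Omega_0,\sigma$, and for each $m\ge1$ there is $C>0$, depending only on $d,\Omega,\Omega_0,\sigma,m$, such that for all meshes $\mathcal T_h$ as above with $h\le h_0$, all choices of the elements $K_i^\circ$, and each of the choices of the spaces $V_{h,i}^{m,\circ}$, \[ \inf_{v_h\in V_h^m}|||u-v_h|||\le C\,h^m\,\|u\|_{H^{m+1}(\Omega_0\cup\Omega_1)}\qquad\text{for all }u\in H^{m+1}(\Omega_0\cup\Omega_1). \] -/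

import Mathlib

open MeasureTheory Filter Topology Set
open scoped ENNReal ContDiff Gradient

noncomputable section

namespace UnfittedFEM

/-- Euclidean space `ℝ^d`. -/
abbrev E (d : ℕ) : Type := EuclideanSpace ℝ (Fin d)

/-! ### The domains -/

/-- A convex polygonal (polyhedral) domain: the nonempty interior of a convex polytope. -/
def IsConvexPolytopalDomain {d : ℕ} (Ω : Set (E d)) : Prop :=
  Ω.Nonempty ∧ ∃ P : Finset (E d), Ω = interior (convexHull ℝ (P : Set (E d)))

/-- The set `U` has a `C²` boundary: near each of its boundary points `x`, the set `U` is
`{φ < 0}` for a `C²` function `φ` with `∇φ(x) ≠ 0`. -/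
def HasC2Boundary {d : ℕ} (U : Set (E d)) : Prop :=
  ∀ x ∈ frontier U, ∃ φ : E d → ℝ,
    ContDiffAt ℝ 2 φ x ∧ fderiv ℝ φ x ≠ 0 ∧ ∀ᶠ y in 𝓝 x, (y ∈ U ↔ φ y < 0)

/-- The two open subdomains: `Ω₀`, and `Ω₁ = Ω \ closure Ω₀`. -/
def subdomain {d : ℕ} (Ω Ω₀ : Set (E d)) (i : Fin 2) : Set (E d) :=
  if i = 0 then Ω₀ else Ω \ closure Ω₀

/-- The part of the closed domain that belongs to subdomain `i`: `Ω₀`, or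
`closure Ω \ closure Ω₀`. It is used to restrict faces to a subdomain; in contrast with
`subdomain` it keeps the faces on `∂Ω` (these all belong to the outer subdomain). -/
def faceRegion {d : ℕ} (Ω Ω₀ : Set (E d)) (i : Fin 2) : Set (E d) :=
  if i = 0 then Ω₀ else closure Ω \ closure Ω₀

/-! ### `L²` norms, weak derivatives, Sobolev spaces -/

/-- The squared norm `‖f‖²_{L²(S; μ)}`, with values in `[0, ∞]`. -/
def l2Sq {d : ℕ} {F : Type*} [NormedAddCommGroup F] (μ : Measure (E d)) (S : Set (E d))
    (f : E d → F) : ℝ≥0∞ :=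
  ∫⁻ x in S, ‖f x‖ₑ ^ 2 ∂μ

/-- On the open set `D`, `u` and `g` are in `L²(D)` and `g` is the weak derivative
`∂_{i 0} ⋯ ∂_{i (k-1)} u`. -/
def HasWeakDeriv {d k : ℕ} (D : Set (E d)) (i : Fin k → Fin d) (u g : E d → ℝ) : Prop :=
  MemLp u 2 (volume.restrict D) ∧ MemLp g 2 (volume.restrict D) ∧
    ∀ φ : E d → ℝ, ContDiff ℝ ∞ φ → HasCompactSupport φ → tsupport φ ⊆ D →
      ∫ x in D, u x * iteratedFDeriv ℝ k φ x (fun l => EuclideanSpace.single (i l) (1 : ℝ)) =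
        (-1) ^ k * ∫ x in D, g x * φ x

/-- Membership in the Sobolev space `H^k(D)` of the open set `D`. -/
def MemSobolev {d : ℕ} (k : ℕ) (D : Set (E d)) (u : E d → ℝ) : Prop :=
  ∀ j ≤ k, ∀ i : Fin j → Fin d, ∃ g, HasWeakDeriv D i u g

/-- The Sobolev norm `‖u‖_{H^k(D)} = (∑_{j ≤ k} ‖D^j u‖²_{L²(D)})^{1/2}`, where `|D^j u|` is the
Euclidean norm of the tensor of all weak derivatives of order `j`. A weak derivative is unique
almost everywhere, so that each infimum is over one value (it is `∞` if there is none). -/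
def sobolevNorm {d : ℕ} (k : ℕ) (D : Set (E d)) (u : E d → ℝ) : ℝ≥0∞ :=
  (∑ j ∈ Finset.range (k + 1), ∑ i : Fin j → Fin d,
    ⨅ (g : E d → ℝ) (_ : HasWeakDeriv D i u g), l2Sq volume D g) ^ (1 / 2 : ℝ)

/-- `G` is the weak gradient of `w` on the open set `D`. -/
def HasWeakGrad {d : ℕ} (D : Set (E d)) (w : E d → ℝ) (G : E d → E d) : Prop :=
  ∀ j : Fin d, HasWeakDeriv D (fun _ : Fin 1 => j) w (fun x => G x j)

/-! ### Traces on hypersurfaces -/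

/-- The `(d-1)`-dimensional surface measure on `ℝ^d`. -/
abbrev surf (d : ℕ) : Measure (E d) := Measure.euclideanHausdorffMeasure (d - 1)

/-- `T ∈ L²(S)` is the trace on the hypersurface `S ⊆ closure D` of `w ∈ H¹(D)`: there are smooth
functions `φ n` that tend to `w` in `H¹(D)` and whose restrictions to `S` tend to `T` in
`L²(S)`. -/
def IsTrace {d : ℕ} (D S : Set (E d)) (w T : E d → ℝ) : Prop :=
  MemLp T 2 ((surf d).restrict S) ∧
    ∃ G : E d → E d, HasWeakGrad D w G ∧
      ∃ φ : ℕ → E d → ℝ, (∀ n, ContDiff ℝ ∞ (φ n)) ∧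
        Tendsto (fun n => l2Sq volume D (fun x => φ n x - w x)) atTop (𝓝 0) ∧
        Tendsto (fun n => l2Sq volume D (fun x => ∇ (φ n) x - G x)) atTop (𝓝 0) ∧
        Tendsto (fun n => l2Sq (surf d) S (fun x => φ n x - T x)) atTop (𝓝 0)

/-- The vector field `T` is on `S` the trace of the gradient of `w ∈ H²(D)`. -/
def IsGradTrace {d : ℕ} (D S : Set (E d)) (w : E d → ℝ) (T : E d → E d) : Prop :=
  ∃ G : E d → E d, HasWeakGrad D w G ∧ ∀ j : Fin d, IsTrace D S (fun x => G x j) (fun x => T x j)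

/-! ### Triangulations -/

/-- A (conforming) triangulation of `Ω`: a finite simplicial complex that covers `closure Ω` and
in which each simplex is a face of a `d`-dimensional one. Simplices are given by their vertex
sets. -/
structure Mesh {d : ℕ} (Ω : Set (E d)) where
  complex : Geometry.SimplicialComplex ℝ (E d)
  finite_faces : complex.faces.Finite
  pure : ∀ s ∈ complex.faces, ∃ t ∈ complex.faces, s ⊆ t ∧ t.card = d + 1
  space_eq : complex.space = closure Ω

/-- The closed simplex with vertex set `s`. -/
def hull {d : ℕ} (s : Finset (E d)) : Set (E d) := convexHull ℝ (s : Set (E d))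

/-- The open `d`-dimensional simplex with vertex set `K`. -/
def cell {d : ℕ} (K : Finset (E d)) : Set (E d) := interior (hull K)

/-- The diameter of the simplex with vertex set `s` (written `h_K` or `h_e`). -/
def diam {d : ℕ} (s : Finset (E d)) : ℝ := Metric.diam (hull s)

/-- The radius `ρ_K` of the largest ball inscribed in the simplex with vertex set `K`. -/
def inradius {d : ℕ} (K : Finset (E d)) : ℝ :=
  sSup {r : ℝ | ∃ x, Metric.closedBall x r ⊆ hull K}

namespace Mesh

variable {d : ℕ} {Ω : Set (E d)}

/-- The set of elements, that is, of `d`-dimensional simplices. -/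
def elements (𝒯 : Mesh Ω) : Finset (Finset (E d)) :=
  {s ∈ 𝒯.finite_faces.toFinset | s.card = d + 1}

/-- The set of `(d-1)`-dimensional faces. -/
def facets (𝒯 : Mesh Ω) : Finset (Finset (E d)) :=
  {s ∈ 𝒯.finite_faces.toFinset | s.card = d}

open Classical in
/-- The elements that have `e` as a face: two if `e` is an interior face, one if it is a boundary
face. -/
def neighbours (𝒯 : Mesh Ω) (e : Finset (E d)) : Finset (Finset (E d)) :=
  {K ∈ 𝒯.elements | e ⊆ K}

/-- The mesh size `h`, the largest diameter of an element. -/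
def size (𝒯 : Mesh Ω) : ℝ := sSup (diam '' (𝒯.elements : Set (Finset (E d))))

/-- Quasi-uniformity with constant `σ`. -/
def IsQuasiUniform (𝒯 : Mesh Ω) (σ : ℝ) : Prop :=
  ∀ K ∈ 𝒯.elements, 𝒯.size ≤ σ * inradius K

open Classical in
/-- The elements that lie in subdomain `i`. -/
def inner (𝒯 : Mesh Ω) (Ω₀ : Set (E d)) (i : Fin 2) : Finset (Finset (E d)) :=
  {K ∈ 𝒯.elements | cell K ⊆ subdomain Ω Ω₀ i}

open Classical in
/-- The elements that are cut by the interface `Γ = ∂Ω₀`. -/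
def cut (𝒯 : Mesh Ω) (Ω₀ : Set (E d)) : Finset (Finset (E d)) :=
  {K ∈ 𝒯.elements | (cell K ∩ frontier Ω₀).Nonempty}

/-- `Δ(K)`, the set of elements that touch `K`. -/
def touching (𝒯 : Mesh Ω) (K : Finset (E d)) : Set (Finset (E d)) :=
  {K' | K' ∈ 𝒯.elements ∧ (hull K' ∩ hull K).Nonempty}

/-- `A` assigns to each cut element `K` and each `i` an element `K°_i ∈ Δ(K)` which lies in
subdomain `i`. -/
def IsAssignment (𝒯 : Mesh Ω) (Ω₀ : Set (E d)) (A : Fin 2 → Finset (E d) → Finset (E d)) : Prop :=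
  ∀ K ∈ 𝒯.cut Ω₀, ∀ i, A i K ∈ 𝒯.touching K ∧ A i K ∈ 𝒯.inner Ω₀ i

end Mesh

/-! ### The extended finite element space -/

/-- The two choices for the finite element space on the elements inside a subdomain. -/
inductive SpaceKind
  | continuous
  | discontinuous

/-- On `S`, the function `v` is equal to the polynomial `p`. -/
def EqPolyOn {d : ℕ} (v : E d → ℝ) (p : MvPolynomial (Fin d) ℝ) (S : Set (E d)) : Prop :=
  ∀ x ∈ S, v x = MvPolynomial.eval (fun j => x j) p

/-- The space `V_{h,i}^{m,∘}` of functions that are polynomials of degree at most `m` on each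
element inside subdomain `i` and, for the `C⁰` space, are continuous on the union of these
(closed) elements. Values elsewhere are irrelevant. -/
def innerSpace {d : ℕ} {Ω : Set (E d)} (𝒯 : Mesh Ω) (Ω₀ : Set (E d)) (m : ℕ) (κ : SpaceKind)
    (i : Fin 2) : Set (E d → ℝ) :=
  {v | (∀ K ∈ 𝒯.inner Ω₀ i, ∃ p : MvPolynomial (Fin d) ℝ, p.totalDegree ≤ m ∧
          EqPolyOn v p (cell K)) ∧
       (κ = SpaceKind.continuous → ContinuousOn v (⋃ K ∈ 𝒯.inner Ω₀ i, hull K))}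

/-- `w = E_h(v 0, v 1)` (up to a null set): on an element inside subdomain `i` it is `v i`; on the
part in subdomain `i` of a cut element `K` it is the polynomial that is equal to `v i` on
`K°_i = A i K`. -/
def IsExtension {d : ℕ} {Ω : Set (E d)} (𝒯 : Mesh Ω) (Ω₀ : Set (E d)) (m : ℕ)
    (A : Fin 2 → Finset (E d) → Finset (E d)) (v : Fin 2 → E d → ℝ) (w : E d → ℝ) : Prop :=
  (∀ i, ∀ K ∈ 𝒯.inner Ω₀ i, EqOn w (v i) (cell K)) ∧
  (∀ i, ∀ K ∈ 𝒯.cut Ω₀, ∃ p : MvPolynomial (Fin d) ℝ, p.totalDegree ≤ m ∧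
      EqPolyOn (v i) p (cell (A i K)) ∧ EqPolyOn w p (cell K ∩ subdomain Ω Ω₀ i))

/-- The approximation space `V_h^m`: the image of `V_{h,0}^{m,∘} × V_{h,1}^{m,∘}` under the
extension operator `E_h`. -/
def extSpace {d : ℕ} {Ω : Set (E d)} (𝒯 : Mesh Ω) (Ω₀ : Set (E d)) (m : ℕ) (κ : Fin 2 → SpaceKind)
    (A : Fin 2 → Finset (E d) → Finset (E d)) : Set (E d → ℝ) :=
  {w | ∃ v : Fin 2 → E d → ℝ, (∀ i, v i ∈ innerSpace 𝒯 Ω₀ m (κ i) i) ∧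
    IsExtension 𝒯 Ω₀ m A v w}

/-! ### The energy norm

In the definitions below the weak gradients and the traces of `w` are unique almost everywhere, so
that each infimum is over one value (it is `∞` if a gradient or a trace does not exist). -/

section Energy

variable {d : ℕ} {Ω : Set (E d)}

/-- `K^i = K ∩ Ω_i`. -/
def part (Ω Ω₀ : Set (E d)) (K : Finset (E d)) (i : Fin 2) : Set (E d) :=
  cell K ∩ subdomain Ω Ω₀ i

/-- `e^i`, the part of the face `e` in subdomain `i`. -/
def facePart (Ω Ω₀ : Set (E d)) (e : Finset (E d)) (i : Fin 2) : Set (E d) :=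
  hull e ∩ faceRegion Ω Ω₀ i

/-- `Γ_K = K ∩ Γ`. -/
def interfacePart (Ω₀ : Set (E d)) (K : Finset (E d)) : Set (E d) :=
  cell K ∩ frontier Ω₀

/-- `n` is the unit normal vector on the face `e` of `K` that points out of `K`. -/
def IsOutwardNormal (K e : Finset (E d)) (n : E d) : Prop :=
  ‖n‖ = 1 ∧ (∀ x ∈ e, ∀ y ∈ e, inner ℝ n (y - x) = 0) ∧
    ∀ x ∈ e, ∀ z ∈ K, inner ℝ n (z - x) ≤ 0

/-- The outward unit normal vector of `K` on its face `e`. -/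
def outwardNormal (K e : Finset (E d)) : E d := Classical.epsilon (IsOutwardNormal K e)

/-- `‖∇w‖²_{L²(D)}`. -/
def gradSq (D : Set (E d)) (w : E d → ℝ) : ℝ≥0∞ :=
  ⨅ (G : E d → E d) (_ : HasWeakGrad D w G), l2Sq volume D G

/-- `‖{∇w}‖²_{L²(e^i)}`: the average is the mean of the traces from the two elements that share
`e`, or the trace from the one element if `e` is a boundary face. -/
def faceAverSq (𝒯 : Mesh Ω) (Ω₀ : Set (E d)) (e : Finset (E d)) (i : Fin 2) (w : E d → ℝ) :
    ℝ≥0∞ :=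
  ⨅ (T : Finset (E d) → E d → E d)
    (_ : ∀ K ∈ 𝒯.neighbours e, IsGradTrace (part Ω Ω₀ K i) (facePart Ω Ω₀ e i) w (T K)),
    l2Sq (surf d) (facePart Ω Ω₀ e i)
      (fun x => ((𝒯.neighbours e).card : ℝ)⁻¹ • ∑ K ∈ 𝒯.neighbours e, T K x)

/-- `‖[w]‖²_{L²(e^i)}`: the jump is the sum of `w|_K n_K` over the one or two elements `K` that
have `e` as a face. -/
def faceJumpSq (𝒯 : Mesh Ω) (Ω₀ : Set (E d)) (e : Finset (E d)) (i : Fin 2) (w : E d → ℝ) :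
    ℝ≥0∞ :=
  ⨅ (T : Finset (E d) → E d → ℝ)
    (_ : ∀ K ∈ 𝒯.neighbours e, IsTrace (part Ω Ω₀ K i) (facePart Ω Ω₀ e i) w (T K)),
    l2Sq (surf d) (facePart Ω Ω₀ e i)
      (fun x => ∑ K ∈ 𝒯.neighbours e, T K x • outwardNormal K e)

/-- `‖{∇w}‖²_{L²(Γ_K)}`: the mean of the traces from `K^0` and from `K^1`. -/
def interfaceAverSq (Ω Ω₀ : Set (E d)) (K : Finset (E d)) (w : E d → ℝ) : ℝ≥0∞ :=
  ⨅ (T : Fin 2 → E d → E d)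
    (_ : ∀ i, IsGradTrace (part Ω Ω₀ K i) (interfacePart Ω₀ K) w (T i)),
    l2Sq (surf d) (interfacePart Ω₀ K) (fun x => (1 / 2 : ℝ) • (T 0 x + T 1 x))

/-- `‖[w]‖²_{L²(Γ_K)}`: the jump is `(w⁰ - w¹) n` with a unit vector `n`, and its Euclidean norm is
`|w⁰ - w¹|`. -/
def interfaceJumpSq (Ω Ω₀ : Set (E d)) (K : Finset (E d)) (w : E d → ℝ) : ℝ≥0∞ :=
  ⨅ (T : Fin 2 → E d → ℝ)
    (_ : ∀ i, IsTrace (part Ω Ω₀ K i) (interfacePart Ω₀ K) w (T i)),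
    l2Sq (surf d) (interfacePart Ω₀ K) (fun x => T 0 x - T 1 x)

/-- The energy norm of a piecewise `H²` function `w`. -/
def energyNorm (𝒯 : Mesh Ω) (Ω₀ : Set (E d)) (w : E d → ℝ) : ℝ≥0∞ :=
  ((∑ K ∈ 𝒯.elements, ∑ i, gradSq (part Ω Ω₀ K i) w)
    + (∑ e ∈ 𝒯.facets, ∑ i, ENNReal.ofReal (diam e) * faceAverSq 𝒯 Ω₀ e i w)
    + (∑ e ∈ 𝒯.facets, ∑ i, ENNReal.ofReal (diam e)⁻¹ * faceJumpSq 𝒯 Ω₀ e i w)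
    + (∑ K ∈ 𝒯.cut Ω₀, ENNReal.ofReal (diam K) * interfaceAverSq Ω Ω₀ K w)
    + (∑ K ∈ 𝒯.cut Ω₀, ENNReal.ofReal (diam K)⁻¹ * interfaceJumpSq Ω Ω₀ K w)) ^ (1 / 2 : ℝ)

end Energy

end UnfittedFEM

end

namespace UnfittedFEM

/-! ### Squared `L²` norms -/

section L2

variable {d : ℕ} {F : Type*} [NormedAddCommGroup F]

/-! The errors are estimated on patches and never on the cut pieces `K ∩ Ω_i`, whose shape is
uncontrolled. For each vertex `z` of an element inside subdomain `i` there is an open set `W ⊆ Ω_i`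
that is star-shaped with respect to a ball of radius comparable to `h`, has size `O(h)`, and
contains all points of `Ω_i` within `3h` of `z` (`IsInterfaceRadius.exists_isPatch`). Near the
interface `W` is a one-sided ball; this works for small `h`, because the boundary satisfies a
uniform cone condition with small slope (`exists_coneAt`). Away from the interface `W` is the convex
set `Ω ∩ B(z, 3h)`. Since patches stay on one side, `u` need not be extended across the interface.

On a star-shaped set the analysis rests on one Schur type estimate for averages over segments,
`lintegral_sq_segment_le`, which asks of the measure only an upper growth bound of dimension `d -
1`. For Lebesgue measure it gives approximation by averaged Taylor polynomials, simultaneously for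
all derivatives up to order two (`exists_isPoly_approx`). For surface measure on a piece that is a
flat graph it gives the trace inequality (`trace_inequality`). Both are proved for smooth functions
and passed to Sobolev functions by density (`exists_smooth_tendsto`: dilate towards the centre, then
mollify). Traces from a cut piece are bounded through the whole patch, so the constants do not
depend on the position of the cut.

The discrete function is a quasi-interpolant. Let `P z` be the local polynomial at the vertex `z`,
and put on an inner element `K` the function `∑ λ_z (P z + (1/m) ∇(P z) ⬝ (z - x))` with barycentric
coordinates `λ_z`. By Euler's identity the bracket has degree `m - 1`, so the sum has degree `m`.
Because `∑ λ_z (z - x) = 0`, the formula reproduces a polynomial that is common to all vertices. On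
a shared face only the shared vertices contribute, so the result is continuous; it therefore serves
the continuous and the discontinuous space alike. On a cut element the polynomial of the assigned
inner element is used. Its error on a patch is controlled because all patches at the vertices of
that element share its inscribed ball, and inverse estimates carry differences of polynomials from
that ball to the whole patch (`exists_fePoly_error`).

The local bounds are summed in `BoundedOnParts.energyNorm_sq_le`, and a packing argument with
disjoint inscribed balls bounds the overlap of the patches (`sum_l2Sq_patches_le`). A parameter `δ >
0`, which comes from the density argument, tends to zero at the end. -/

theorem l2Sq_eq_eLpNorm_sq (μ : Measure (E d)) (S : Set (E d)) (f : E d → F) :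
    l2Sq μ S f = eLpNorm f 2 (μ.restrict S) ^ 2 := by
  have h := eLpNorm_nnreal_pow_eq_lintegral (μ := μ.restrict S) (f := f) (p := 2) two_ne_zero
  simp only [NNReal.coe_ofNat, ENNReal.rpow_ofNat, ENNReal.coe_ofNat] at h
  rw [h, l2Sq]

theorem enorm_add_sq_le (a b : F) : ‖a + b‖ₑ ^ 2 ≤ 2 * ‖a‖ₑ ^ 2 + 2 * ‖b‖ₑ ^ 2 := by
  have h : ‖a + b‖₊ ^ 2 ≤ 2 * ‖a‖₊ ^ 2 + 2 * ‖b‖₊ ^ 2 := by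
    rw [← NNReal.coe_le_coe]
    push_cast
    have := norm_add_le a b
    nlinarith [norm_nonneg (a + b), norm_nonneg a, norm_nonneg b, sq_nonneg (‖a‖ - ‖b‖)]
  simp only [enorm_eq_nnnorm]
  exact_mod_cast h

theorem enorm_sub_sq_le (a b : F) : ‖a - b‖ₑ ^ 2 ≤ 2 * ‖a‖ₑ ^ 2 + 2 * ‖b‖ₑ ^ 2 := by
  simpa [sub_eq_add_neg] using enorm_add_sq_le a (-b)

theorem l2Sq_mono_set {μ : Measure (E d)} {S S' : Set (E d)} (h : S ⊆ S') (f : E d → F) :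
    l2Sq μ S f ≤ l2Sq μ S' f :=
  lintegral_mono_set h

theorem l2Sq_congr {μ : Measure (E d)} {S : Set (E d)} (hS : MeasurableSet S) {f g : E d → F}
    (h : EqOn f g S) : l2Sq μ S f = l2Sq μ S g :=
  setLIntegral_congr_fun hS fun x hx => by simp only [h hx]

theorem l2Sq_sub_le {μ : Measure (E d)} {S : Set (E d)} {f g : E d → F}
    (hf : AEStronglyMeasurable f (μ.restrict S)) :
    l2Sq μ S (fun x => f x - g x) ≤ 2 * l2Sq μ S f + 2 * l2Sq μ S g := by
  calc l2Sq μ S (fun x => f x - g x)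
      ≤ ∫⁻ x in S, (2 * ‖f x‖ₑ ^ 2 + 2 * ‖g x‖ₑ ^ 2) ∂μ := lintegral_mono fun x => enorm_sub_sq_le _ _
    _ = _ := by
      rw [lintegral_add_left' ((hf.enorm.pow_const 2).const_mul 2), lintegral_const_mul' _ _ (by simp),
        lintegral_const_mul' _ _ (by simp)]
      rfl

theorem l2Sq_add_le {μ : Measure (E d)} {S : Set (E d)} {f g : E d → F}
    (hf : AEStronglyMeasurable f (μ.restrict S)) :
    l2Sq μ S (fun x => f x + g x) ≤ 2 * l2Sq μ S f + 2 * l2Sq μ S g := by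
  calc l2Sq μ S (fun x => f x + g x)
      ≤ ∫⁻ x in S, (2 * ‖f x‖ₑ ^ 2 + 2 * ‖g x‖ₑ ^ 2) ∂μ := lintegral_mono fun x => enorm_add_sq_le _ _
    _ = _ := by
      rw [lintegral_add_left' ((hf.enorm.pow_const 2).const_mul 2), lintegral_const_mul' _ _ (by simp),
        lintegral_const_mul' _ _ (by simp)]
      rfl

theorem l2Sq_sub_comm {μ : Measure (E d)} {S : Set (E d)} (f g : E d → F) :
    l2Sq μ S (fun x => f x - g x) = l2Sq μ S (fun x => g x - f x) := by
  simp only [l2Sq, enorm_sub_rev]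

theorem memLp_two_iff {μ : Measure (E d)} {S : Set (E d)} {f : E d → F}
    (hf : AEStronglyMeasurable f (μ.restrict S)) :
    MemLp f 2 (μ.restrict S) ↔ l2Sq μ S f < ⊤ := by
  rw [l2Sq_eq_eLpNorm_sq, ENNReal.pow_lt_top_iff, MemLp]
  simp [hf]

theorem l2Sq_lt_top {μ : Measure (E d)} {S : Set (E d)} {f : E d → F}
    (hf : MemLp f 2 (μ.restrict S)) : l2Sq μ S f < ⊤ :=
  (memLp_two_iff hf.1).1 hf

theorem memLp_of_continuous {μ : Measure (E d)} {S : Set (E d)} [IsFiniteMeasure (μ.restrict S)]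
    (hS : Bornology.IsBounded S) (hm : MeasurableSet S) {f : E d → ℝ} (hf : Continuous f) :
    MemLp f 2 (μ.restrict S) := by
  obtain ⟨C, hC⟩ := (hS.isCompact_closure.image hf).isBounded.exists_norm_le
  refine MemLp.of_bound hf.aestronglyMeasurable C ?_
  filter_upwards [ae_restrict_mem hm] with x hx
  exact hC _ ⟨x, subset_closure hx, rfl⟩

/-- `f n` tends to `w` in `L²(S; μ)`. -/
def L2Tendsto (μ : Measure (E d)) (S : Set (E d)) (f : ℕ → E d → ℝ) (w : E d → ℝ) : Prop :=
  Tendsto (fun n => l2Sq μ S (fun x => f n x - w x)) atTop (𝓝 0)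

theorem L2Tendsto.mono {μ : Measure (E d)} {S S' : Set (E d)} {f : ℕ → E d → ℝ} {w : E d → ℝ}
    (h : L2Tendsto μ S' f w) (hS : S ⊆ S') : L2Tendsto μ S f w :=
  tendsto_of_tendsto_of_tendsto_of_le_of_le tendsto_const_nhds h (fun _ => bot_le)
    fun _ => l2Sq_mono_set hS _

theorem L2Tendsto.tendsto_eLpNorm {μ : Measure (E d)} {S : Set (E d)} {f : ℕ → E d → ℝ} {w : E d → ℝ}
    (h : L2Tendsto μ S f w) :
    Tendsto (fun n => eLpNorm (fun x => f n x - w x) 2 (μ.restrict S)) atTop (𝓝 0) := by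
  have h2 := (ENNReal.continuous_rpow_const (y := 1 / 2)).continuousAt.tendsto.comp h
  simp only [one_div, Function.comp_def, l2Sq_eq_eLpNorm_sq] at h2
  rw [ENNReal.zero_rpow_of_pos (by norm_num)] at h2
  refine h2.congr fun n => ?_
  rw [← ENNReal.rpow_natCast, ← ENNReal.rpow_mul]
  simp

/-- Continuity of the norm: the triangle inequality in both directions squeezes the norms of the `f
n`. Estimates for smooth functions reach their limits in this way. -/
theorem l2Sq_le_of_L2Tendsto {μ : Measure (E d)} {S : Set (E d)} {f : ℕ → E d → ℝ} {w : E d → ℝ}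
    (hf : ∀ n, AEStronglyMeasurable (f n) (μ.restrict S)) (hw : AEStronglyMeasurable w (μ.restrict S))
    (h : L2Tendsto μ S f w) :
    Tendsto (fun n => l2Sq μ S (f n)) atTop (𝓝 (l2Sq μ S w)) := by
  have h1 := h.tendsto_eLpNorm
  have key : Tendsto (fun n => eLpNorm (f n) 2 (μ.restrict S)) atTop
      (𝓝 (eLpNorm w 2 (μ.restrict S))) := by
    have hup : ∀ n, eLpNorm (f n) 2 (μ.restrict S) ≤
        eLpNorm w 2 (μ.restrict S) +
          eLpNorm (fun x => f n x - w x) 2 (μ.restrict S) := fun n => by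
      have := eLpNorm_add_le hw ((hf n).sub hw) (p := 2) (by norm_num)
      simpa using! this
    have hlo : ∀ n, eLpNorm w 2 (μ.restrict S) -
          eLpNorm (fun x => f n x - w x) 2 (μ.restrict S) ≤
        eLpNorm (f n) 2 (μ.restrict S) := fun n => by
      rw [tsub_le_iff_right]
      have := eLpNorm_sub_le (hf n) ((hf n).sub hw) (p := 2) (by norm_num)
      simpa using! this
    refine tendsto_of_tendsto_of_tendsto_of_le_of_le ?_ ?_ hlo hup
    · simpa using ENNReal.Tendsto.sub tendsto_const_nhds h1 (Or.inr (by simp))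
    · simpa using tendsto_const_nhds.add h1
  simp only [l2Sq_eq_eLpNorm_sq]
  exact (ENNReal.continuous_pow 2).continuousAt.tendsto.comp key

end L2

/-! ### Partial derivatives -/

section Partial

variable {d : ℕ}

/-- The partial derivative `∂_k f`. -/
noncomputable def pd (k : Fin d) (f : E d → ℝ) : E d → ℝ := fun x => fderiv ℝ f x (EuclideanSpace.single k 1)

/-- The iterated partial derivative `∂_{i 0} ⋯ ∂_{i (j-1)} f`. -/
noncomputable def pds {j : ℕ} (i : Fin j → Fin d) (f : E d → ℝ) : E d → ℝ :=
  fun x => iteratedFDeriv ℝ j f x (fun l => EuclideanSpace.single (i l) (1 : ℝ))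

theorem contDiff_pd {f : E d → ℝ} (hf : ContDiff ℝ ∞ f) (k : Fin d) : ContDiff ℝ ∞ (pd k f) :=
  (hf.fderiv_right (m := ∞) (by simp)).clm_apply contDiff_const

theorem pds_zero (i : Fin 0 → Fin d) (f : E d → ℝ) : pds i f = f := by
  ext x; simp [pds]

/-- The last index is the innermost derivative. Inductions on the order thus replace `f` by a
partial derivative, which is again smooth. -/
theorem pds_succ {j : ℕ} (i : Fin (j + 1) → Fin d) {f : E d → ℝ} (hf : ContDiff ℝ ∞ f) :
    pds i f = pds (Fin.init i) (pd (i (Fin.last j)) f) := by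
  ext x
  rw [pds, iteratedFDeriv_succ_apply_right]
  have h1 : ContDiff ℝ ∞ (fderiv ℝ f) := hf.fderiv_right (m := ∞) (by simp)
  have := ((ContinuousLinearMap.apply ℝ ℝ
    (EuclideanSpace.single (i (Fin.last j)) (1 : ℝ))).iteratedFDeriv_comp_left (f := fderiv ℝ f)
      (x := x) (i := j) (n := ∞) h1.contDiffAt (by exact_mod_cast le_top))
  simp only [pds]
  rw [show pd (i (Fin.last j)) f = (ContinuousLinearMap.apply ℝ ℝ
    (EuclideanSpace.single (i (Fin.last j)) (1 : ℝ))) ∘ fderiv ℝ f from rfl, this]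
  rfl

theorem pds_snoc {j : ℕ} (i : Fin j → Fin d) (k : Fin d) {f : E d → ℝ} (hf : ContDiff ℝ ∞ f) :
    pds (Fin.snoc i k : Fin (j + 1) → Fin d) f = pds i (pd k f) := by
  rw [pds_succ _ hf]; simp

theorem pds_one (k : Fin d) (f : E d → ℝ) : pds (fun _ : Fin 1 => k) f = pd k f := by
  ext x; simp [pds, pd, iteratedFDeriv_one_apply]

theorem contDiff_pds {j : ℕ} (i : Fin j → Fin d) {f : E d → ℝ} (hf : ContDiff ℝ ∞ f) :
    ContDiff ℝ ∞ (pds i f) := by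
  induction j generalizing f with
  | zero => rwa [pds_zero]
  | succ j ih => rw [pds_succ _ hf]; exact ih _ (contDiff_pd hf _)

theorem pd_comm (k l : Fin d) {f : E d → ℝ} (hf : ContDiff ℝ ∞ f) :
    pd k (pd l f) = pd l (pd k f) := by
  have h1 : ContDiff ℝ ∞ (fderiv ℝ f) := hf.fderiv_right (m := ∞) (by simp)
  have key : ∀ a b : Fin d, ∀ x, pd a (pd b f) x =
      fderiv ℝ (fderiv ℝ f) x (EuclideanSpace.single a 1) (EuclideanSpace.single b 1) := by
    intro a b x
    have h2 : DifferentiableAt ℝ (fderiv ℝ f) x := h1.contDiffAt.differentiableAt (by simp)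
    have : HasFDerivAt (pd b f) _ x :=
      h2.hasFDerivAt.clm_apply (hasFDerivAt_const (EuclideanSpace.single b (1 : ℝ)) x)
    rw [pd, this.fderiv]
    simp
  ext x
  rw [key, key]
  exact (hf.contDiffAt.isSymmSndFDerivAt (by simpa using WithTop.coe_le_coe.2 (le_top : (2 : ℕ∞) ≤ ⊤))) _ _

theorem pds_two (k l : Fin d) {f : E d → ℝ} (hf : ContDiff ℝ ∞ f) :
    pds ![k, l] f = pd k (pd l f) := by
  rw [pds_succ _ hf, ← pds_one k]
  congr 1
  ext a
  fin_cases a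
  simp [Fin.init]

theorem pd_sub (k : Fin d) {f g : E d → ℝ} (hf : ContDiff ℝ ∞ f) (hg : ContDiff ℝ ∞ g) :
    pd k (fun x => f x - g x) = fun x => pd k f x - pd k g x := by
  ext x
  have h := (hf.contDiffAt (x := x)).differentiableAt (by simp)
  have h' := (hg.contDiffAt (x := x)).differentiableAt (by simp)
  simp only [pd]
  rw [fderiv_fun_sub h h']
  rfl

theorem pds_sub {j : ℕ} (i : Fin j → Fin d) {f g : E d → ℝ} (hf : ContDiff ℝ ∞ f)
    (hg : ContDiff ℝ ∞ g) :
    pds i (fun x => f x - g x) = fun x => pds i f x - pds i g x := by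
  induction j generalizing f g with
  | zero => simp [pds_zero]
  | succ j ih =>
    rw [pds_succ _ (hf.sub hg), pds_succ _ hf, pds_succ _ hg, pd_sub _ hf hg,
      ih _ (contDiff_pd hf _) (contDiff_pd hg _)]

theorem fderiv_apply_eq_sum_pd (f : E d → ℝ) (x v : E d) :
    fderiv ℝ f x v = ∑ k, v k * pd k f x := by
  have hv : v = ∑ k, v k • (EuclideanSpace.single k (1 : ℝ) : E d) := by
    ext j
    simp [Finset.sum_apply, Pi.single_apply]
  conv_lhs => rw [hv]
  simp [pd]

theorem gradient_apply (f : E d → ℝ) (x : E d) (k : Fin d) : (∇ f x) k = pd k f x := by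
  have := InnerProductSpace.toDual_symm_apply (x := EuclideanSpace.single k (1 : ℝ))
    (y := fderiv ℝ f x)
  rw [pd, ← this, EuclideanSpace.inner_single_right]
  simp [gradient]

theorem enorm_sq_eq_sum (v : E d) : ‖v‖ₑ ^ 2 = ∑ k, ‖v k‖ₑ ^ 2 := by
  have h : ‖v‖₊ ^ 2 = ∑ k, ‖v k‖₊ ^ 2 := by
    rw [← NNReal.coe_inj]
    push_cast
    exact EuclideanSpace.norm_sq_eq v
  simp only [enorm_eq_nnnorm]
  exact_mod_cast h

theorem enorm_apply_le (v : E d) (k : Fin d) : ‖v k‖ₑ ≤ ‖v‖ₑ := by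
  have := EuclideanSpace.norm_eq v ▸ Real.le_sqrt_of_sq_le (x := ‖v k‖)
    (Finset.single_le_sum (f := fun k => ‖v k‖ ^ 2) (fun i _ => sq_nonneg _) (Finset.mem_univ k))
  rw [enorm_eq_nnnorm, enorm_eq_nnnorm]
  exact_mod_cast this

theorem l2Sq_vector (μ : Measure (E d)) (S : Set (E d)) {f : E d → E d}
    (hf : ∀ k, AEStronglyMeasurable (fun x => f x k) (μ.restrict S)) :
    l2Sq μ S f = ∑ k, l2Sq μ S (fun x => f x k) := by
  simp only [l2Sq, enorm_sq_eq_sum]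
  rw [lintegral_finsetSum' _ fun k _ => (hf k).enorm.pow_const 2]

end Partial

/-! ### Sets that are star-shaped with respect to a ball -/

section Star

variable {d : ℕ}

/-- Each point of the ball `B(b, r)` is joined to `x` by a segment that lies in `W`, except perhaps
for the point `x` itself. -/
def Sees (W : Set (E d)) (b : E d) (r : ℝ) (x : E d) : Prop :=
  ∀ y ∈ Metric.ball b r, ∀ t ∈ Ioc (0 : ℝ) 1, x + t • (y - x) ∈ W

/-- The open set `W ⊆ B(b, R)` is star-shaped with respect to the ball `B(b, r)`. -/
structure StarPatch (W : Set (E d)) (b : E d) (r R : ℝ) : Prop where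
  isOpen : IsOpen W
  pos : 0 < r
  subset : W ⊆ Metric.ball b R
  ball_subset : Metric.ball b r ⊆ W
  star : ∀ x ∈ W, Sees W b r x

theorem lintegral_ofReal_rpow_neg_half :
    ∫⁻ t in Ioc (0 : ℝ) 1, ENNReal.ofReal (t ^ (-(1 / 2) : ℝ)) = 2 := by
  have hi : IntervalIntegrable (fun t : ℝ => t ^ (-(1 / 2) : ℝ)) volume 0 1 :=
    intervalIntegral.intervalIntegrable_rpow' (by norm_num)
  rw [← ofReal_integral_eq_lintegral_ofReal
    ((intervalIntegrable_iff_integrableOn_Ioc_of_le zero_le_one).1 hi)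
    ((ae_restrict_mem measurableSet_Ioc).mono fun t ht => Real.rpow_nonneg ht.1.le _),
    ← intervalIntegral.integral_of_le zero_le_one, integral_rpow (Or.inl (by norm_num))]
  norm_num

/-- Cauchy–Schwarz for `t^(-1/4)` and `t^(1/4) G`. The exponent is a compromise: `t^(-1/2)` must be
integrable here, and the weight `t^(1/2)` must still tame the factor `t⁻¹` that the estimate at
fixed `t` produces. -/
theorem sq_lintegral_Ioc_le {G : ℝ → ℝ≥0∞} (hG : Measurable G) :
    (∫⁻ t in Ioc (0 : ℝ) 1, G t) ^ 2 ≤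
      2 * ∫⁻ t in Ioc (0 : ℝ) 1, ENNReal.ofReal (t ^ (1 / 2 : ℝ)) * G t ^ 2 := by
  have h := ENNReal.lintegral_mul_le_Lp_mul_Lq (volume.restrict (Ioc (0 : ℝ) 1))
    (p := 2) (q := 2) Real.HolderConjugate.two_two
    (f := fun t => ENNReal.ofReal (t ^ (-(1 / 4) : ℝ)))
    (g := fun t => ENNReal.ofReal (t ^ (1 / 4 : ℝ)) * G t) (by fun_prop) (by fun_prop)
  have e1 : ∫⁻ t in Ioc (0 : ℝ) 1, G t = ∫⁻ t in Ioc (0 : ℝ) 1,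
      ((fun t => ENNReal.ofReal (t ^ (-(1 / 4) : ℝ))) *
        (fun t => ENNReal.ofReal (t ^ (1 / 4 : ℝ)) * G t)) t := by
    refine setLIntegral_congr_fun measurableSet_Ioc fun t ht => ?_
    simp only [Pi.mul_apply, ← mul_assoc]
    rw [← ENNReal.ofReal_mul (Real.rpow_nonneg ht.1.le _), ← Real.rpow_add ht.1]
    norm_num
  have e2 : ∫⁻ t in Ioc (0 : ℝ) 1, (ENNReal.ofReal (t ^ (-(1 / 4) : ℝ))) ^ (2 : ℝ) = 2 := by
    rw [← lintegral_ofReal_rpow_neg_half]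
    refine setLIntegral_congr_fun measurableSet_Ioc fun t ht => ?_
    rw [ENNReal.ofReal_rpow_of_nonneg (Real.rpow_nonneg ht.1.le _) (by norm_num),
      ← Real.rpow_mul ht.1.le]
    norm_num
  have e3 : ∫⁻ t in Ioc (0 : ℝ) 1, (ENNReal.ofReal (t ^ (1 / 4 : ℝ)) * G t) ^ (2 : ℝ) =
      ∫⁻ t in Ioc (0 : ℝ) 1, ENNReal.ofReal (t ^ (1 / 2 : ℝ)) * G t ^ 2 := by
    refine setLIntegral_congr_fun measurableSet_Ioc fun t ht => ?_
    rw [ENNReal.mul_rpow_of_nonneg _ _ (by norm_num),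
      ENNReal.ofReal_rpow_of_nonneg (Real.rpow_nonneg ht.1.le _) (by norm_num),
      ← Real.rpow_mul ht.1.le]
    norm_num
  rw [e2, e3, ← e1] at h
  calc _ ≤ _ := pow_le_pow_left' h 2
    _ = _ := by
      rw [mul_pow, ← ENNReal.rpow_natCast, ← ENNReal.rpow_natCast, ← ENNReal.rpow_mul,
        ← ENNReal.rpow_mul]
      norm_num

theorem lintegral_comp_add_smul_sub (x : E d) {t : ℝ} (ht : 0 < t) {F : E d → ℝ≥0∞}
    (hF : Measurable F) :
    ∫⁻ y, F (x + t • (y - x)) = ENNReal.ofReal (t ^ d)⁻¹ * ∫⁻ z, F z := by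
  have e : (fun y => F (x + t • (y - x))) = fun y => F ((x - t • x) + t • y) := by
    ext y; congr 1; rw [smul_sub]; abel
  rw [e]
  have h1 : ∫⁻ y : E d, F ((x - t • x) + t • y) =
      ∫⁻ z, F ((x - t • x) + z) ∂(Measure.map (fun y : E d => t • y) volume) := by
    rw [lintegral_map (by fun_prop) (by fun_prop)]
  rw [h1, Measure.map_addHaar_smul _ ht.ne', lintegral_smul_measure, finrank_euclideanSpace_fin,
    abs_of_pos (by positivity), lintegral_add_left_eq_self (μ := volume) F, smul_eq_mul]

/-- At fixed `t` the substitution `z = x + t (y - x)` costs `t^(-d)`, and `x` lies within `2Rt` of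
`z`. After exchanging the integrals, the growth of `μ` gives `(2Rt)^(d-1)`; the product leaves a
single `t⁻¹`. -/
theorem lintegral_lintegral_segment_le (hd : 1 ≤ d) {W : Set (E d)} {b : E d} {r R M : ℝ}
    (hW : MeasurableSet W) (hrR : r ≤ R) (hr : 0 < r)
    (μ : Measure (E d)) [SFinite μ]
    (hreg : ∀ z s, 0 ≤ s → s ≤ 2 * R → μ (Metric.closedBall z s) ≤ ENNReal.ofReal (M * s ^ (d - 1)))
    (hsee : ∀ᵐ x ∂μ, Sees W b r x ∧ x ∈ Metric.ball b R)
    {h : E d → ℝ≥0∞} (hh : Measurable h) {t : ℝ} (ht : t ∈ Ioc (0 : ℝ) 1) :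
    ∫⁻ x, ∫⁻ y in Metric.ball b r, h (x + t • (y - x)) ∂volume ∂μ ≤
      ENNReal.ofReal (M * (2 * R) ^ (d - 1) * t⁻¹) * ∫⁻ z in W, h z := by
  have hR : 0 < R := hr.trans_le hrR
  have step1 : ∀ᵐ x ∂μ, ∫⁻ y in Metric.ball b r, h (x + t • (y - x)) ≤
      ENNReal.ofReal (t ^ d)⁻¹ *
        ∫⁻ z in W, (Metric.closedBall z (2 * R * t)).indicator 1 x * h z := by
    filter_upwards [hsee] with x hx
    have hm : Measurable fun z : E d => (Metric.closedBall z (2 * R * t)).indicator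
        (1 : E d → ℝ≥0∞) x * h z := by
      refine Measurable.mul ?_ hh
      have : (fun z : E d => (Metric.closedBall z (2 * R * t)).indicator (1 : E d → ℝ≥0∞) x) =
          (Metric.closedBall x (2 * R * t)).indicator 1 := by
        ext z
        simp only [Set.indicator, Metric.mem_closedBall, dist_comm, Pi.one_apply]
      rw [this]
      exact measurable_one.indicator Metric.isClosed_closedBall.measurableSet
    calc ∫⁻ y in Metric.ball b r, h (x + t • (y - x))
        ≤ ∫⁻ y in Metric.ball b r, W.indicator (fun z =>
            (Metric.closedBall z (2 * R * t)).indicator 1 x * h z) (x + t • (y - x)) := by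
          refine setLIntegral_mono' Metric.isOpen_ball.measurableSet fun y hy => ?_
          rw [Set.indicator_of_mem (hx.1 y hy t ht), Set.indicator_of_mem]
          · simp
          · rw [Metric.mem_closedBall, dist_eq_norm, sub_add_cancel_left, norm_neg, norm_smul,
              Real.norm_of_nonneg ht.1.le, mul_comm]
            refine mul_le_mul_of_nonneg_right ?_ ht.1.le
            have h1 := Metric.mem_ball.1 hy
            have h2 := Metric.mem_ball.1 hx.2
            have h3 := dist_triangle_right y x b
            rw [← dist_eq_norm]
            linarith
      _ ≤ ∫⁻ y, W.indicator (fun z =>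
            (Metric.closedBall z (2 * R * t)).indicator 1 x * h z) (x + t • (y - x)) :=
          setLIntegral_le_lintegral _ _
      _ = _ := by
          rw [lintegral_comp_add_smul_sub x ht.1 (hm.indicator hW), lintegral_indicator hW]
  have hm2 : Measurable fun p : E d × E d =>
      (Metric.closedBall p.2 (2 * R * t)).indicator (1 : E d → ℝ≥0∞) p.1 * h p.2 := by
    refine Measurable.mul ?_ (hh.comp measurable_snd)
    have : (fun p : E d × E d => (Metric.closedBall p.2 (2 * R * t)).indicator
        (1 : E d → ℝ≥0∞) p.1) = {p : E d × E d | dist p.1 p.2 ≤ 2 * R * t}.indicator 1 := by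
      ext p
      simp only [Set.indicator, Metric.mem_closedBall, Set.mem_ofPred_eq, Pi.one_apply]
    rw [this]
    exact measurable_one.indicator (measurableSet_le (by fun_prop) measurable_const)
  calc _ ≤ ∫⁻ x, (ENNReal.ofReal (t ^ d)⁻¹ *
        ∫⁻ z in W, (Metric.closedBall z (2 * R * t)).indicator 1 x * h z) ∂μ :=
        lintegral_mono_ae step1
    _ = ENNReal.ofReal (t ^ d)⁻¹ * ∫⁻ z in W, ∫⁻ x,
          (Metric.closedBall z (2 * R * t)).indicator 1 x * h z ∂μ := by
        rw [lintegral_const_mul' _ _ (by simp), lintegral_lintegral_swap hm2.aemeasurable]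
    _ ≤ ENNReal.ofReal (t ^ d)⁻¹ * ∫⁻ z in W, ENNReal.ofReal (M * (2 * R * t) ^ (d - 1)) * h z := by
        gcongr with z
        rw [lintegral_mul_const _ (measurable_one.indicator Metric.isClosed_closedBall.measurableSet),
          lintegral_indicator_one Metric.isClosed_closedBall.measurableSet]
        gcongr
        have := ht.1
        exact hreg z _ (by positivity) (mul_le_of_le_one_right (by positivity) ht.2)
    _ = _ := by
        rw [lintegral_const_mul' _ _ (by simp), ← mul_assoc,
          ← ENNReal.ofReal_mul (inv_nonneg.2 (pow_nonneg ht.1.le _))]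
        congr 2
        obtain ⟨k, rfl⟩ : ∃ k, d = k + 1 := ⟨d - 1, by omega⟩
        have := ht.1.ne'
        simp only [Nat.add_sub_cancel]
        field_simp
        ring

/-- A Schur type estimate for averages over segments. The measure `μ` is upper Ahlfors regular of
dimension `d - 1`. -/
theorem lintegral_sq_segment_le (hd : 1 ≤ d) {W : Set (E d)} {b : E d} {r R M : ℝ}
    (hW : MeasurableSet W) (hrR : r ≤ R) (hM : 0 ≤ M) (hr : 0 < r)
    (μ : Measure (E d)) [SFinite μ]
    (hreg : ∀ z s, 0 ≤ s → s ≤ 2 * R → μ (Metric.closedBall z s) ≤ ENNReal.ofReal (M * s ^ (d - 1)))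
    (hsee : ∀ᵐ x ∂μ, Sees W b r x ∧ x ∈ Metric.ball b R)
    {g : E d → ℝ≥0∞} (hg : Measurable g) :
    ∫⁻ x, ∫⁻ y in Metric.ball b r, (∫⁻ t in Ioc (0 : ℝ) 1, g (x + t • (y - x))) ^ 2 ∂volume ∂μ ≤
      ENNReal.ofReal (4 * (M * (2 * R) ^ (d - 1))) * ∫⁻ z in W, g z ^ 2 := by
  have hR : 0 < R := hr.trans_le hrR
  set c := M * (2 * R) ^ (d - 1) with hc
  have hc0 : 0 ≤ c := by positivity
  have hmw : Measurable fun p : E d × E d × ℝ =>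
      ENNReal.ofReal (p.2.2 ^ (1 / 2 : ℝ)) * g (p.1 + p.2.2 • (p.2.1 - p.1)) ^ 2 := by
    fun_prop
  have hsw : ∀ x, ∫⁻ y in Metric.ball b r, ∫⁻ t in Ioc (0 : ℝ) 1,
        ENNReal.ofReal (t ^ (1 / 2 : ℝ)) * g (x + t • (y - x)) ^ 2 =
      ∫⁻ t in Ioc (0 : ℝ) 1, ∫⁻ y in Metric.ball b r,
        ENNReal.ofReal (t ^ (1 / 2 : ℝ)) * g (x + t • (y - x)) ^ 2 := fun x =>
    lintegral_lintegral_swap (hmw.comp (measurable_const.prodMk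
      (measurable_fst.prodMk measurable_snd) :
        Measurable fun q : E d × ℝ => (x, q.1, q.2))).aemeasurable
  have hmi : Measurable fun p : E d × ℝ => ∫⁻ y in Metric.ball b r,
        ENNReal.ofReal (p.2 ^ (1 / 2 : ℝ)) * g (p.1 + p.2 • (y - p.1)) ^ 2 := by
    have : Measurable fun q : (E d × ℝ) × E d =>
        ENNReal.ofReal (q.1.2 ^ (1 / 2 : ℝ)) * g (q.1.1 + q.1.2 • (q.2 - q.1.1)) ^ 2 := by
      fun_prop
    exact this.lintegral_prod_right'
  calc _ ≤ ∫⁻ x, ∫⁻ y in Metric.ball b r, 2 * ∫⁻ t in Ioc (0 : ℝ) 1,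
        ENNReal.ofReal (t ^ (1 / 2 : ℝ)) * g (x + t • (y - x)) ^ 2 ∂volume ∂volume ∂μ := by
        gcongr with x y
        exact sq_lintegral_Ioc_le (by fun_prop)
    _ = 2 * ∫⁻ x, ∫⁻ y in Metric.ball b r, ∫⁻ t in Ioc (0 : ℝ) 1,
        ENNReal.ofReal (t ^ (1 / 2 : ℝ)) * g (x + t • (y - x)) ^ 2 ∂volume ∂volume ∂μ := by
        simp_rw [lintegral_const_mul' (2 : ℝ≥0∞) _ (by simp)]
    _ = 2 * ∫⁻ t in Ioc (0 : ℝ) 1, ∫⁻ x, ∫⁻ y in Metric.ball b r,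
        ENNReal.ofReal (t ^ (1 / 2 : ℝ)) * g (x + t • (y - x)) ^ 2 ∂volume ∂μ ∂volume := by
        simp_rw [hsw]
        rw [lintegral_lintegral_swap hmi.aemeasurable]
    -- The weight `t^(1/2)` against `t⁻¹` leaves the integrable `t^(-1/2)`, whose integral is two.
    -- With the two of Cauchy–Schwarz this makes the constant four.
    _ ≤ 2 * ∫⁻ t in Ioc (0 : ℝ) 1, ENNReal.ofReal (t ^ (-(1 / 2) : ℝ)) *
          (ENNReal.ofReal c * ∫⁻ z in W, g z ^ 2) := by
        refine mul_le_mul' le_rfl (setLIntegral_mono' measurableSet_Ioc fun t ht => ?_)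
        simp_rw [lintegral_const_mul' _ _ (ENNReal.ofReal_ne_top (r := t ^ (1 / 2 : ℝ)))]
        calc _ ≤ ENNReal.ofReal (t ^ (1 / 2 : ℝ)) *
              (ENNReal.ofReal (c * t⁻¹) * ∫⁻ z in W, g z ^ 2) := by
              gcongr
              exact lintegral_lintegral_segment_le hd hW hrR hr μ hreg hsee (hg.pow_const 2) ht
          _ = _ := by
              rw [← mul_assoc, ← mul_assoc, ← ENNReal.ofReal_mul (Real.rpow_nonneg ht.1.le _),
                ← ENNReal.ofReal_mul (Real.rpow_nonneg ht.1.le _)]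
              congr 2
              rw [← Real.rpow_neg_one t, mul_left_comm, ← Real.rpow_add ht.1, mul_comm]
              norm_num
    _ = _ := by
        rw [lintegral_mul_const _ (by fun_prop), lintegral_ofReal_rpow_neg_half, ← mul_assoc,
          ← mul_assoc, ENNReal.ofReal_mul (by norm_num : (0 : ℝ) ≤ 4)]
        congr 2
        norm_num

end Star

/-! ### Polynomial functions -/

section Poly

variable {d : ℕ}

/-- The function `f` is a polynomial of total degree at most `m`. -/
def IsPoly (m : ℕ) (f : E d → ℝ) : Prop :=
  ∃ p : MvPolynomial (Fin d) ℝ, p.totalDegree ≤ m ∧ ∀ x, f x = MvPolynomial.eval (fun j => x j) p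

theorem IsPoly.mono {m n : ℕ} {f : E d → ℝ} (hf : IsPoly m f) (h : m ≤ n) : IsPoly n f :=
  let ⟨p, hp, e⟩ := hf; ⟨p, hp.trans h, e⟩

theorem isPoly_const (m : ℕ) (c : ℝ) : IsPoly m (fun _ : E d => c) :=
  ⟨MvPolynomial.C c, by simp, fun x => by simp⟩

theorem isPoly_coord (k : Fin d) : IsPoly 1 (fun x : E d => x k) :=
  ⟨MvPolynomial.X k, by simp, fun x => by simp⟩

theorem IsPoly.add {m : ℕ} {f g : E d → ℝ} (hf : IsPoly m f) (hg : IsPoly m g) :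
    IsPoly m (fun x => f x + g x) := by
  obtain ⟨p, hp, e⟩ := hf
  obtain ⟨q, hq, e'⟩ := hg
  exact ⟨p + q, (MvPolynomial.totalDegree_add _ _).trans (max_le hp hq), fun x => by simp [e, e']⟩

theorem IsPoly.mul {m n : ℕ} {f g : E d → ℝ} (hf : IsPoly m f) (hg : IsPoly n g) :
    IsPoly (m + n) (fun x => f x * g x) := by
  obtain ⟨p, hp, e⟩ := hf
  obtain ⟨q, hq, e'⟩ := hg
  exact ⟨p * q, (MvPolynomial.totalDegree_mul _ _).trans (add_le_add hp hq),
    fun x => by simp [e, e']⟩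

theorem IsPoly.const_mul {m : ℕ} {f : E d → ℝ} (hf : IsPoly m f) (c : ℝ) :
    IsPoly m (fun x => c * f x) := by
  simpa using (isPoly_const 0 c).mul hf

theorem IsPoly.sub {m : ℕ} {f g : E d → ℝ} (hf : IsPoly m f) (hg : IsPoly m g) :
    IsPoly m (fun x => f x - g x) := by
  simpa [sub_eq_add_neg] using hf.add (hg.const_mul (-1))

theorem IsPoly.sum {ι : Type*} {m : ℕ} (s : Finset ι) {f : ι → E d → ℝ}
    (hf : ∀ i ∈ s, IsPoly m (f i)) : IsPoly m (fun x => ∑ i ∈ s, f i x) := by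
  classical
  induction s using Finset.induction_on with
  | empty => simpa using isPoly_const m 0
  | insert a s ha ih =>
    simp only [Finset.sum_insert ha]
    exact (hf a (by simp)).add (ih fun i hi => hf i (by simp [hi]))

theorem IsPoly.contDiff {m : ℕ} {f : E d → ℝ} (hf : IsPoly m f) : ContDiff ℝ ∞ f := by
  obtain ⟨p, -, e⟩ := hf
  rw [funext e]
  clear e
  induction p using MvPolynomial.induction_on with
  | C a => simpa using contDiff_const
  | add p q hp hq => simpa using hp.add hq
  | mul_X p k hp =>
    simp only [map_mul, MvPolynomial.eval_X]
    exact hp.mul (by fun_prop)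

end Poly

/-! ### Taylor polynomials -/

section Taylor

variable {d : ℕ}

theorem pd_add (k : Fin d) {f g : E d → ℝ} (hf : ContDiff ℝ ∞ f) (hg : ContDiff ℝ ∞ g) :
    pd k (fun x => f x + g x) = fun x => pd k f x + pd k g x := by
  ext x
  have h := (hf.contDiffAt (x := x)).differentiableAt (by simp)
  have h' := (hg.contDiffAt (x := x)).differentiableAt (by simp)
  simp only [pd]
  rw [fderiv_fun_add h h']
  rfl

theorem pd_mul (k : Fin d) {f g : E d → ℝ} (hf : ContDiff ℝ ∞ f) (hg : ContDiff ℝ ∞ g) :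
    pd k (fun x => f x * g x) = fun x => pd k f x * g x + f x * pd k g x := by
  ext x
  have h := (hf.contDiffAt (x := x)).differentiableAt (by simp)
  have h' := (hg.contDiffAt (x := x)).differentiableAt (by simp)
  simp only [pd]
  rw [fderiv_fun_mul h h']
  simp
  ring

theorem pd_const (k : Fin d) (c : ℝ) : pd k (fun _ : E d => c) = fun _ => 0 := by
  ext x; simp [pd]

theorem pd_coord (k l : Fin d) : pd k (fun x : E d => x l) = fun _ => if l = k then 1 else 0 := by
  ext x
  have : HasFDerivAt (fun x : E d => x l) (EuclideanSpace.proj l : E d →L[ℝ] ℝ) x :=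
    (EuclideanSpace.proj l : E d →L[ℝ] ℝ).hasFDerivAt
  simp [pd, this.fderiv]

theorem contDiff_coord (l : Fin d) : ContDiff ℝ ∞ (fun x : E d => x l) := by fun_prop

theorem pd_sum {ι : Type*} (k : Fin d) (s : Finset ι) {f : ι → E d → ℝ}
    (hf : ∀ i ∈ s, ContDiff ℝ ∞ (f i)) :
    pd k (fun x => ∑ i ∈ s, f i x) = fun x => ∑ i ∈ s, pd k (f i) x := by
  ext x
  simp only [pd]
  rw [fderiv_fun_sum fun i hi => ((hf i hi).contDiffAt (x := x)).differentiableAt (by simp)]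
  simp

theorem pd_const_mul (k : Fin d) (c : ℝ) {f : E d → ℝ} (hf : ContDiff ℝ ∞ f) :
    pd k (fun x => c * f x) = fun x => c * pd k f x := by
  rw [pd_mul k contDiff_const hf, pd_const]; simp

theorem pd_comp_sub_const (k : Fin d) (f : E d → ℝ) (a : E d) :
    pd k (fun x => f (x - a)) = fun x => pd k f (x - a) := by
  ext x; simp [pd, fderiv_comp_sub]

/-- The `j`-th derivative of `f` at `y`, applied to `(w, …, w)`. -/
noncomputable def dirPow : ℕ → (E d → ℝ) → E d → E d → ℝ
  | 0, f, y, _ => f y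
  | j + 1, f, y, w => ∑ l, w l * dirPow j (pd l f) y w

theorem isPoly_dirPow (j : ℕ) (f : E d → ℝ) (y : E d) : IsPoly j (dirPow j f y) := by
  induction j generalizing f with
  | zero => exact isPoly_const 0 _
  | succ j ih =>
    refine IsPoly.sum _ fun l _ => ?_
    rw [add_comm]
    exact (isPoly_coord l).mul (ih _)

theorem dirPow_smul (j : ℕ) (f : E d → ℝ) (y w : E d) (c : ℝ) :
    dirPow j f y (c • w) = c ^ j * dirPow j f y w := by
  induction j generalizing f with
  | zero => simp [dirPow]
  | succ j ih =>
    simp only [dirPow, ih, Finset.mul_sum]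
    refine Finset.sum_congr rfl fun l _ => ?_
    simp
    ring

theorem hasDerivAt_dirPow (j : ℕ) {f : E d → ℝ} (hf : ContDiff ℝ ∞ f) (x w : E d) (t : ℝ) :
    HasDerivAt (fun t : ℝ => dirPow j f (x + t • w) w) (dirPow (j + 1) f (x + t • w) w) t := by
  induction j generalizing f with
  | zero =>
    have h := (hf.contDiffAt (x := x + t • w)).differentiableAt (by simp)
    have h2 : HasDerivAt (fun t : ℝ => x + t • w) w t := by
      simpa using ((hasDerivAt_id t).smul_const w).const_add x
    have := h.hasFDerivAt.comp_hasDerivAt t h2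
    rw [fderiv_apply_eq_sum_pd] at this
    simpa [dirPow] using! this
  | succ j ih =>
    have : HasDerivAt (fun t : ℝ => ∑ l, w l * dirPow j (pd l f) (x + t • w) w)
        (∑ l, w l * dirPow (j + 1) (pd l f) (x + t • w) w) t :=
      HasDerivAt.fun_sum fun l _ => (ih (contDiff_pd hf l)).const_mul _
    exact this

/-- Euler's rule for a homogeneous form of degree `j + 1`. Symmetry of second derivatives makes all
slots equivalent, hence the factor `j + 1`. -/
theorem pd_dirPow_succ (j : ℕ) (k : Fin d) {f : E d → ℝ} (hf : ContDiff ℝ ∞ f) (y : E d) :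
    pd k (dirPow (j + 1) f y) = fun w => (j + 1) * dirPow j (pd k f) y w := by
  induction j generalizing f with
  | zero =>
    have e : dirPow 1 f y = fun w => ∑ l, w l * pd l f y := rfl
    rw [e, pd_sum _ _ fun l _ => (contDiff_coord l).mul contDiff_const]
    ext w
    simp only [pd_mul _ (contDiff_coord _) contDiff_const, pd_coord, pd_const]
    simp [dirPow]
  | succ j ih =>
    have e : dirPow (j + 2) f y = fun w => ∑ l, w l * dirPow (j + 1) (pd l f) y w := rfl
    rw [e, pd_sum _ _ fun l _ => (contDiff_coord l).mul (isPoly_dirPow _ _ _).contDiff]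
    ext w
    simp only [pd_mul _ (contDiff_coord _) (isPoly_dirPow _ _ _).contDiff, pd_coord,
      Finset.sum_add_distrib, ih (contDiff_pd hf _), pd_comm k _ hf]
    have e2 : dirPow (j + 1) (pd k f) y w = ∑ l, w l * dirPow j (pd l (pd k f)) y w := rfl
    simp only [ite_mul, one_mul, zero_mul, Finset.sum_ite_eq', Finset.mem_univ,
      if_true]
    have e3 : ∀ l, w l * ((j + 1) * dirPow j (pd l (pd k f)) y w) =
      (j + 1) * (w l * dirPow j (pd l (pd k f)) y w) := fun l => by ring
    simp only [e3, ← Finset.mul_sum]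
    rw [← e2]
    push_cast
    ring

theorem sum_snoc {j : ℕ} {M : Type*} [AddCommMonoid M] (F : (Fin (j + 1) → Fin d) → M) :
    ∑ i, F i = ∑ l, ∑ i : Fin j → Fin d, F (Fin.snoc i l) := by
  rw [← (Fin.snocEquiv (fun _ : Fin (j + 1) => Fin d)).sum_comp, Fintype.sum_prod_type]
  rfl

theorem enorm_dirPow_le (j : ℕ) {f : E d → ℝ} (hf : ContDiff ℝ ∞ f) (y w : E d) :
    ‖dirPow j f y w‖ₑ ≤ ‖w‖ₑ ^ j * ∑ i : Fin j → Fin d, ‖pds i f y‖ₑ := by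
  induction j generalizing f with
  | zero => simp [dirPow, pds_zero]
  | succ j ih =>
    rw [sum_snoc]
    calc ‖∑ l, w l * dirPow j (pd l f) y w‖ₑ ≤ ∑ l, ‖w l * dirPow j (pd l f) y w‖ₑ :=
          enorm_sum_le _ _
      _ ≤ ∑ l, ‖w‖ₑ * (‖w‖ₑ ^ j * ∑ i : Fin j → Fin d, ‖pds i (pd l f) y‖ₑ) := by
          gcongr with l
          rw [enorm_mul]
          exact mul_le_mul' (enorm_apply_le w l) (ih (contDiff_pd hf l))
      _ = _ := by
          simp only [pds_snoc _ _ hf]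
          rw [← Finset.mul_sum, ← Finset.mul_sum, ← mul_assoc, pow_succ']

/-- The Taylor polynomial of `f` at `y` with `n` terms. -/
noncomputable def taylorPoly (n : ℕ) (f : E d → ℝ) (y : E d) : E d → ℝ :=
  fun x => ∑ j ∈ Finset.range n, (j.factorial : ℝ)⁻¹ * dirPow j f y (x - y)

theorem IsPoly.comp_sub_const {m : ℕ} {f : E d → ℝ} (hf : IsPoly m f) (a : E d) :
    IsPoly m (fun x => f (x - a)) := by
  obtain ⟨p, hp, e⟩ := hf
  have key : ∀ q : MvPolynomial (Fin d) ℝ, IsPoly q.totalDegree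
      (fun x : E d => MvPolynomial.eval (fun j => (x - a) j) q) := by
    intro q
    have : (fun x : E d => MvPolynomial.eval (fun j => (x - a) j) q) = fun x =>
        ∑ s ∈ q.support, q.coeff s * ∏ k, (x k - a k) ^ s k := by
      ext x
      rw [MvPolynomial.eval_eq']
      simp
    rw [this]
    refine IsPoly.sum _ fun s hs => IsPoly.const_mul ?_ _
    refine IsPoly.mono ?_ (MvPolynomial.le_totalDegree hs)
    rw [Finsupp.sum_fintype _ _ (by simp)]
    have hpow : ∀ (k : Fin d) (n : ℕ), IsPoly n (fun x : E d => (x k - a k) ^ n) := by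
      intro k n
      induction n with
      | zero => simpa using isPoly_const 0 1
      | succ n ih =>
        simp only [pow_succ]
        exact ih.mul ((isPoly_coord k).sub (isPoly_const 1 _))
    have hprod : ∀ S : Finset (Fin d), IsPoly (∑ k ∈ S, s k)
        (fun x : E d => ∏ k ∈ S, (x k - a k) ^ s k) := by
      intro S
      induction S using Finset.induction_on with
      | empty => simpa using isPoly_const 0 1
      | insert k S hk ih =>
        simp only [Finset.sum_insert hk, Finset.prod_insert hk]
        exact (hpow k _).mul ih
    exact hprod _
  simp only [e]
  exact (key p).mono hp

theorem isPoly_taylorPoly (m : ℕ) (f : E d → ℝ) (y : E d) : IsPoly m (taylorPoly (m + 1) f y) :=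
  IsPoly.sum _ fun j hj => (((isPoly_dirPow j f y).comp_sub_const y).const_mul _).mono
    (Nat.lt_succ_iff.1 (Finset.mem_range.1 hj))

theorem contDiff_taylorPoly (n : ℕ) (f : E d → ℝ) (y : E d) : ContDiff ℝ ∞ (taylorPoly n f y) :=
  ContDiff.sum fun j _ => (((isPoly_dirPow j f y).comp_sub_const y).const_mul _).contDiff

/-- Differentiation commutes with Taylor expansion at the cost of one term. A single Taylor
polynomial therefore approximates `f` and its derivatives with the same centre. -/
theorem pd_taylorPoly_succ (n : ℕ) (k : Fin d) {f : E d → ℝ} (hf : ContDiff ℝ ∞ f) (y : E d) :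
    pd k (taylorPoly (n + 1) f y) = taylorPoly n (pd k f) y := by
  have e : taylorPoly (n + 1) f y = fun x => ∑ j ∈ Finset.range (n + 1),
    (j.factorial : ℝ)⁻¹ * dirPow j f y (x - y) := rfl
  have hc : ∀ j, ContDiff ℝ ∞ fun x => dirPow j f y (x - y) := fun j =>
    ((isPoly_dirPow j f y).comp_sub_const y).contDiff
  rw [e, pd_sum _ _ fun j _ => contDiff_const.mul (hc j)]
  ext x
  simp only [pd_const_mul _ _ (hc _)]
  rw [Finset.sum_range_succ']
  have h0 : pd k (fun x => dirPow 0 f y (x - y)) = fun _ => 0 := pd_const k (f y)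
  simp only [pd_comp_sub_const k (dirPow _ f y), pd_dirPow_succ _ k hf, taylorPoly]
  rw [show pd k (dirPow 0 f y) (x - y) = 0 from congrFun (pd_const k (f y)) _, mul_zero, add_zero]
  refine Finset.sum_congr rfl fun j _ => ?_
  rw [Nat.factorial_succ]
  push_cast
  field_simp

theorem continuous_dirPow (j : ℕ) {f : E d → ℝ} (hf : ContDiff ℝ ∞ f) :
    Continuous fun p : E d × E d => dirPow j f p.1 p.2 := by
  induction j generalizing f with
  | zero => exact hf.continuous.comp continuous_fst
  | succ j ih =>
    have : Continuous fun p : E d × E d => ∑ l, p.2 l * dirPow j (pd l f) p.1 p.2 := by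
      refine continuous_finsetSum _ fun l _ => Continuous.mul ?_ (ih (contDiff_pd hf l))
      fun_prop
    exact this

theorem continuous_taylorPoly (n : ℕ) {f : E d → ℝ} (hf : ContDiff ℝ ∞ f) :
    Continuous fun p : E d × E d => taylorPoly n f p.1 p.2 := by
  unfold taylorPoly
  refine continuous_finsetSum _ fun j _ => continuous_const.mul ?_
  exact (continuous_dirPow j hf).comp (continuous_fst.prodMk (continuous_snd.sub continuous_fst))

/-- Let the centre of expansion move from `x` to `y` and evaluate at `x`: the value starts at `f x`
and ends at the Taylor polynomial with centre `y`. In the derivative along the way all terms but the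
last telescope. -/
theorem enorm_sub_taylorPoly_le (n : ℕ) {f : E d → ℝ} (hf : ContDiff ℝ ∞ f) (x y : E d) :
    ‖f x - taylorPoly (n + 1) f y x‖ₑ ≤ ‖y - x‖ₑ ^ (n + 1) * ∫⁻ t in Ioc (0 : ℝ) 1,
      ∑ i : Fin (n + 1) → Fin d, ‖pds i f (x + t • (y - x))‖ₑ := by
  set v := y - x with hv
  let H : ℝ → ℝ := fun t => ∑ j ∈ Finset.range (n + 1),
    (j.factorial : ℝ)⁻¹ * (-t) ^ j * dirPow j f (x + t • v) v
  let H' : ℝ → ℝ := fun t => (n.factorial : ℝ)⁻¹ * (-t) ^ n * dirPow (n + 1) f (x + t • v) v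
  have hH : ∀ t, HasDerivAt H (H' t) t := by
    intro t
    simp only [H, H']
    induction n with
    | zero => simpa using! hasDerivAt_dirPow 0 hf x v t
    | succ n ih =>
      simp only [Finset.sum_range_succ _ (n + 1)]
      have h1 : HasDerivAt (fun t : ℝ => ((n + 1).factorial : ℝ)⁻¹ * (-t) ^ (n + 1))
          (-((n.factorial : ℝ)⁻¹ * (-t) ^ n)) t := by
        have := (((hasDerivAt_id t).neg).pow (n + 1)).const_mul (((n + 1).factorial : ℝ)⁻¹)
        convert! this using 1
        rw [Nat.factorial_succ]
        push_cast
        simp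
        field_simp
      convert! ih.add (h1.mul (hasDerivAt_dirPow (n + 1) hf x v t)) using 1
      ring
  have hcont : Continuous H' := by
    have := (continuous_dirPow (n + 1) hf).comp
      ((by fun_prop : Continuous fun t : ℝ => x + t • v).prodMk (continuous_const (y := v)))
    exact (by fun_prop : Continuous fun t : ℝ => (n.factorial : ℝ)⁻¹ * (-t) ^ n).mul this
  have hint := intervalIntegral.integral_eq_sub_of_hasDerivAt (fun t _ => hH t)
    (hcont.intervalIntegrable 0 1)
  have h0 : H 0 = f x := by
    simp only [H]
    rw [Finset.sum_range_succ']
    simp [dirPow]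
  have h1 : H 1 = taylorPoly (n + 1) f y x := by
    simp only [H, taylorPoly]
    refine Finset.sum_congr rfl fun j _ => ?_
    rw [show x - y = (-1 : ℝ) • v by rw [hv]; simp, dirPow_smul, mul_assoc, hv]
    simp
  rw [← h0, ← h1, ← neg_sub, ← hint, enorm_neg, intervalIntegral.integral_of_le zero_le_one,
    ← lintegral_const_mul' _ _ (by simp [hv])]
  refine (enorm_integral_le_lintegral_enorm _).trans
    (setLIntegral_mono' measurableSet_Ioc fun t ht => ?_)
  -- The kernel of the remainder is bounded by one on the segment; no more of it is needed.
  have hle : ‖(n.factorial : ℝ)⁻¹ * (-t) ^ n‖ₑ ≤ 1 := by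
    rw [← ofReal_norm, ENNReal.ofReal_le_one, norm_mul, norm_pow, norm_neg, Real.norm_of_nonneg ht.1.le,
      norm_inv, Real.norm_natCast]
    have h3 : (1 : ℝ) ≤ n.factorial := by exact_mod_cast Nat.one_le_iff_ne_zero.2 n.factorial_ne_zero
    exact mul_le_one₀ (inv_le_one_of_one_le₀ h3) (pow_nonneg ht.1.le _) (pow_le_one₀ ht.1.le ht.2)
  simp only [H']
  rw [enorm_mul]
  calc _ ≤ 1 * (‖v‖ₑ ^ (n + 1) * ∑ i : Fin (n + 1) → Fin d, ‖pds i f (x + t • v)‖ₑ) :=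
        mul_le_mul' hle (enorm_dirPow_le _ hf _ _)
    _ = _ := one_mul _

end Taylor

/-! ### Approximation by polynomials and traces on star-shaped sets -/

section BrambleHilbert

variable {d : ℕ}

/-- The volume of the unit ball. -/
noncomputable def unitBallVol (d : ℕ) : ℝ := (volume : Measure (E d)).real (Metric.ball 0 1)

theorem unitBallVol_pos (d : ℕ) : 0 < unitBallVol d :=
  ENNReal.toReal_pos (Metric.measure_ball_pos _ _ one_pos).ne' measure_ball_lt_top.ne

theorem volume_ball_eq (x : E d) {r : ℝ} (hr : 0 < r) :
    volume (Metric.ball x r) = ENNReal.ofReal (unitBallVol d * r ^ d) := by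
  rw [Measure.addHaar_ball_of_pos _ _ hr, finrank_euclideanSpace_fin, mul_comm, unitBallVol,
    ENNReal.ofReal_mul (by positivity), Measure.real, ENNReal.ofReal_toReal measure_ball_lt_top.ne]

theorem volume_closedBall_eq (x : E d) {r : ℝ} (hr : 0 ≤ r) :
    volume (Metric.closedBall x r) = ENNReal.ofReal (unitBallVol d * r ^ d) := by
  rw [Measure.addHaar_closedBall _ _ hr, finrank_euclideanSpace_fin, mul_comm, unitBallVol,
    ENNReal.ofReal_mul (by positivity), Measure.real, ENNReal.ofReal_toReal measure_ball_lt_top.ne]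

/-- Since `s ^ d ≤ 2R s ^ (d - 1)` for radii up to `2R`, Lebesgue measure also has growth of
dimension `d - 1`. One segment estimate thus covers volumes and surfaces. -/
theorem volume_regular (hd : 1 ≤ d) (W : Set (E d)) {R : ℝ} (z : E d) {s : ℝ} (hs : 0 ≤ s)
    (hsR : s ≤ 2 * R) :
    (volume.restrict W) (Metric.closedBall z s) ≤
      ENNReal.ofReal (unitBallVol d * (2 * R) * s ^ (d - 1)) := by
  refine (Measure.restrict_apply_le _ _).trans ?_
  rw [volume_closedBall_eq z hs]
  refine ENNReal.ofReal_le_ofReal ?_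
  obtain ⟨k, rfl⟩ : ∃ k, d = k + 1 := ⟨d - 1, by omega⟩
  have := unitBallVol_pos (k + 1)
  rw [pow_succ, Nat.add_sub_cancel, mul_assoc]
  have : 0 ≤ s ^ k := by positivity
  calc _ ≤ unitBallVol (k + 1) * (s ^ k * (2 * R)) := by gcongr
    _ = _ := by ring

theorem sq_sum_enorm_le {ι : Type*} [Fintype ι] (a : ι → ℝ≥0∞) :
    (∑ i, a i) ^ 2 ≤ Fintype.card ι * ∑ i, a i ^ 2 := by
  have h := ENNReal.inner_le_Lp_mul_Lq Finset.univ (fun _ : ι => 1) a Real.HolderConjugate.two_two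
  have h2 := pow_le_pow_left' h 2
  simp only [one_mul] at h2
  refine h2.trans (le_of_eq ?_)
  rw [mul_pow, ← ENNReal.rpow_natCast, ← ENNReal.rpow_natCast, ← ENNReal.rpow_mul,
    ← ENNReal.rpow_mul]
  simp

theorem StarPatch.sees_ae {W : Set (E d)} {b : E d} {r R : ℝ} (h : StarPatch W b r R) :
    ∀ᵐ x ∂(volume.restrict W), Sees W b r x ∧ x ∈ Metric.ball b R := by
  filter_upwards [ae_restrict_mem h.isOpen.measurableSet] with x hx
  exact ⟨h.star x hx, h.subset hx⟩

/-- The `L²` estimate of the Taylor remainder, averaged over the centres of expansion. -/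
theorem lintegral_taylor_remainder_le (hd : 1 ≤ d) {W : Set (E d)} {b : E d} {r R M : ℝ}
    (hW : IsOpen W) (hrR : r ≤ R) (hM : 0 ≤ M) (hr : 0 < r)
    (μ : Measure (E d)) [SFinite μ]
    (hreg : ∀ z s, 0 ≤ s → s ≤ 2 * R → μ (Metric.closedBall z s) ≤ ENNReal.ofReal (M * s ^ (d - 1)))
    (hsee : ∀ᵐ x ∂μ, Sees W b r x ∧ x ∈ Metric.ball b R)
    (n : ℕ) {f : E d → ℝ} (hf : ContDiff ℝ ∞ f) :
    ∫⁻ x, ∫⁻ y in Metric.ball b r, ‖f x - taylorPoly (n + 1) f y x‖ₑ ^ 2 ∂volume ∂μ ≤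
      ENNReal.ofReal ((2 * R) ^ (2 * (n + 1)) * (4 * (M * (2 * R) ^ (d - 1))) * d ^ (n + 1)) *
        ∑ i : Fin (n + 1) → Fin d, l2Sq volume W (pds i f) := by
  have hR : 0 < R := hr.trans_le hrR
  have hcont : ∀ i : Fin (n + 1) → Fin d, Continuous (pds i f) := fun i => (contDiff_pds i hf).continuous
  let g : E d → ℝ≥0∞ := fun z => ∑ i : Fin (n + 1) → Fin d, ‖pds i f z‖ₑ
  have hg : Measurable g := Finset.measurable_sum _ fun i _ => (hcont i).measurable.enorm
  have h1 : ∀ᵐ x ∂μ, ∫⁻ y in Metric.ball b r, ‖f x - taylorPoly (n + 1) f y x‖ₑ ^ 2 ≤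
      ENNReal.ofReal ((2 * R) ^ (2 * (n + 1))) *
        ∫⁻ y in Metric.ball b r, (∫⁻ t in Ioc (0 : ℝ) 1, g (x + t • (y - x))) ^ 2 := by
    filter_upwards [hsee] with x hx
    rw [← lintegral_const_mul' _ _ (by simp)]
    refine setLIntegral_mono' Metric.isOpen_ball.measurableSet fun y hy => ?_
    have hyx : ‖y - x‖ₑ ≤ ENNReal.ofReal (2 * R) := by
      rw [← ofReal_norm, ← dist_eq_norm]
      refine ENNReal.ofReal_le_ofReal ?_
      have h1 := Metric.mem_ball.1 hy
      have h2 := Metric.mem_ball.1 hx.2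
      have h3 := dist_triangle_right y x b
      linarith
    calc _ ≤ (‖y - x‖ₑ ^ (n + 1) * ∫⁻ t in Ioc (0 : ℝ) 1, g (x + t • (y - x))) ^ 2 :=
          pow_le_pow_left' (enorm_sub_taylorPoly_le n hf x y) 2
      _ ≤ (ENNReal.ofReal (2 * R) ^ (n + 1) * ∫⁻ t in Ioc (0 : ℝ) 1, g (x + t • (y - x))) ^ 2 := by
          gcongr
      _ = _ := by
          rw [mul_pow, ← pow_mul, ENNReal.ofReal_pow (by positivity), mul_comm (n + 1)]
  have h2 : ∫⁻ z in W, g z ^ 2 ≤ ENNReal.ofReal (d ^ (n + 1)) *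
      ∑ i : Fin (n + 1) → Fin d, l2Sq volume W (pds i f) := by
    simp only [l2Sq]
    rw [← lintegral_finsetSum' _ fun i _ => ((hcont i).measurable.enorm.pow_const 2).aemeasurable,
      ← lintegral_const_mul' _ _ (by simp)]
    refine lintegral_mono fun z => (sq_sum_enorm_le _).trans (le_of_eq ?_)
    congr 1
    rw [ENNReal.ofReal_pow (by positivity)]
    simp
  calc _ ≤ ∫⁻ x, (ENNReal.ofReal ((2 * R) ^ (2 * (n + 1))) *
        ∫⁻ y in Metric.ball b r, (∫⁻ t in Ioc (0 : ℝ) 1, g (x + t • (y - x))) ^ 2) ∂μ :=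
        lintegral_mono_ae h1
    _ ≤ ENNReal.ofReal ((2 * R) ^ (2 * (n + 1))) * (ENNReal.ofReal (4 * (M * (2 * R) ^ (d - 1))) *
        (ENNReal.ofReal (d ^ (n + 1)) * ∑ i : Fin (n + 1) → Fin d, l2Sq volume W (pds i f))) := by
        rw [lintegral_const_mul' _ _ (by simp)]
        gcongr
        exact (lintegral_sq_segment_le hd hW.measurableSet hrR hM hr μ hreg hsee hg).trans
          (mul_le_mul' le_rfl h2)
    _ = _ := by
        rw [← mul_assoc, ← mul_assoc, ← ENNReal.ofReal_mul (by positivity),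
          ← ENNReal.ofReal_mul (by positivity)]

theorem measure_univ_le_of_regular {W : Set (E d)} {b : E d} {r R M : ℝ} (hR : 0 < R)
    {μ : Measure (E d)}
    (hreg : ∀ z s, 0 ≤ s → s ≤ 2 * R → μ (Metric.closedBall z s) ≤ ENNReal.ofReal (M * s ^ (d - 1)))
    (hsee : ∀ᵐ x ∂μ, Sees W b r x ∧ x ∈ Metric.ball b R) :
    μ univ ≤ ENNReal.ofReal (M * (2 * R) ^ (d - 1)) := by
  refine le_trans ?_ (hreg b (2 * R) (by positivity) le_rfl)
  refine measure_mono_ae ?_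
  filter_upwards [hsee] with x hx _
  exact Metric.ball_subset_closedBall (Metric.ball_subset_ball (by linarith) hx.2)

/-- The trace inequality for smooth functions. -/
theorem trace_inequality (hd : 1 ≤ d) {W : Set (E d)} {b : E d} {r R M : ℝ}
    (hW : StarPatch W b r R) (hrR : r ≤ R) (hM : 0 ≤ M)
    (μ : Measure (E d)) [SFinite μ]
    (hreg : ∀ z s, 0 ≤ s → s ≤ 2 * R → μ (Metric.closedBall z s) ≤ ENNReal.ofReal (M * s ^ (d - 1)))
    (hsee : ∀ᵐ x ∂μ, Sees W b r x ∧ x ∈ Metric.ball b R)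
    {f : E d → ℝ} (hf : ContDiff ℝ ∞ f) :
    ENNReal.ofReal (unitBallVol d * r ^ d) * ∫⁻ x, ‖f x‖ₑ ^ 2 ∂μ ≤
      ENNReal.ofReal (2 * M * (2 * R) ^ (d - 1)) * (l2Sq volume W f +
        ENNReal.ofReal (16 * d * R ^ 2) * ∑ k, l2Sq volume W (pd k f)) := by
  have hR : 0 < R := hW.pos.trans_le hrR
  -- Write `f x = f y + (f x - f y)` and integrate over `y` in the ball. The Taylor polynomial with
  -- one term is the constant `f y`, so the difference is the remainder of order one.
  have h1 : ∀ x, ENNReal.ofReal (unitBallVol d * r ^ d) * ‖f x‖ₑ ^ 2 ≤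
      2 * l2Sq volume W f +
        2 * ∫⁻ y in Metric.ball b r, ‖f x - taylorPoly 1 f y x‖ₑ ^ 2 := by
    intro x
    rw [← volume_ball_eq b hW.pos, mul_comm, ← setLIntegral_const]
    have hm : Measurable fun y => 2 * ‖f y‖ₑ ^ 2 :=
      (hf.continuous.measurable.enorm.pow_const 2).const_mul 2
    calc _ ≤ ∫⁻ y in Metric.ball b r, (2 * ‖f y‖ₑ ^ 2 + 2 * ‖f x - taylorPoly 1 f y x‖ₑ ^ 2) := by
          refine lintegral_mono fun y => ?_
          have e : taylorPoly 1 f y x = f y := by simp [taylorPoly, dirPow]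
          rw [e]
          simpa using enorm_add_sq_le (f y) (f x - f y)
      _ = 2 * (∫⁻ y in Metric.ball b r, ‖f y‖ₑ ^ 2) +
          2 * ∫⁻ y in Metric.ball b r, ‖f x - taylorPoly 1 f y x‖ₑ ^ 2 := by
          rw [lintegral_add_left hm, lintegral_const_mul' _ _ (by simp),
            lintegral_const_mul' _ _ (by simp)]
      _ ≤ _ := by
          gcongr
          exact l2Sq_mono_set hW.ball_subset f
  have h2 := lintegral_taylor_remainder_le hd hW.isOpen hrR hM hW.pos μ hreg hsee 0 hf
  have h3 : ∑ i : Fin 1 → Fin d, l2Sq volume W (pds i f) = ∑ k, l2Sq volume W (pd k f) := by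
    rw [← (Equiv.funUnique (Fin 1) (Fin d)).symm.sum_comp]
    exact Finset.sum_congr rfl fun k _ => congrArg _ (pds_one k f)
  calc _ = ∫⁻ x, ENNReal.ofReal (unitBallVol d * r ^ d) * ‖f x‖ₑ ^ 2 ∂μ := by
        rw [lintegral_const_mul' _ _ (by simp)]
    _ ≤ ∫⁻ x, (2 * l2Sq volume W f +
        2 * ∫⁻ y in Metric.ball b r, ‖f x - taylorPoly 1 f y x‖ₑ ^ 2) ∂μ := lintegral_mono h1
    _ = 2 * l2Sq volume W f * μ univ +
        2 * ∫⁻ x, ∫⁻ y in Metric.ball b r, ‖f x - taylorPoly 1 f y x‖ₑ ^ 2 ∂volume ∂μ := by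
        rw [lintegral_add_left measurable_const, lintegral_const, lintegral_const_mul' _ _ (by simp)]
    _ ≤ 2 * l2Sq volume W f * ENNReal.ofReal (M * (2 * R) ^ (d - 1)) +
        2 * (ENNReal.ofReal ((2 * R) ^ (2 * (0 + 1)) * (4 * (M * (2 * R) ^ (d - 1))) *
          d ^ (0 + 1)) * ∑ k, l2Sq volume W (pd k f)) := by
        gcongr
        · exact measure_univ_le_of_regular hR hreg hsee
        · rw [← h3]; exact h2
    _ = _ := by
        have hc : 0 ≤ M * (2 * R) ^ (d - 1) := by positivity
        rw [show 2 * M * (2 * R) ^ (d - 1) = 2 * (M * (2 * R) ^ (d - 1)) by ring,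
          ENNReal.ofReal_mul zero_le_two, show (2 * R) ^ (2 * (0 + 1)) *
            (4 * (M * (2 * R) ^ (d - 1))) * (d : ℝ) ^ (0 + 1) =
            (M * (2 * R) ^ (d - 1)) * (16 * d * R ^ 2) by ring, ENNReal.ofReal_mul hc,
          ENNReal.ofReal_ofNat]
        ring

end BrambleHilbert

/-! ### Limits of smooth functions: weak gradients and traces -/

section Limits

variable {d : ℕ}

theorem L2Tendsto.sub_const {μ : Measure (E d)} {S : Set (E d)} {f : ℕ → E d → ℝ} {w : E d → ℝ}
    (h : L2Tendsto μ S f w) (q : E d → ℝ) :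
    L2Tendsto μ S (fun n x => f n x - q x) (fun x => w x - q x) := by
  simpa [L2Tendsto] using h

theorem L2Tendsto.tendsto_integral_mul {D : Set (E d)} {f : ℕ → E d → ℝ} {w h : E d → ℝ}
    (hf : ∀ n, MemLp (f n) 2 (volume.restrict D)) (hw : MemLp w 2 (volume.restrict D))
    (hh : MemLp h 2 (volume.restrict D)) (hfw : L2Tendsto volume D f w) :
    Tendsto (fun n => ∫ x in D, f n x * h x) atTop (𝓝 (∫ x in D, w x * h x)) := by
  have hprod : ∀ {g : E d → ℝ}, MemLp g 2 (volume.restrict D) →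
      Integrable (fun x => g x * h x) (volume.restrict D) := fun hg =>
    MemLp.integrable_mul hg hh
  refine tendsto_integral_of_L1' _ (hprod hw).aestronglyMeasurable
    (Eventually.of_forall fun n => hprod (hf n)) ?_
  have h0 : Tendsto (fun n => eLpNorm (fun x => f n x - w x) 2 (volume.restrict D) *
      eLpNorm h 2 (volume.restrict D)) atTop (𝓝 0) := by
    simpa using ENNReal.Tendsto.mul_const hfw.tendsto_eLpNorm (Or.inr hh.2.ne)
  refine tendsto_of_tendsto_of_tendsto_of_le_of_le tendsto_const_nhds h0 (fun _ => bot_le) fun n => ?_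
  have := eLpNorm_smul_le_mul_eLpNorm (p := 2) (q := 2) (r := 1) hh.1 ((hf n).1.sub hw.1)
  refine le_trans (le_of_eq ?_) this
  congr 1
  ext x
  simp [sub_mul]

/-- On `W`, the function `w` is the `H¹` limit of the smooth functions `f n`, and `G` is its
gradient. -/
structure SmoothApprox (W : Set (E d)) (w : E d → ℝ) (G : Fin d → E d → ℝ) (f : ℕ → E d → ℝ) :
    Prop where
  contDiff : ∀ n, ContDiff ℝ ∞ (f n)
  memLp : MemLp w 2 (volume.restrict W)
  memLp_grad : ∀ k, MemLp (G k) 2 (volume.restrict W)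
  tendsto : L2Tendsto volume W f w
  tendsto_grad : ∀ k, L2Tendsto volume W (fun n => pd k (f n)) (G k)

theorem SmoothApprox.mono {W D : Set (E d)} {w : E d → ℝ} {G : Fin d → E d → ℝ}
    {f : ℕ → E d → ℝ} (h : SmoothApprox W w G f) (hD : D ⊆ W) : SmoothApprox D w G f where
  contDiff := h.contDiff
  memLp := h.memLp.mono_measure (Measure.restrict_mono hD le_rfl)
  memLp_grad k := (h.memLp_grad k).mono_measure (Measure.restrict_mono hD le_rfl)
  tendsto := h.tendsto.mono hD
  tendsto_grad k := (h.tendsto_grad k).mono hD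

theorem isFiniteMeasure_restrict_of_isBounded {W : Set (E d)} (hb : Bornology.IsBounded W) :
    IsFiniteMeasure (volume.restrict W) :=
  ⟨by simpa using hb.measure_lt_top⟩

theorem SmoothApprox.sub {W : Set (E d)} (hb : Bornology.IsBounded W) (hm : MeasurableSet W)
    {w : E d → ℝ} {G : Fin d → E d → ℝ}
    {f : ℕ → E d → ℝ} (h : SmoothApprox W w G f) {q : E d → ℝ} (hq : ContDiff ℝ ∞ q) :
    SmoothApprox W (fun x => w x - q x) (fun k x => G k x - pd k q x) (fun n x => f n x - q x) := by
  have := isFiniteMeasure_restrict_of_isBounded hb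
  refine ⟨fun n => (h.contDiff n).sub hq, h.memLp.sub (memLp_of_continuous hb hm hq.continuous),
    fun k => (h.memLp_grad k).sub (memLp_of_continuous hb hm (contDiff_pd hq k).continuous),
    h.tendsto.sub_const q, fun k => ?_⟩
  simp only [pd_sub k (h.contDiff _) hq]
  exact (h.tendsto_grad k).sub_const _

theorem setIntegral_mul_pd {D : Set (E d)} {f ψ : E d → ℝ} (hf : ContDiff ℝ ∞ f)
    (hψ : ContDiff ℝ ∞ ψ) (hc : HasCompactSupport ψ) (hD : tsupport ψ ⊆ D) (k : Fin d) :
    ∫ x in D, f x * pd k ψ x = -∫ x in D, pd k f x * ψ x := by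
  have h0 : ∀ x ∉ D, ψ x = 0 := fun x hx => image_eq_zero_of_notMem_tsupport fun h => hx (hD h)
  have h1 : ∀ x ∉ D, pd k ψ x = 0 := fun x hx => by
    have : fderiv ℝ ψ x = 0 :=
      image_eq_zero_of_notMem_tsupport fun h => hx (hD (tsupport_fderiv_subset ℝ h))
    simp [pd, this]
  rw [setIntegral_eq_integral_of_forall_compl_eq_zero (fun x hx => by rw [h1 x hx, mul_zero]),
    setIntegral_eq_integral_of_forall_compl_eq_zero (fun x hx => by rw [h0 x hx, mul_zero])]
  have hcs : HasCompactSupport (pd k ψ) := hc.fderiv_apply ℝ _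
  refine integral_mul_fderiv_eq_neg_fderiv_mul_of_integrable ?_ ?_ ?_
    (fun x _ => hf.contDiffAt.differentiableAt (by simp))
    (fun x _ => hψ.contDiffAt.differentiableAt (by simp))
  · exact ((contDiff_pd hf k).continuous.mul hψ.continuous).integrable_of_hasCompactSupport hc.mul_left
  · exact (hf.continuous.mul (contDiff_pd hψ k).continuous).integrable_of_hasCompactSupport
      hcs.mul_left
  · exact (hf.continuous.mul hψ.continuous).integrable_of_hasCompactSupport hc.mul_left

/-- Integration by parts holds for each `f n`, and both sides converge because the test function is
bounded on `D`. -/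
theorem SmoothApprox.hasWeakGrad {D : Set (E d)} (hb : Bornology.IsBounded D)
    (hm : MeasurableSet D) {w : E d → ℝ} {G : Fin d → E d → ℝ} {f : ℕ → E d → ℝ}
    (h : SmoothApprox D w G f) :
    HasWeakGrad D w (fun x => WithLp.toLp 2 fun k => G k x) := by
  intro k
  refine ⟨h.memLp, h.memLp_grad k, fun ψ hψ hc hD => ?_⟩
  have := isFiniteMeasure_restrict_of_isBounded hb
  have e : ∀ x, iteratedFDeriv ℝ 1 ψ x (fun _ => EuclideanSpace.single k (1 : ℝ)) = pd k ψ x :=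
    fun x => congrFun (pds_one k ψ) x
  simp only [e, pow_one, neg_one_mul]
  have h1 := L2Tendsto.tendsto_integral_mul
    (fun n => memLp_of_continuous hb hm (h.contDiff n).continuous) h.memLp
    (memLp_of_continuous hb hm (contDiff_pd hψ k).continuous) h.tendsto
  have h2 := L2Tendsto.tendsto_integral_mul
    (fun n => memLp_of_continuous hb hm (contDiff_pd (h.contDiff n) k).continuous) (h.memLp_grad k)
    (memLp_of_continuous hb hm hψ.continuous) (h.tendsto_grad k)
  refine tendsto_nhds_unique h1 (h2.neg.congr fun n => ?_)
  rw [setIntegral_mul_pd (h.contDiff n) hψ hc hD k]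

/-- A function that is approximated by smooth functions in `H¹(W)` has a trace on each regular
hypersurface whose points are seen from `W`. -/
theorem SmoothApprox.exists_trace (hd : 1 ≤ d) {W : Set (E d)} {b : E d} {r R M : ℝ}
    (hW : StarPatch W b r R) (hrR : r ≤ R) (hM : 0 ≤ M)
    (ν : Measure (E d)) {S : Set (E d)}
    (hreg : ∀ z s, 0 ≤ s → s ≤ 2 * R →
      (ν.restrict S) (Metric.closedBall z s) ≤ ENNReal.ofReal (M * s ^ (d - 1)))
    (hsee : ∀ᵐ x ∂(ν.restrict S), Sees W b r x ∧ x ∈ Metric.ball b R)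
    {w : E d → ℝ} {G : Fin d → E d → ℝ} {f : ℕ → E d → ℝ} (h : SmoothApprox W w G f) :
    ∃ T, MemLp T 2 (ν.restrict S) ∧ L2Tendsto ν S f T ∧
      ENNReal.ofReal (unitBallVol d * r ^ d) * l2Sq ν S T ≤
        ENNReal.ofReal (2 * M * (2 * R) ^ (d - 1)) * (l2Sq volume W w +
          ENNReal.ofReal (16 * d * R ^ 2) * ∑ k, l2Sq volume W (G k)) := by
  have hR : 0 < R := hW.pos.trans_le hrR
  have hfin : IsFiniteMeasure (ν.restrict S) :=
    ⟨(measure_univ_le_of_regular hR hreg hsee).trans_lt ENNReal.ofReal_lt_top⟩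
  have hWb : Bornology.IsBounded W := Metric.isBounded_ball.subset hW.subset
  have hWm := hW.isOpen.measurableSet
  have := isFiniteMeasure_restrict_of_isBounded hWb
  set c := ENNReal.ofReal (unitBallVol d * r ^ d) with hc
  have hc0 : c ≠ 0 := by
    have := unitBallVol_pos d
    have := hW.pos
    simp only [hc, ne_eq, ENNReal.ofReal_eq_zero, not_le]
    positivity
  have hct : c ≠ ⊤ := by simp [hc]
  set A := ENNReal.ofReal (2 * M * (2 * R) ^ (d - 1)) with hA
  set B := ENNReal.ofReal (16 * d * R ^ 2) with hB
  have hAt : A ≠ ⊤ := by simp [hA]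
  have hBt : B ≠ ⊤ := ENNReal.ofReal_ne_top
  have htr : ∀ {g : E d → ℝ}, ContDiff ℝ ∞ g →
      c * l2Sq ν S g ≤ A * (l2Sq volume W g + B * ∑ k, l2Sq volume W (pd k g)) := fun hg =>
    trace_inequality hd hW hrR hM (ν.restrict S) hreg hsee hg
  have hmem : ∀ {g : E d → ℝ}, ContDiff ℝ ∞ g → MemLp g 2 (volume.restrict W) := fun hg =>
    memLp_of_continuous hWb hWm hg.continuous
  have hmS : ∀ n, MemLp (f n) 2 (ν.restrict S) := by
    intro n
    rw [memLp_two_iff (h.contDiff n).continuous.aestronglyMeasurable]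
    have h1 : c * l2Sq ν S (f n) < ⊤ := by
      refine (htr (h.contDiff n)).trans_lt ?_
      refine ENNReal.mul_lt_top hAt.lt_top (ENNReal.add_lt_top.2
        ⟨l2Sq_lt_top (hmem (h.contDiff n)), ENNReal.mul_lt_top hBt.lt_top ?_⟩)
      exact ENNReal.sum_lt_top.2 fun k _ => l2Sq_lt_top (hmem (contDiff_pd (h.contDiff n) k))
    exact ENNReal.lt_top_of_mul_ne_top_right h1.ne hc0
  -- the Cauchy property
  let a : ℕ → ℝ≥0∞ := fun n => l2Sq volume W (fun x => f n x - w x) +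
    B * ∑ k, l2Sq volume W (fun x => pd k (f n) x - G k x)
  have ha : Tendsto a atTop (𝓝 0) := by
    have h1 : Tendsto (fun n => ∑ k, l2Sq volume W (fun x => pd k (f n) x - G k x)) atTop (𝓝 0) := by
      simpa using tendsto_finsetSum Finset.univ fun k _ => h.tendsto_grad k
    simpa using! h.tendsto.add (ENNReal.Tendsto.const_mul h1 (Or.inr hBt))
  have hcau : ∀ n m, c * l2Sq ν S (fun x => f n x - f m x) ≤ A * (2 * a n + 2 * a m) := by
    intro n m
    refine (htr ((h.contDiff n).sub (h.contDiff m))).trans (mul_le_mul' le_rfl ?_)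
    have key : ∀ {p q v : E d → ℝ}, MemLp p 2 (volume.restrict W) → MemLp v 2 (volume.restrict W) →
        l2Sq volume W (fun x => p x - q x) ≤
        2 * l2Sq volume W (fun x => p x - v x) + 2 * l2Sq volume W (fun x => q x - v x) := by
      intro p q v hp hv
      have := l2Sq_sub_le (μ := volume) (S := W) (f := fun x => p x - v x) (g := fun x => q x - v x)
        (hp.1.sub hv.1)
      simpa using this
    calc _ ≤ (2 * l2Sq volume W (fun x => f n x - w x) + 2 * l2Sq volume W (fun x => f m x - w x)) +
          B * ∑ k, (2 * l2Sq volume W (fun x => pd k (f n) x - G k x) +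
            2 * l2Sq volume W (fun x => pd k (f m) x - G k x)) := by
          gcongr with k
          · exact key (hmem (h.contDiff n)) h.memLp
          · rw [pd_sub k (h.contDiff n) (h.contDiff m)]
            exact key (hmem (contDiff_pd (h.contDiff n) k)) (h.memLp_grad k)
      _ = _ := by
          simp only [a, Finset.sum_add_distrib, ← Finset.mul_sum]
          ring
  have hseq : CauchySeq fun n => (hmS n).toLp (f n) := by
    rw [EMetric.cauchySeq_iff]
    intro ε hε
    have h1 : Tendsto (fun n => c⁻¹ * (A * (4 * a n))) atTop (𝓝 0) := by
      simpa using ENNReal.Tendsto.const_mul (a := c⁻¹) (ENNReal.Tendsto.const_mul (a := A)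
        (ENNReal.Tendsto.const_mul (a := 4) ha (Or.inr (by simp))) (Or.inr hAt))
        (Or.inr (ENNReal.inv_ne_top.2 hc0))
    have hε2 : (0 : ℝ≥0∞) < ε ^ 2 := ENNReal.pow_pos hε 2
    obtain ⟨N, hN⟩ := (h1.eventually (gt_mem_nhds hε2)).exists_forall_of_atTop
    refine ⟨N, fun n hn m hm => ?_⟩
    rw [Lp.edist_toLp_toLp]
    refine lt_of_pow_lt_pow_left' 2 ?_
    rw [← l2Sq_eq_eLpNorm_sq]
    have h2 : l2Sq ν S (f n - f m) ≤ c⁻¹ * (A * (2 * a n + 2 * a m)) := by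
      rw [← ENNReal.div_eq_inv_mul, ENNReal.le_div_iff_mul_le (Or.inl hc0) (Or.inl hct), mul_comm]
      exact hcau n m
    refine h2.trans_lt ?_
    rcases le_total (a n) (a m) with hnm | hnm
    · refine lt_of_le_of_lt ?_ (hN m hm)
      gcongr
      calc 2 * a n + 2 * a m ≤ 2 * a m + 2 * a m := by gcongr
        _ = 4 * a m := by ring
    · refine lt_of_le_of_lt ?_ (hN n hn)
      gcongr
      calc 2 * a n + 2 * a m ≤ 2 * a n + 2 * a n := by gcongr
        _ = 4 * a n := by ring
  obtain ⟨T, hT⟩ := cauchySeq_tendsto_of_complete hseq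
  have hTm : MemLp T 2 (ν.restrict S) := Lp.memLp T
  have hTt : L2Tendsto ν S f T := by
    have h1 := (tendsto_iff_edist_tendsto_0.1 hT)
    have h2 := (ENNReal.continuous_pow 2).continuousAt.tendsto.comp h1
    simp only [Function.comp_def] at h2
    rw [zero_pow two_ne_zero] at h2
    refine h2.congr fun n => ?_
    rw [l2Sq_eq_eLpNorm_sq, Lp.edist_def]
    congr 1
    refine eLpNorm_congr_ae ?_
    filter_upwards [(hmS n).coeFn_toLp] with x hx
    simp [hx]
  refine ⟨T, hTm, hTt, ?_⟩
  have l1 := ENNReal.Tendsto.const_mul (a := c)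
    (l2Sq_le_of_L2Tendsto (fun n => (hmS n).1) hTm.1 hTt) (Or.inr hct)
  have l2 : Tendsto (fun n => A * (l2Sq volume W (f n) + B * ∑ k, l2Sq volume W (pd k (f n)))) atTop
      (𝓝 (A * (l2Sq volume W w + B * ∑ k, l2Sq volume W (G k)))) := by
    refine ENNReal.Tendsto.const_mul (Tendsto.add ?_ (ENNReal.Tendsto.const_mul
      (tendsto_finsetSum _ fun k _ => ?_) (Or.inr hBt))) (Or.inr hAt)
    · exact l2Sq_le_of_L2Tendsto (fun n => (hmem (h.contDiff n)).1) h.memLp.1 h.tendsto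
    · exact l2Sq_le_of_L2Tendsto (fun n => (hmem (contDiff_pd (h.contDiff n) k)).1)
        (h.memLp_grad k).1 (h.tendsto_grad k)
  exact le_of_tendsto_of_tendsto' l1 l2 fun n => htr (h.contDiff n)

end Limits

/-! ### Polynomial approximation of smooth functions -/

section SmoothApproximation

variable {d : ℕ}

theorem pds_taylorPoly {j : ℕ} (i : Fin j → Fin d) (n : ℕ) {f : E d → ℝ} (hf : ContDiff ℝ ∞ f)
    (y : E d) : pds i (taylorPoly (n + j) f y) = taylorPoly n (pds i f) y := by
  induction j generalizing f with
  | zero => simp [pds_zero]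
  | succ j ih =>
    rw [pds_succ _ (contDiff_taylorPoly _ _ _), pds_succ _ hf, ← add_assoc,
      pd_taylorPoly_succ _ _ hf, ih _ (contDiff_pd hf _)]

/-- Derivatives are indexed by ordered tuples. Appending the fixed tuple `i` selects distinct
summands on the right, so the constant is one. -/
theorem sum_l2Sq_pds_pds_le {j : ℕ} (i : Fin j → Fin d) (n : ℕ) (W : Set (E d)) {f : E d → ℝ}
    (hf : ContDiff ℝ ∞ f) :
    ∑ i' : Fin n → Fin d, l2Sq volume W (pds i' (pds i f)) ≤
      ∑ i' : Fin (n + j) → Fin d, l2Sq volume W (pds i' f) := by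
  induction j generalizing f with
  | zero => simp [pds_zero]
  | succ j ih =>
    rw [pds_succ i hf, ← add_assoc, sum_snoc (j := n + j)]
    refine (ih (Fin.init i) (contDiff_pd hf _)).trans ?_
    simp only [pds_snoc _ _ hf]
    exact Finset.single_le_sum (f := fun l => ∑ i' : Fin (n + j) → Fin d,
      l2Sq volume W (pds i' (pd l f))) (fun _ _ => zero_le) (Finset.mem_univ _)

theorem lintegral_l2Sq_sub_taylorPoly_le (hd : 1 ≤ d) {W : Set (E d)} {b : E d} {r R : ℝ}
    (hW : StarPatch W b r R) (hrR : r ≤ R) (n : ℕ) {f : E d → ℝ} (hf : ContDiff ℝ ∞ f) :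
    ∫⁻ y in Metric.ball b r, l2Sq volume W (fun x => f x - taylorPoly n f y x) ≤
      ENNReal.ofReal (4 * unitBallVol d * (2 * R) ^ (2 * n + d) * d ^ n) *
        ∑ i : Fin n → Fin d, l2Sq volume W (pds i f) := by
  have hR : 0 < R := hW.pos.trans_le hrR
  have hv := unitBallVol_pos d
  cases n with
  -- Without terms nothing is subtracted and the bound is the volume of the ball. This case is
  -- needed for second derivatives when `m = 1`.
  | zero =>
    simp only [taylorPoly, Finset.range_zero, Finset.sum_empty, sub_zero, lintegral_const,
      Measure.restrict_apply_univ, Finset.univ_unique, Finset.sum_singleton, pds_zero]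
    rw [volume_ball_eq b hW.pos, mul_comm]
    refine mul_le_mul' (ENNReal.ofReal_le_ofReal ?_) le_rfl
    have h1 : r ^ d ≤ (2 * R) ^ d := pow_le_pow_left₀ hW.pos.le (by linarith) d
    have h2 : 0 ≤ (2 * R) ^ d := by positivity
    calc unitBallVol d * r ^ d ≤ unitBallVol d * (2 * R) ^ d := by gcongr
      _ ≤ 4 * (unitBallVol d * (2 * R) ^ d) := by nlinarith [mul_nonneg hv.le h2]
      _ = _ := by simp; ring
  | succ n =>
    have h := lintegral_taylor_remainder_le (M := unitBallVol d * (2 * R)) hd hW.isOpen hrR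
      (by positivity) hW.pos (volume.restrict W)
      (fun z s hs hsR => volume_regular hd W z hs hsR) hW.sees_ae n hf
    have hm : Measurable fun p : E d × E d => ‖f p.1 - taylorPoly (n + 1) f p.2 p.1‖ₑ ^ 2 := by
      have h1 := (continuous_taylorPoly (n + 1) hf).comp (continuous_swap (X := E d) (Y := E d))
      exact (((hf.continuous.comp continuous_fst).sub h1).measurable.enorm).pow_const 2
    rw [lintegral_lintegral_swap hm.aemeasurable] at h
    refine h.trans (mul_le_mul' (ENNReal.ofReal_le_ofReal (le_of_eq ?_)) le_rfl)
    obtain ⟨k, rfl⟩ : ∃ k, d = k + 1 := ⟨d - 1, by omega⟩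
    simp only [Nat.add_sub_cancel]
    ring

/-- A smooth function is approximated by a Taylor polynomial of degree `m`, in `H²`. -/
theorem exists_isPoly_approx (hd : 1 ≤ d) {m : ℕ} (hm : 1 ≤ m) (κ : ℝ) : ∃ C : ℝ, 0 ≤ C ∧
    ∀ {W : Set (E d)} {b : E d} {r R : ℝ}, StarPatch W b r R → r ≤ R → R ≤ κ * r →
    ∀ {f : E d → ℝ}, ContDiff ℝ ∞ f → ∃ P, IsPoly m P ∧
      ∀ j ≤ 2, ∀ i : Fin j → Fin d, l2Sq volume W (pds i fun x => f x - P x) ≤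
        ENNReal.ofReal (C * R ^ (2 * (m + 1 - j))) *
          ∑ i' : Fin (m + 1) → Fin d, l2Sq volume W (pds i' f) := by
  let N : ℝ := ∑ j : Fin 3, (d : ℝ) ^ (j : ℕ)
  refine ⟨4 ^ (m + 1) * (N * (4 * (2 * |κ|) ^ d * d ^ (m + 1))), by positivity,
    fun {W b r R} hW hrR hRr {f} hf => ?_⟩
  have hR : 0 < R := hW.pos.trans_le hrR
  have hv := unitBallVol_pos d
  have h5 : 0 ≤ N * (4 * (2 * |κ|) ^ d * d ^ (m + 1)) := by positivity
  have hκ : R ≤ |κ| * r := hRr.trans (mul_le_mul_of_nonneg_right (le_abs_self κ) hW.pos.le)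
  set S := ∑ i' : Fin (m + 1) → Fin d, l2Sq volume W (pds i' f) with hS
  let n : ℕ → ℕ := fun j => m + 1 - j
  let A : (j : Fin 3) → (Fin j → Fin d) → E d → ℝ≥0∞ := fun j i y =>
    l2Sq volume W (fun x => pds i f x - taylorPoly (n j) (pds i f) y x)
  -- All errors up to order two are scaled to have the same bound and then added. A centre that is
  -- good for the sum is good for every derivative.
  let F : E d → ℝ≥0∞ := fun y => ∑ j : Fin 3, ∑ i : Fin j → Fin d,
    ENNReal.ofReal ((2 * R) ^ (2 * n j))⁻¹ * A j i y
  have hAm : ∀ j i, Measurable (A j i) := by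
    intro j i
    have hg := contDiff_pds i hf
    have h1 := continuous_taylorPoly (n j) hg
    have hm : Measurable fun p : E d × E d => ‖pds i f p.2 - taylorPoly (n j) (pds i f) p.1 p.2‖ₑ ^ 2 :=
      (((hg.continuous.comp continuous_snd).sub h1).measurable.enorm).pow_const 2
    exact hm.lintegral_prod_right'
  have hFm : Measurable F := Finset.measurable_sum _ fun j _ => Finset.measurable_sum _ fun i _ =>
    (hAm j i).const_mul _
  have hA : ∀ (j : Fin 3) (i : Fin j → Fin d), ∫⁻ y in Metric.ball b r, ENNReal.ofReal ((2 * R) ^ (2 * n j))⁻¹ * A j i y ≤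
      ENNReal.ofReal (4 * unitBallVol d * (2 * R) ^ d * d ^ (m + 1)) * S := by
    intro j i
    rw [lintegral_const_mul' _ _ (by simp)]
    have h1 := lintegral_l2Sq_sub_taylorPoly_le hd hW hrR (n j) (contDiff_pds i hf)
    have hj : n j + j = m + 1 := by simp only [n]; have := j.2; omega
    have h2 := sum_l2Sq_pds_pds_le i (n j) W hf
    rw [hj] at h2
    calc _ ≤ ENNReal.ofReal ((2 * R) ^ (2 * n j))⁻¹ *
          (ENNReal.ofReal (4 * unitBallVol d * (2 * R) ^ (2 * n j + d) * d ^ n j) * S) := by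
          gcongr
          exact h1.trans (mul_le_mul' le_rfl h2)
      _ = ENNReal.ofReal (4 * unitBallVol d * (2 * R) ^ d * d ^ n j) * S := by
          rw [← mul_assoc, ← ENNReal.ofReal_mul (by positivity)]
          congr 2
          field_simp
          ring
      _ ≤ _ := by
          have : (1 : ℝ) ≤ d := by exact_mod_cast hd
          gcongr
          exact Nat.sub_le _ _
  have hF : ∫⁻ y in Metric.ball b r, F y ≤
      ENNReal.ofReal (N * (4 * unitBallVol d * (2 * R) ^ d * d ^ (m + 1))) * S := by
    simp only [F]
    rw [lintegral_finsetSum _ fun j _ => Finset.measurable_sum _ fun i _ => (hAm j i).const_mul _]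
    calc _ ≤ ∑ j : Fin 3, ∑ i : Fin j → Fin d,
          ENNReal.ofReal (4 * unitBallVol d * (2 * R) ^ d * d ^ (m + 1)) * S := by
          refine Finset.sum_le_sum fun j _ => ?_
          rw [lintegral_finsetSum _ fun i _ => (hAm j i).const_mul _]
          exact Finset.sum_le_sum fun i _ => hA j i
      _ = _ := by
          simp only [Finset.sum_const, Finset.card_univ, Fintype.card_pi, Fintype.card_fin,
            Finset.prod_const, nsmul_eq_mul, ← Finset.sum_mul]
          rw [← mul_assoc, ENNReal.ofReal_mul (p := N) (by positivity)]
          congr 2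
          simp only [N]
          rw [ENNReal.ofReal_sum_of_nonneg fun j _ => by positivity]
          refine Finset.sum_congr rfl fun j _ => ?_
          rw [ENNReal.ofReal_pow (by positivity)]
          simp
  have hB0 : volume (Metric.ball b r) ≠ 0 := (Metric.measure_ball_pos _ _ hW.pos).ne'
  have hBt : volume (Metric.ball b r) ≠ ⊤ := measure_ball_lt_top.ne
  -- Somewhere the sum of the errors is at most its average. Picking this centre makes smoothing of
  -- the Taylor polynomial over the ball unnecessary.
  obtain ⟨y, -, hy⟩ := exists_le_setLAverage hB0 hBt hFm.aemeasurable
  have hFy : F y ≤ ENNReal.ofReal (N * (4 * (2 * |κ|) ^ d * d ^ (m + 1))) * S := by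
    refine hy.trans ?_
    rw [setLAverage_eq, ENNReal.div_le_iff hB0 hBt]
    refine hF.trans ?_
    rw [mul_right_comm (ENNReal.ofReal _) S, volume_ball_eq b hW.pos, ← ENNReal.ofReal_mul (by positivity)]
    refine mul_le_mul' (ENNReal.ofReal_le_ofReal ?_) le_rfl
    have h1 : (2 * R) ^ d ≤ (2 * |κ|) ^ d * r ^ d := by
      rw [← mul_pow]
      exact pow_le_pow_left₀ (by positivity) (by linarith) d
    have h2 : 0 ≤ N * (4 * unitBallVol d * d ^ (m + 1)) := by positivity
    calc _ = N * (4 * unitBallVol d * d ^ (m + 1)) * (2 * R) ^ d := by ring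
      _ ≤ N * (4 * unitBallVol d * d ^ (m + 1)) * ((2 * |κ|) ^ d * r ^ d) := by gcongr
      _ = _ := by ring
  refine ⟨taylorPoly (m + 1) f y, isPoly_taylorPoly m f y, fun j hj i => ?_⟩
  have hjn : m + 1 = n j + j := by simp only [n]; omega
  have e : pds i (fun x => f x - taylorPoly (m + 1) f y x) =
      fun x => pds i f x - taylorPoly (n j) (pds i f) y x := by
    rw [pds_sub i hf (contDiff_taylorPoly _ _ _), hjn, pds_taylorPoly i (n j) hf y]
  rw [e]
  have h1 : ENNReal.ofReal ((2 * R) ^ (2 * n j))⁻¹ * A ⟨j, by omega⟩ i y ≤ F y :=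
    (Finset.single_le_sum (f := fun i : Fin j → Fin d => ENNReal.ofReal ((2 * R) ^ (2 * n j))⁻¹ *
      A ⟨j, by omega⟩ i y) (fun _ _ => zero_le) (Finset.mem_univ i)).trans
    (Finset.single_le_sum (f := fun j : Fin 3 => ∑ i : Fin j → Fin d,
      ENNReal.ofReal ((2 * R) ^ (2 * n j))⁻¹ * A j i y) (fun _ _ => zero_le)
      (Finset.mem_univ (⟨j, by omega⟩ : Fin 3)))
  have h2 : A ⟨j, by omega⟩ i y ≤ ENNReal.ofReal ((2 * R) ^ (2 * n j)) *
      (ENNReal.ofReal (N * (4 * (2 * |κ|) ^ d * d ^ (m + 1))) * S) := by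
    calc A ⟨j, by omega⟩ i y = ENNReal.ofReal ((2 * R) ^ (2 * n j)) *
          (ENNReal.ofReal ((2 * R) ^ (2 * n j))⁻¹ * A ⟨j, by omega⟩ i y) := by
          rw [← mul_assoc, ← ENNReal.ofReal_mul (by positivity), mul_inv_cancel₀ (by positivity)]
          simp
      _ ≤ _ := mul_le_mul' le_rfl (h1.trans hFy)
  refine h2.trans ?_
  rw [← mul_assoc, ← ENNReal.ofReal_mul (by positivity)]
  refine mul_le_mul' (ENNReal.ofReal_le_ofReal ?_) le_rfl
  have h4 : (2 * R) ^ (2 * n j) ≤ 4 ^ (m + 1) * R ^ (2 * n j) := by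
    rw [mul_pow, pow_mul 2]
    norm_num only
    gcongr
    · norm_num
    · exact Nat.sub_le _ _
  calc _ ≤ 4 ^ (m + 1) * R ^ (2 * n j) * (N * (4 * (2 * |κ|) ^ d * d ^ (m + 1))) :=
        mul_le_mul_of_nonneg_right h4 h5
    _ = _ := by simp only [n]; ring

end SmoothApproximation

/-! ### Density of smooth functions in Sobolev spaces on star-shaped sets -/

section Density

variable {d : ℕ}

/-- The convolution of `g` with the kernel `ψ`. -/
noncomputable def mollify (ψ g : E d → ℝ) (x : E d) : ℝ := ∫ z, g z * ψ (x - z)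

theorem contDiff_mollify {ψ g : E d → ℝ} (hψ : ContDiff ℝ ∞ ψ) (hc : HasCompactSupport ψ)
    (hg : LocallyIntegrable g volume) : ContDiff ℝ ∞ (mollify ψ g) :=
  HasCompactSupport.contDiff_convolution_right (n := ⊤) (ContinuousLinearMap.mul ℝ ℝ) hc hg hψ

theorem pd_mollify {ψ g : E d → ℝ} (hψ : ContDiff ℝ ∞ ψ) (hc : HasCompactSupport ψ)
    (hg : LocallyIntegrable g volume) (k : Fin d) :
    pd k (mollify ψ g) = mollify (pd k ψ) g := by
  ext x
  have h1 : ContDiff ℝ 1 ψ := hψ.of_le (by exact_mod_cast le_top)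
  have h := hc.hasFDerivAt_convolution_right (ContinuousLinearMap.mul ℝ ℝ) hg h1 x
  have e : mollify ψ g = MeasureTheory.convolution g ψ (ContinuousLinearMap.mul ℝ ℝ) volume := rfl
  rw [pd, e, h.fderiv, convolution_precompR_apply _ hg (hc.fderiv ℝ) (hψ.continuous_fderiv (by simp))]
  rfl

theorem hasCompactSupport_pd {ψ : E d → ℝ} (hc : HasCompactSupport ψ) (k : Fin d) :
    HasCompactSupport (pd k ψ) := hc.fderiv_apply ℝ _

theorem pds_mollify {j : ℕ} (i : Fin j → Fin d) {ψ g : E d → ℝ} (hψ : ContDiff ℝ ∞ ψ)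
    (hc : HasCompactSupport ψ) (hg : LocallyIntegrable g volume) :
    pds i (mollify ψ g) = mollify (pds i ψ) g := by
  induction j generalizing ψ with
  | zero => simp [pds_zero]
  | succ j ih =>
    rw [pds_succ i (contDiff_mollify hψ hc hg), pds_succ i hψ, pd_mollify hψ hc hg,
      ih _ (contDiff_pd hψ _) (hasCompactSupport_pd hc _)]

theorem pd_comp_smul_add (k : Fin d) {f : E d → ℝ} (hf : ContDiff ℝ ∞ f) (s : ℝ) (c : E d) :
    pd k (fun x => f (s • x + c)) = fun x => s * pd k f (s • x + c) := by
  ext x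
  have h1 : HasFDerivAt (fun x : E d => s • x + c) (s • ContinuousLinearMap.id ℝ (E d)) x :=
    ((hasFDerivAt_id x).const_smul s).add_const c
  have h2 := ((hf.contDiffAt (x := s • x + c)).differentiableAt (by simp)).hasFDerivAt
  have h3 : HasFDerivAt (fun x => f (s • x + c)) _ x := h2.comp x h1
  simp [pd, h3.fderiv]

theorem pds_const_mul {j : ℕ} (i : Fin j → Fin d) (c : ℝ) {f : E d → ℝ} (hf : ContDiff ℝ ∞ f) :
    pds i (fun x => c * f x) = fun x => c * pds i f x := by
  induction j generalizing f with
  | zero => simp [pds_zero]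
  | succ j ih =>
    rw [pds_succ i (contDiff_const.mul hf), pds_succ i hf, pd_const_mul _ _ hf,
      ih _ (contDiff_pd hf _)]

theorem pds_comp_smul_add {j : ℕ} (i : Fin j → Fin d) {f : E d → ℝ} (hf : ContDiff ℝ ∞ f) (s : ℝ)
    (c : E d) : pds i (fun x => f (s • x + c)) = fun x => s ^ j * pds i f (s • x + c) := by
  have haff : ContDiff ℝ ∞ fun x : E d => s • x + c := by fun_prop
  induction j generalizing f with
  | zero => simp [pds_zero]
  | succ j ih =>
    have h1 := contDiff_pd hf (i (Fin.last j))
    have h2 : pds i (fun x => f (s • x + c)) =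
        pds (Fin.init i) (pd (i (Fin.last j)) fun x => f (s • x + c)) := pds_succ i (hf.comp haff)
    rw [h2, pds_succ i hf, pd_comp_smul_add _ hf,
      pds_const_mul _ _ (f := fun x => pd (i (Fin.last j)) f (s • x + c)) (h1.comp haff), ih _ h1]
    ext x
    ring

/-- Jensen's inequality for the probability density `ψ`, obtained from Cauchy–Schwarz by splitting
`ψ` into two square roots. -/
theorem enorm_mollify_sq_le {ψ g : E d → ℝ} (hψc : Continuous ψ) (hψ0 : ∀ x, 0 ≤ ψ x)
    (hψi : Integrable ψ) (hψ1 : ∫ x, ψ x = 1) (hg : AEStronglyMeasurable g volume) (x : E d) :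
    ‖mollify ψ g x‖ₑ ^ 2 ≤ ∫⁻ z, ‖g z‖ₑ ^ 2 * ENNReal.ofReal (ψ (x - z)) := by
  have hm : AEMeasurable (fun z => ENNReal.ofReal (ψ (x - z))) volume :=
    (ENNReal.measurable_ofReal.comp (hψc.comp (continuous_const.sub continuous_id)).measurable).aemeasurable
  have h1 : ‖mollify ψ g x‖ₑ ≤ ∫⁻ z, ‖g z‖ₑ * ENNReal.ofReal (ψ (x - z)) := by
    refine (enorm_integral_le_lintegral_enorm _).trans (le_of_eq (lintegral_congr fun z => ?_))
    rw [enorm_mul, Real.enorm_of_nonneg (hψ0 _)]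
  have h2 : ∫⁻ z, ENNReal.ofReal (ψ (x - z)) = 1 := by
    rw [lintegral_sub_left_eq_self (fun z => ENNReal.ofReal (ψ z)) x,
      ← ofReal_integral_eq_lintegral_ofReal hψi (Eventually.of_forall hψ0), hψ1]
    simp
  have h3 := ENNReal.lintegral_mul_le_Lp_mul_Lq volume (p := 2) (q := 2)
    Real.HolderConjugate.two_two (f := fun z => ENNReal.ofReal (ψ (x - z)) ^ (1 / 2 : ℝ))
    (g := fun z => ‖g z‖ₑ * ENNReal.ofReal (ψ (x - z)) ^ (1 / 2 : ℝ))
    (hm.pow_const _) (hg.enorm.mul (hm.pow_const _))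
  have e1 : ∀ a : ℝ≥0∞, a ^ (1 / 2 : ℝ) * a ^ (1 / 2 : ℝ) = a := fun a => by
    rw [← ENNReal.rpow_add_of_nonneg _ _ (by norm_num) (by norm_num)]; norm_num
  have e2 : ∀ a : ℝ≥0∞, (a ^ (1 / 2 : ℝ)) ^ (2 : ℝ) = a := fun a => by
    rw [← ENNReal.rpow_mul]; norm_num
  have e3 : ∀ a : ℝ≥0∞, (a ^ (1 / 2 : ℝ)) ^ 2 = a := fun a => by
    rw [← ENNReal.rpow_natCast]; exact e2 a
  have e4 : ∀ z, ((fun z => ENNReal.ofReal (ψ (x - z)) ^ (1 / 2 : ℝ)) *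
      (fun z => ‖g z‖ₑ * ENNReal.ofReal (ψ (x - z)) ^ (1 / 2 : ℝ))) z =
      ‖g z‖ₑ * ENNReal.ofReal (ψ (x - z)) := fun z => by
    simp only [Pi.mul_apply]
    rw [mul_left_comm, e1]
  simp only [e4, e2, h2, ENNReal.one_rpow, one_mul, ENNReal.mul_rpow_of_nonneg _ _ zero_le_two,
    ENNReal.rpow_ofNat] at h3
  calc _ ≤ _ := pow_le_pow_left' (h1.trans h3) 2
    _ = _ := e3 _

/-- Integrate the pointwise bound in `x` first: the kernel has mass one, and the dilation
contributes its Jacobian. The bound is uniform in the width of the kernel, as the density argument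
requires. -/
theorem l2Sq_mollify_comp_le {ψ g : E d → ℝ} (hψc : Continuous ψ) (hψ0 : ∀ x, 0 ≤ ψ x)
    (hψi : Integrable ψ) (hψ1 : ∫ x, ψ x = 1) (hg : AEStronglyMeasurable g volume)
    {s : ℝ} (hs : 0 < s) (c : E d) (W : Set (E d)) :
    l2Sq volume W (fun x => mollify ψ g (s • x + c)) ≤
      ENNReal.ofReal (s ^ d)⁻¹ * l2Sq volume univ g := by
  have hm : AEMeasurable (fun p : E d × E d => ‖g p.2‖ₑ ^ 2 *
      ENNReal.ofReal (ψ (s • p.1 + c - p.2))) (volume.prod volume) := by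
    refine AEMeasurable.mul (hg.comp_snd.enorm.pow_const 2) ?_
    exact (ENNReal.measurable_ofReal.comp (hψc.comp (by fun_prop)).measurable).aemeasurable
  calc _ ≤ ∫⁻ x, ∫⁻ z, ‖g z‖ₑ ^ 2 * ENNReal.ofReal (ψ (s • x + c - z)) :=
        (setLIntegral_le_lintegral _ _).trans
          (lintegral_mono fun x => enorm_mollify_sq_le hψc hψ0 hψi hψ1 hg _)
    _ = ∫⁻ z, ∫⁻ x, ‖g z‖ₑ ^ 2 * ENNReal.ofReal (ψ (s • x + c - z)) :=
        lintegral_lintegral_swap hm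
    _ = ∫⁻ z, ‖g z‖ₑ ^ 2 * ENNReal.ofReal (s ^ d)⁻¹ := by
        refine lintegral_congr fun z => ?_
        have hmψ : Measurable fun x => ENNReal.ofReal (ψ x) :=
          ENNReal.measurable_ofReal.comp hψc.measurable
        have hme : Measurable fun x => ENNReal.ofReal (ψ (s • x + c - z)) :=
          ENNReal.measurable_ofReal.comp (hψc.comp (by fun_prop)).measurable
        rw [lintegral_const_mul _ hme]
        congr 1
        have h1 := lintegral_comp_add_smul_sub (0 : E d) hs
          (F := fun y => ENNReal.ofReal (ψ (y + (c - z)))) (hmψ.comp (by fun_prop))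
        simp only [zero_add, sub_zero] at h1
        simp only [add_sub_assoc]
        rw [h1, lintegral_add_right_eq_self (fun y => ENNReal.ofReal (ψ y)) (c - z),
          ← ofReal_integral_eq_lintegral_ofReal hψi (Eventually.of_forall hψ0), hψ1]
        simp
    _ = _ := by
        rw [lintegral_mul_const'' _ (hg.enorm.pow_const 2), mul_comm, l2Sq, Measure.restrict_univ]

theorem L2Tendsto.const_mul {W : Set (E d)} {f : ℕ → E d → ℝ} {w : E d → ℝ} {c : ℕ → ℝ}
    (h : L2Tendsto volume W f w) (hf : ∀ n, AEStronglyMeasurable (f n) (volume.restrict W))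
    (hw : MemLp w 2 (volume.restrict W)) (hc : Tendsto c atTop (𝓝 1)) :
    L2Tendsto volume W (fun n x => c n * f n x) w := by
  have hmul : ∀ (a : ℝ) (g : E d → ℝ), l2Sq volume W (fun x => a * g x) =
      ‖a‖ₑ ^ 2 * l2Sq volume W g := fun a g => by
    simp only [l2Sq, enorm_mul, mul_pow]
    rw [lintegral_const_mul' _ _ (by simp)]
  have hb : ∀ n, l2Sq volume W (fun x => c n * f n x - w x) ≤
      2 * (‖c n‖ₑ ^ 2 * l2Sq volume W (fun x => f n x - w x)) +
        2 * (‖c n - 1‖ₑ ^ 2 * l2Sq volume W w) := fun n => by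
    have e : (fun x => c n * f n x - w x) =
      fun x => c n * (f n x - w x) + (c n - 1) * w x := by ext x; ring
    rw [e, ← hmul, ← hmul]
    exact l2Sq_add_le (((hf n).sub hw.1).const_mul _)
  have t1 : Tendsto (fun n => ‖c n‖ₑ ^ 2) atTop (𝓝 1) := by
    have := (ENNReal.continuous_pow 2).tendsto _ |>.comp ((continuous_enorm.tendsto _).comp hc)
    simpa using! this
  have t2 : Tendsto (fun n => ‖c n - 1‖ₑ ^ 2) atTop (𝓝 0) := by
    have := (ENNReal.continuous_pow 2).tendsto _ |>.comp
      ((continuous_enorm.tendsto _).comp (hc.sub_const 1))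
    simpa using! this
  refine tendsto_of_tendsto_of_tendsto_of_le_of_le tendsto_const_nhds ?_ (fun _ => bot_le) hb
  have h1 := ENNReal.Tendsto.const_mul (a := 2)
    (ENNReal.Tendsto.mul t1 (Or.inr (by simp)) h (Or.inr (by simp))) (Or.inr (by simp))
  have h2 := ENNReal.Tendsto.const_mul (a := 2)
    (ENNReal.Tendsto.mul_const t2 (Or.inr (l2Sq_lt_top hw).ne)) (Or.inr (by simp))
  simpa using! h1.add h2

theorem abs_mollify_le {ψ h : E d → ℝ} (hψ0 : ∀ x, 0 ≤ ψ x)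
    (hψi : Integrable ψ) (hψ1 : ∫ x, ψ x = 1) {B : ℝ} (hB : ∀ x, ‖h x‖ ≤ B) (x : E d) :
    ‖mollify ψ h x‖ ≤ B := by
  have h1 : Integrable fun z => B * ψ (x - z) := (hψi.comp_sub_left x).const_mul B
  refine (norm_integral_le_of_norm_le h1 (Eventually.of_forall fun z => ?_)).trans (le_of_eq ?_)
  · rw [norm_mul, Real.norm_of_nonneg (hψ0 _)]
    exact mul_le_mul_of_nonneg_right (hB z) (hψ0 _)
  · rw [integral_const_mul, integral_sub_left_eq_self ψ volume x, hψ1, mul_one]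

theorem mollify_sub {ψ g h : E d → ℝ} (hψ : Continuous ψ) (hc : HasCompactSupport ψ)
    (hg : LocallyIntegrable g volume) (hh : LocallyIntegrable h volume) (x : E d) :
    mollify ψ (fun z => g z - h z) x = mollify ψ g x - mollify ψ h x := by
  have e : ∀ {f : E d → ℝ}, LocallyIntegrable f volume → Integrable fun z => f z * ψ (x - z) := by
    intro f hf
    exact (hc.convolutionExists_right (ContinuousLinearMap.mul ℝ ℝ) hf hψ x)
  rw [mollify, mollify, mollify, ← integral_sub (e hg) (e hh)]
  exact integral_congr_ae (Eventually.of_forall fun z => by simp only [sub_mul])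

/-- Mollification, combined with dilations, converges in `L²`. -/
theorem tendsto_mollify {W : Set (E d)} (hWb : Bornology.IsBounded W) {φ : ℕ → ContDiffBump (0 : E d)}
    (hφ : Tendsto (fun n => (φ n).rOut) atTop (𝓝 0)) {s : ℕ → ℝ} (hs : Tendsto s atTop (𝓝 1))
    (hs2 : ∀ n, 1 / 2 ≤ s n) {c : ℕ → E d} (hc : Tendsto c atTop (𝓝 0)) {g : E d → ℝ}
    (hg : MemLp g 2 volume) :
    L2Tendsto volume W (fun n x => mollify ((φ n).normed volume) g (s n • x + c n)) g := by
  have hfinW := isFiniteMeasure_restrict_of_isBounded hWb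
  have hloc : ∀ {h : E d → ℝ}, MemLp h 2 volume → LocallyIntegrable h volume := fun hh =>
    hh.locallyIntegrable (by norm_num)
  have hcont : ∀ {h : E d → ℝ} n, MemLp h 2 volume →
      Continuous fun x => mollify ((φ n).normed volume) h (s n • x + c n) := by
    intro h n hh
    exact (contDiff_mollify (φ n).contDiff_normed (φ n).hasCompactSupport_normed
      (hloc hh)).continuous.comp (by fun_prop)
  -- continuous functions
  have hcs : ∀ h : E d → ℝ, Continuous h → HasCompactSupport h →
      L2Tendsto volume W (fun n x => mollify ((φ n).normed volume) h (s n • x + c n)) h := by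
    intro h hh hhc
    obtain ⟨B, hB⟩ := hh.bounded_above_of_compact_support hhc
    have hhm : MemLp h 2 volume := hh.memLp_of_hasCompactSupport hhc
    have hpt : ∀ x, Tendsto (fun n => ‖mollify ((φ n).normed volume) h (s n • x + c n) - h x‖ₑ ^ 2)
        atTop (𝓝 0) := by
      intro x
      have hk : Tendsto (fun n => s n • x + c n) atTop (𝓝 x) := by
        simpa using (hs.smul_const x).add hc
      have h1 := ContDiffBump.convolution_tendsto_right (μ := volume) (g := fun _ : ℕ => h) (z₀ := h x)
        hφ (Eventually.of_forall fun _ => hh.aestronglyMeasurable)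
        ((hh.tendsto x).comp tendsto_snd) hk
      have e : ∀ n, (MeasureTheory.convolution ((φ n).normed volume) h
          (ContinuousLinearMap.lsmul ℝ ℝ) volume) (s n • x + c n) =
          mollify ((φ n).normed volume) h (s n • x + c n) := by
        intro n
        rw [convolution_lsmul_swap, mollify]
        exact integral_congr_ae (Eventually.of_forall fun z => by simp [mul_comm])
      simp only [e] at h1
      have h2 := (ENNReal.continuous_pow 2).tendsto _ |>.comp
        ((continuous_enorm.tendsto _).comp (h1.sub_const (h x)))
      simpa using! h2
    have := tendsto_lintegral_of_dominated_convergence (μ := volume.restrict W)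
      (F := fun n x => ‖mollify ((φ n).normed volume) h (s n • x + c n) - h x‖ₑ ^ 2)
      (f := fun _ => 0) (fun _ => ENNReal.ofReal (2 * B) ^ 2)
      (fun n => (((hcont n hhm).sub hh).measurable.enorm).pow_const 2)
      (fun n => Eventually.of_forall fun x => by
        refine pow_le_pow_left' ?_ 2
        rw [← ofReal_norm]
        refine ENNReal.ofReal_le_ofReal ((norm_sub_le _ _).trans ?_)
        have := abs_mollify_le (φ n).nonneg_normed (φ n).integrable_normed (φ n).integral_normed
          hB (s n • x + c n)
        linarith [hB x])
      (by
        rw [lintegral_const]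
        exact ENNReal.mul_ne_top (ENNReal.pow_ne_top ENNReal.ofReal_ne_top) (measure_ne_top _ _))
      (Eventually.of_forall hpt)
    simpa using! this
  -- approximation
  rw [L2Tendsto, ENNReal.tendsto_nhds_zero]
  intro ε hε
  -- Dilation factors are at least one half, so their inverse Jacobians are at most `2 ^ d`.
  obtain ⟨K, hK⟩ : ∃ K : ℝ≥0∞, K = ENNReal.ofReal (2 ^ d) := ⟨_, rfl⟩
  have hKt : K ≠ ⊤ := by simp [hK]
  -- The polynomial in `η` is what two applications of `(a + b)² ≤ 2a² + 2b²` leave: `2 (K η²) + 2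
  -- (2 η + 2 η²)`.
  obtain ⟨η, hη, hηε⟩ : ∃ η : ℝ≥0∞, 0 < η ∧ (2 * K + 4) * η ^ 2 + 4 * η ≤ ε := by
    have ht : Tendsto (fun η : ℝ≥0∞ => (2 * K + 4) * η ^ 2 + 4 * η) (𝓝 0) (𝓝 0) := by
      have h1 := ENNReal.Tendsto.const_mul (a := 2 * K + 4)
        ((ENNReal.continuous_pow 2).tendsto 0) (Or.inr (by simp [ENNReal.mul_ne_top, hKt]))
      have h2 := ENNReal.Tendsto.const_mul (a := 4) (tendsto_id (x := 𝓝 (0 : ℝ≥0∞)))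
        (Or.inr (by simp))
      simpa using! h1.add h2
    have := (ht.mono_left (nhdsWithin_le_nhds (s := Ioi 0))).eventually (ge_mem_nhds hε)
    obtain ⟨η, h1, h2⟩ := (this.and self_mem_nhdsWithin).exists
    exact ⟨η, h2, h1⟩
  obtain ⟨h, hhc, hhe, hhcont, hhm⟩ := hg.exists_hasCompactSupport_eLpNorm_sub_le (by norm_num) hη.ne'
  have hgh : l2Sq volume univ (fun x => g x - h x) ≤ η ^ 2 := by
    rw [l2Sq_eq_eLpNorm_sq, Measure.restrict_univ]
    exact pow_le_pow_left' hhe 2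
  filter_upwards [(ENNReal.tendsto_nhds_zero.1 (hcs h hhcont hhc)) η hη] with n hn
  have hsn : 0 < s n := by linarith [hs2 n]
  have h1 : l2Sq volume W (fun x => mollify ((φ n).normed volume) (fun z => g z - h z)
      (s n • x + c n)) ≤ K * η ^ 2 := by
    refine (l2Sq_mollify_comp_le (φ n).continuous_normed (φ n).nonneg_normed
      (φ n).integrable_normed (φ n).integral_normed (hg.1.sub hhm.1) hsn (c n) W).trans ?_
    refine mul_le_mul' ?_ hgh
    rw [hK]
    refine ENNReal.ofReal_le_ofReal ?_
    rw [← inv_pow]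
    refine pow_le_pow_left₀ (by positivity) ?_ d
    rw [inv_le_comm₀ hsn two_pos]
    simpa using hs2 n
  have e : (fun x => mollify ((φ n).normed volume) g (s n • x + c n) - g x) = fun x =>
      mollify ((φ n).normed volume) (fun z => g z - h z) (s n • x + c n) +
      ((mollify ((φ n).normed volume) h (s n • x + c n) - h x) - (g x - h x)) := by
    ext x
    rw [mollify_sub (φ n).continuous_normed (φ n).hasCompactSupport_normed (hloc hg) (hloc hhm)]
    ring
  rw [e]
  have hgr : AEStronglyMeasurable (fun x => g x - h x) (volume.restrict W) :=
    (hg.1.sub hhm.1).restrict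
  calc _ ≤ 2 * (K * η ^ 2) + 2 * (2 * η + 2 * η ^ 2) := by
        refine (l2Sq_add_le (hcont n (hg.sub hhm)).aestronglyMeasurable).trans ?_
        refine add_le_add (mul_le_mul' le_rfl h1) (mul_le_mul' le_rfl ?_)
        refine (l2Sq_sub_le ((hcont n hhm).sub hhcont).aestronglyMeasurable).trans ?_
        exact add_le_add (mul_le_mul' le_rfl hn)
          (mul_le_mul' le_rfl ((l2Sq_mono_set (subset_univ _) _).trans hgh))
    _ = (2 * K + 4) * η ^ 2 + 4 * η := by ring
    _ ≤ ε := hηε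

/-- Smooth functions are dense in Sobolev spaces on star-shaped sets. One sequence approximates
all weak derivatives that exist. -/
theorem exists_smooth_tendsto {W : Set (E d)} {b : E d} {r R : ℝ} (hW : StarPatch W b r R)
    {u : E d → ℝ} (hu : MemLp u 2 (volume.restrict W)) :
    ∃ φ : ℕ → E d → ℝ, (∀ n, ContDiff ℝ ∞ (φ n)) ∧
      ∀ (j : ℕ) (i : Fin j → Fin d) (g : E d → ℝ), HasWeakDeriv W i u g →
        L2Tendsto volume W (fun n => pds i (φ n)) g := by
  have hr := hW.pos
  have hWm := hW.isOpen.measurableSet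
  have hWb : Bornology.IsBounded W := Metric.isBounded_ball.subset hW.subset
  -- The shift by two keeps `t n ≤ 1/2`, so the dilation factor `1 - t n` is at least one half.
  let t : ℕ → ℝ := fun n => 1 / ((n : ℝ) + 1 + 1)
  have ht0 : ∀ n, 0 < t n := fun n => by positivity
  have ht2 : ∀ n, t n ≤ 1 / 2 := fun n =>
    one_div_le_one_div_of_le two_pos (by have : (0 : ℝ) ≤ n := Nat.cast_nonneg n; linarith)
  have ht : Tendsto t atTop (𝓝 0) := by
    have := (tendsto_add_atTop_iff_nat 1).2 (tendsto_one_div_add_atTop_nhds_zero_nat (𝕜 := ℝ))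
    simpa [t] using this
  -- The width `t n * r / 2` is less than `t n * r`, the distance that the contraction towards `b`
  -- gains from the boundary of `W`.
  let ψ : ℕ → ContDiffBump (0 : E d) := fun n =>
    ⟨t n * r / 4, t n * r / 2, by have := ht0 n; positivity, by
      have := mul_pos (ht0 n) hr; linarith⟩
  have hext : ∀ {g : E d → ℝ}, MemLp g 2 (volume.restrict W) → MemLp (W.indicator g) 2 volume :=
    fun hg => (memLp_indicator_iff_restrict hWm).2 hg
  have hloc : ∀ {g : E d → ℝ}, MemLp g 2 (volume.restrict W) →
      LocallyIntegrable (W.indicator g) volume := fun hg => (hext hg).locallyIntegrable (by norm_num)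
  let a : ℕ → E d → E d := fun n x => (1 - t n) • x + t n • b
  have hsm : ∀ n, ContDiff ℝ ∞ (mollify ((ψ n).normed volume) (W.indicator u)) := fun n =>
    contDiff_mollify (ψ n).contDiff_normed (ψ n).hasCompactSupport_normed (hloc hu)
  refine ⟨fun n x => mollify ((ψ n).normed volume) (W.indicator u) (a n x), fun n =>
    (hsm n).comp (by fun_prop), fun j i g hg => ?_⟩
  have hs : Tendsto (fun n => 1 - t n) atTop (𝓝 1) := by simpa using ht.const_sub 1
  -- For `x` in `W` the kernel centred at the contracted point is a test function on `W`. All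
  -- derivatives can therefore be moved onto `u`, although `u` is cut off at the boundary.
  have key : ∀ n, ∀ x ∈ W, pds i (fun x => mollify ((ψ n).normed volume) (W.indicator u) (a n x)) x =
      (1 - t n) ^ j * mollify ((ψ n).normed volume) (W.indicator g) (a n x) := by
    intro n x hx
    set η : E d → ℝ := (ψ n).normed volume with hη
    have hηs : ContDiff ℝ ∞ η := (ψ n).contDiff_normed
    have hηc : HasCompactSupport η := (ψ n).hasCompactSupport_normed
    rw [pds_comp_smul_add i (hsm n), pds_mollify i hηs hηc (hloc hu)]
    have hrefl : (fun z => η (a n x - z)) = fun z => η ((-1 : ℝ) • z + a n x) := by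
      ext z; congr 1; rw [neg_one_smul]; abel
    have hζs : ContDiff ℝ ∞ fun z => η (a n x - z) := hηs.comp (by fun_prop)
    have hsupp : tsupport (fun z => η (a n x - z)) ⊆ Metric.closedBall (a n x) (t n * r / 2) := by
      refine closure_minimal (fun z hz => ?_) Metric.isClosed_closedBall
      have h1 : a n x - z ∈ Function.support η := hz
      rw [hη, (ψ n).support_normed_eq, mem_ball_zero_iff] at h1
      rw [Metric.mem_closedBall, dist_comm, dist_eq_norm]
      exact h1.le
    -- A point near `a n x` is `x + t (y - x)` with `y = b + t⁻¹ (z - a n x)` in the ball `B(b, r)`,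
    -- so star-shapedness places it in `W`.
    have hsub : Metric.closedBall (a n x) (t n * r / 2) ⊆ W := by
      intro z hz
      have h1 : b + (t n)⁻¹ • (z - a n x) ∈ Metric.ball b r := by
        rw [mem_ball_iff_norm, add_sub_cancel_left, norm_smul, norm_inv,
          Real.norm_of_nonneg (ht0 n).le, inv_mul_lt_iff₀ (ht0 n), ← dist_eq_norm]
        have := Metric.mem_closedBall.1 hz
        have := mul_pos (ht0 n) hr
        linarith
      have h2 := hW.star x hx _ h1 (t n) ⟨ht0 n, (ht2 n).trans (by norm_num)⟩
      convert h2 using 1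
      rw [add_sub_right_comm, smul_add, smul_smul, mul_inv_cancel₀ (ht0 n).ne', one_smul]
      simp only [a]
      module
    have hζc : HasCompactSupport fun z => η (a n x - z) :=
      (isCompact_closedBall _ _).of_isClosed_subset (isClosed_tsupport _) hsupp
    have h3 := hg.2.2 _ hζs hζc (hsupp.trans hsub)
    have h4 : ∀ z, iteratedFDeriv ℝ j (fun z => η (a n x - z)) z
        (fun l => EuclideanSpace.single (i l) (1 : ℝ)) = (-1) ^ j * pds i η (a n x - z) := by
      intro z
      have h5 := congrFun (pds_comp_smul_add i hηs (-1) (a n x)) z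
      rw [← hrefl] at h5
      rw [show a n x - z = (-1 : ℝ) • z + a n x by rw [neg_one_smul]; abel]
      exact h5
    simp only [h4] at h3
    have hind : ∀ (p : E d → ℝ) (q : E d → ℝ), ∫ z, W.indicator p z * q z = ∫ z in W, p z * q z := by
      intro p q
      rw [← integral_indicator hWm]
      refine integral_congr_ae (Eventually.of_forall fun z => ?_)
      simp only [Set.indicator_mul_left]
    show (1 - t n) ^ j * mollify (pds i η) (W.indicator u) (a n x) = _
    congr 1
    rw [mollify, mollify, hind, hind]
    have h6 : ∫ z in W, u z * ((-1) ^ j * pds i η (a n x - z)) =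
        (-1) ^ j * ∫ z in W, u z * pds i η (a n x - z) := by
      rw [← integral_const_mul]
      exact integral_congr_ae (Eventually.of_forall fun z => by ring)
    rw [h6] at h3
    exact mul_left_cancel₀ (pow_ne_zero j (by norm_num)) h3
  have h1 := tendsto_mollify hWb (φ := ψ) (s := fun n => 1 - t n) (c := fun n => t n • b)
    (by simpa [ψ] using (ht.mul_const r).div_const 2) hs (fun n => by linarith [ht2 n])
    (by simpa using ht.smul_const b) (hext hg.2.1)
  have h2 : L2Tendsto volume W (fun n x => mollify ((ψ n).normed volume) (W.indicator g) (a n x)) g := by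
    refine h1.congr fun n => l2Sq_congr hWm fun x hx => ?_
    simp only [Set.indicator_of_mem hx]
    rfl
  have h3 := h2.const_mul (c := fun n => (1 - t n) ^ j) (fun n =>
    ((contDiff_mollify (ψ n).contDiff_normed (ψ n).hasCompactSupport_normed
      (hloc hg.2.1)).continuous.comp (by fun_prop)).aestronglyMeasurable) hg.2.1
    (by simpa using hs.pow j)
  exact h3.congr fun n => l2Sq_congr hWm fun x hx => by simp only [key n x hx]

end Density

/-! ### Polynomials: degrees and inverse estimates -/

section PolyMore

variable {d : ℕ}

theorem isPoly_eval_monomial (s : Fin d →₀ ℕ) (a : ℝ) :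
    IsPoly (s.sum fun _ => id) (fun x : E d => MvPolynomial.eval (fun j => x j) (MvPolynomial.monomial s a)) :=
  ⟨_, MvPolynomial.totalDegree_monomial_le s a, fun _ => rfl⟩

theorem contDiff_eval (p : MvPolynomial (Fin d) ℝ) :
    ContDiff ℝ ∞ fun x : E d => MvPolynomial.eval (fun j => x j) p :=
  IsPoly.contDiff ⟨p, le_rfl, fun _ => rfl⟩

theorem pd_eval (k : Fin d) (p : MvPolynomial (Fin d) ℝ) :
    pd k (fun x : E d => MvPolynomial.eval (fun j => x j) p) =
      fun x => MvPolynomial.eval (fun j => x j) (MvPolynomial.pderiv k p) := by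
  induction p using MvPolynomial.induction_on with
  | C a => simpa using pd_const k a
  | add p q hp hq =>
    simp only [map_add]
    rw [pd_add k (contDiff_eval p) (contDiff_eval q), hp, hq]
  | mul_X p l hp =>
    simp only [map_mul, MvPolynomial.eval_X]
    rw [pd_mul k (contDiff_eval p) (contDiff_coord l), hp, pd_coord]
    ext x
    rw [MvPolynomial.pderiv_mul, MvPolynomial.pderiv_X]
    simp only [map_add, map_mul, MvPolynomial.eval_X]
    congr 2
    rw [Pi.single_apply]
    split_ifs <;> simp_all

/-- A monomial is an eigenvector of `x_k ∂_k`. Summed over `k` this is Euler's identity, with the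
degree as eigenvalue. -/
theorem mul_pd_eval_monomial (k : Fin d) (s : Fin d →₀ ℕ) (a : ℝ) (x : E d) :
    x k * pd k (fun x : E d => MvPolynomial.eval (fun j => x j) (MvPolynomial.monomial s a)) x =
      s k * MvPolynomial.eval (fun j => x j) (MvPolynomial.monomial s a) := by
  have h := congrArg (MvPolynomial.eval fun j => x j) (MvPolynomial.X_mul_pderiv_monomial (i := k) (m := s) (r := a))
  simp only [map_mul, MvPolynomial.eval_X, nsmul_eq_mul] at h
  rw [pd_eval, h, map_natCast]

theorem isPoly_pd_eval_monomial (k : Fin d) (s : Fin d →₀ ℕ) (a : ℝ) :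
    IsPoly ((s.sum fun _ => id) - 1)
      (pd k (fun x : E d => MvPolynomial.eval (fun j => x j) (MvPolynomial.monomial s a))) := by
  rw [pd_eval, MvPolynomial.pderiv_monomial]
  by_cases hk : s k = 0
  · simpa [hk] using isPoly_const _ 0
  refine (isPoly_eval_monomial _ _).mono ?_
  have h1 : Finsupp.single k 1 ≤ s := by
    rw [Finsupp.single_le_iff]; omega
  have h2 : ((s - Finsupp.single k 1) + Finsupp.single k 1).sum (fun _ => id) = s.sum fun _ => id := by
    rw [tsub_add_cancel_of_le h1]
  rw [Finsupp.sum_add_index' (by simp) (by simp), Finsupp.sum_single_index (by simp)] at h2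
  simp only [id] at h2 ⊢
  omega

theorem IsPoly.exists_sum {m : ℕ} {f : E d → ℝ} (hf : IsPoly m f) :
    ∃ p : MvPolynomial (Fin d) ℝ, (∀ s ∈ p.support, (s.sum fun _ => id) ≤ m) ∧
      f = fun x => ∑ s ∈ p.support, MvPolynomial.eval (fun j => x j) (MvPolynomial.monomial s (p.coeff s)) := by
  obtain ⟨p, hp, e⟩ := hf
  refine ⟨p, fun s hs => (MvPolynomial.le_totalDegree hs).trans hp, ?_⟩
  ext x
  rw [e, ← map_sum, ← MvPolynomial.as_sum]

theorem IsPoly.pd {m : ℕ} {f : E d → ℝ} (hf : IsPoly m f) (k : Fin d) :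
    IsPoly (m - 1) (pd k f) := by
  obtain ⟨p, hp, rfl⟩ := hf.exists_sum
  rw [pd_sum _ _ fun s _ => contDiff_eval _]
  exact IsPoly.sum _ fun s hs =>
    (isPoly_pd_eval_monomial k s _).mono (Nat.sub_le_sub_right (hp s hs) 1)

/-- By Euler's identity, the extrapolation `f(x) + (1/m) ∇f(x) ⬝ (z - x)` has a smaller degree. -/
theorem IsPoly.add_euler {m : ℕ} (hm : 1 ≤ m) {f : E d → ℝ} (hf : IsPoly m f) (z : E d) :
    IsPoly (m - 1) (fun x => f x + (m : ℝ)⁻¹ * ∑ k, (z k - x k) * UnfittedFEM.pd k f x) := by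
  have h1 : IsPoly (m - 1) (fun x => (m : ℝ)⁻¹ * ∑ k, z k * UnfittedFEM.pd k f x) :=
    (IsPoly.sum _ fun k _ => (hf.pd k).const_mul _).const_mul _
  have h2 : IsPoly (m - 1) (fun x => f x - (m : ℝ)⁻¹ * ∑ k, x k * UnfittedFEM.pd k f x) := by
    obtain ⟨p, hp, rfl⟩ := hf.exists_sum
    have e : (fun x : E d => (∑ s ∈ p.support,
        MvPolynomial.eval (fun j => x j) (MvPolynomial.monomial s (p.coeff s))) -
        (m : ℝ)⁻¹ * ∑ k, x k * UnfittedFEM.pd k (fun x => ∑ s ∈ p.support,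
        MvPolynomial.eval (fun j => x j) (MvPolynomial.monomial s (p.coeff s))) x) = fun x =>
        ∑ s ∈ p.support, (1 - (m : ℝ)⁻¹ * ((s.sum fun _ => id : ℕ) : ℝ)) *
          MvPolynomial.eval (fun j => x j) (MvPolynomial.monomial s (p.coeff s)) := by
      ext x
      simp only [pd_sum _ _ fun s _ => contDiff_eval _, Finset.mul_sum (s := p.support)]
      rw [Finset.sum_comm, Finset.mul_sum, ← Finset.sum_sub_distrib]
      refine Finset.sum_congr rfl fun s _ => ?_
      simp only [mul_pd_eval_monomial]
      rw [← Finset.sum_mul, Finsupp.sum_fintype _ _ (by simp)]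
      push_cast
      simp only [id]
      ring
    rw [e]
    refine IsPoly.sum _ fun s hs => ?_
    -- Monomials of degree exactly `m` receive the factor `1 - m⁻¹ m = 0`; all others already have
    -- lower degree.
    rcases (hp s hs).eq_or_lt with h | h
    · rw [h, inv_mul_cancel₀ (by positivity)]
      simpa using isPoly_const _ 0
    · exact ((isPoly_eval_monomial s _).mono (by omega)).const_mul _
  convert h2.add h1 using 1
  ext x
  simp only [sub_mul, Finset.sum_sub_distrib]
  ring

theorem IsPoly.comp_smul {m : ℕ} {f : E d → ℝ} (hf : IsPoly m f) (r : ℝ) :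
    IsPoly m (fun x => f (r • x)) := by
  obtain ⟨p, hp, rfl⟩ := hf.exists_sum
  refine IsPoly.sum _ fun s hs => ?_
  have e : (fun x : E d => MvPolynomial.eval (fun j => (r • x) j) (MvPolynomial.monomial s (p.coeff s))) =
      fun x => r ^ (s.sum fun _ => id) *
        MvPolynomial.eval (fun j => x j) (MvPolynomial.monomial s (p.coeff s)) := by
    ext x
    simp only [MvPolynomial.eval_monomial, PiLp.smul_apply, smul_eq_mul, mul_pow, Finsupp.prod_mul]
    rw [Finsupp.prod_fintype _ _ (by simp), Finset.prod_pow_eq_pow_sum,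
      Finsupp.sum_fintype _ _ (by simp)]
    simp only [id]
    ring
  rw [e]
  exact ((isPoly_eval_monomial s _).mono (hp s hs)).const_mul _

/-- The ball contains the cube `(0, ε)^d` with `ε = ρ / (d + 1)`, and a polynomial that vanishes on
a product of infinite sets is zero. -/
theorem isPoly_eq_zero_of_eqOn_ball {p : MvPolynomial (Fin d) ℝ} {ρ : ℝ} (hρ : 0 < ρ)
    (h : ∀ x ∈ Metric.ball (0 : E d) ρ, MvPolynomial.eval (fun j => x j) p = 0) : p = 0 := by
  set ε := ρ / (d + 1) with hε
  have hε0 : 0 < ε := by positivity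
  refine MvPolynomial.funext_set (fun _ => Ioo 0 ε) (fun _ => Ioo_infinite hε0) fun x hx => ?_
  rw [map_zero]
  refine h (WithLp.toLp 2 x) ?_
  rw [mem_ball_zero_iff]
  have h1 : ‖WithLp.toLp 2 x‖ ≤ ∑ k, ‖x k‖ := by
    conv_lhs => rw [← (EuclideanSpace.basisFun (Fin d) ℝ).sum_repr (WithLp.toLp 2 x)]
    refine (norm_sum_le _ _).trans (Finset.sum_le_sum fun k _ => ?_)
    rw [norm_smul]
    simp
  refine h1.trans_lt ?_
  calc ∑ k, ‖x k‖ ≤ ∑ _k : Fin d, ε := Finset.sum_le_sum fun k _ => by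
        have := hx k (mem_univ k)
        rw [Real.norm_of_nonneg this.1.le]
        exact this.2.le
    _ = d * ε := by simp
    _ < (d + 1) * ε := by linarith
    _ = ρ := by rw [hε]; field_simp

/-- A finite family that parametrizes the polynomials of degree at most `m`. -/
theorem exists_isPoly_basis (d m : ℕ) : ∃ (n : ℕ) (b : Fin n → E d → ℝ), (∀ i, IsPoly m (b i)) ∧
    (∀ q, IsPoly m q → ∃ c : Fin n → ℝ, q = fun x => ∑ i, c i * b i x) ∧
    ∀ (ρ : ℝ) (c : Fin n → ℝ), 0 < ρ →
      (∀ x ∈ Metric.ball (0 : E d) ρ, ∑ i, c i * b i x = 0) → c = 0 := by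
  let V := MvPolynomial.restrictTotalDegree (Fin d) ℝ m
  let B := Module.finBasis ℝ V
  have heval : ∀ (c : Fin (Module.finrank ℝ V) → ℝ) (x : E d),
      MvPolynomial.eval (fun j => x j) ((∑ i, c i • B i : V) : MvPolynomial (Fin d) ℝ) =
      ∑ i, c i * MvPolynomial.eval (fun j => x j) (B i : MvPolynomial (Fin d) ℝ) := by
    intro c x
    rw [AddSubmonoidClass.coe_finsetSum, map_sum]
    simp [MvPolynomial.smul_eval]
  refine ⟨_, fun i x => MvPolynomial.eval (fun j => x j) (B i : MvPolynomial (Fin d) ℝ), fun i =>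
    ⟨_, (MvPolynomial.mem_restrictTotalDegree _ _ _).1 (B i).2, fun _ => rfl⟩, ?_, ?_⟩
  · rintro q ⟨p, hp, e⟩
    let P : V := ⟨p, (MvPolynomial.mem_restrictTotalDegree _ _ _).2 hp⟩
    refine ⟨B.repr P, ?_⟩
    ext x
    rw [← heval, B.sum_repr P, e]
  · intro ρ c hρ h
    have h1 : ((∑ i, c i • B i : V) : MvPolynomial (Fin d) ℝ) = 0 :=
      isPoly_eq_zero_of_eqOn_ball hρ fun x hx => by rw [heval]; exact h x hx
    have h2 : (∑ i, c i • B i : V) = 0 := Subtype.ext h1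
    have h3 := B.linearIndependent
    rw [Fintype.linearIndependent_iff] at h3
    ext i
    exact h3 c h2 i

end PolyMore

/-! ### Inverse estimates for polynomials -/

section Inverse

variable {d : ℕ}

theorem l2Sq_ball_comp_smul_add {g : E d → ℝ} (hg : Measurable g) (x₁ : E d) {r : ℝ} (hr : 0 < r)
    (L : ℝ) : l2Sq volume (Metric.ball 0 L) (fun y => g (r • y + x₁)) =
      ENNReal.ofReal (r ^ d)⁻¹ * l2Sq volume (Metric.ball x₁ (L * r)) g := by
  rw [l2Sq, l2Sq, ← lintegral_indicator Metric.isOpen_ball.measurableSet,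
    ← lintegral_indicator Metric.isOpen_ball.measurableSet]
  have hF : Measurable ((Metric.ball x₁ (L * r)).indicator fun x => ‖g x‖ₑ ^ 2) :=
    (hg.enorm.pow_const 2).indicator Metric.isOpen_ball.measurableSet
  have h1 := lintegral_comp_add_smul_sub (0 : E d) hr
    (F := fun y => (Metric.ball x₁ (L * r)).indicator (fun x => ‖g x‖ₑ ^ 2) (y + x₁))
    (hF.comp (by fun_prop))
  rw [lintegral_add_right_eq_self
    (fun y => (Metric.ball x₁ (L * r)).indicator (fun x => ‖g x‖ₑ ^ 2) y) x₁] at h1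
  rw [← h1]
  refine lintegral_congr fun y => ?_
  simp only [zero_add, sub_zero]
  have hiff : y ∈ Metric.ball (0 : E d) L ↔ r • y + x₁ ∈ Metric.ball x₁ (L * r) := by
    rw [mem_ball_iff_norm, mem_ball_iff_norm, add_sub_cancel_right, sub_zero, norm_smul,
      Real.norm_of_nonneg hr.le, mul_comm L, mul_lt_mul_iff_right₀ hr]
  by_cases hy : y ∈ Metric.ball (0 : E d) L
  · rw [indicator_of_mem hy, indicator_of_mem (hiff.1 hy)]
  · rw [indicator_of_notMem hy, indicator_of_notMem (mt hiff.2 hy)]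

/-- Equivalence of norms in finite dimensions: the squared `L²` norm is continuous, positive and
homogeneous in the coefficients, hence has a positive minimum on their unit sphere. -/
theorem exists_lower_bound {n : ℕ} {b : Fin n → E d → ℝ} (hb : ∀ i, Continuous (b i))
    (hinj : ∀ c : Fin n → ℝ, (∀ x ∈ Metric.ball (0 : E d) (1 / 2), ∑ i, c i * b i x = 0) → c = 0) :
    ∃ a : ℝ, 0 < a ∧ ∀ c : Fin n → ℝ, ENNReal.ofReal (a * ‖c‖ ^ 2) ≤
      l2Sq volume (Metric.ball 0 1) (fun x => ∑ i, c i * b i x) := by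
  set S : Set (E d) := Metric.closedBall 0 (1 / 2) with hS
  have hSc : IsCompact S := isCompact_closedBall _ _
  -- Integration over a compact ball inside the unit ball gives continuity in `c` at once; its
  -- interior is the ball on which the coefficients are determined.
  let N : (Fin n → ℝ) → ℝ := fun c => ∫ x in S, (∑ i, c i * b i x) ^ 2
  have hq : ∀ c : Fin n → ℝ, Continuous fun x => ∑ i, c i * b i x := fun c =>
    continuous_finsetSum _ fun i _ => continuous_const.mul (hb i)
  have hNc : Continuous N := by
    refine continuous_parametric_integral_of_continuous (f := fun (c : Fin n → ℝ) (x : E d) => (∑ i, c i * b i x) ^ 2) ?_ hSc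
    refine Continuous.pow (continuous_finsetSum _ fun i _ => ?_) 2
    exact ((continuous_apply i).comp continuous_fst).mul ((hb i).comp continuous_snd)
  have hNint : ∀ c : Fin n → ℝ, IntegrableOn (fun x => (∑ i, c i * b i x) ^ 2) S := fun c =>
    ((hq c).pow 2).continuousOn.integrableOn_compact hSc
  have hNpos : ∀ c, c ≠ 0 → 0 < N c := by
    intro c hc
    refine lt_of_le_of_ne (integral_nonneg fun x => sq_nonneg _) fun h0 => hc (hinj c fun x hx => ?_)
    have h1 := (integral_eq_zero_iff_of_nonneg (μ := volume.restrict S)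
      (fun x => sq_nonneg (∑ i, c i * b i x)) (hNint c)).1 h0.symm
    have h2 := ae_restrict_of_ae_restrict_of_subset Metric.ball_subset_closedBall h1
    have h3 := Measure.eqOn_open_of_ae_eq h2 Metric.isOpen_ball ((hq c).pow 2).continuousOn
      continuousOn_const hx
    exact pow_eq_zero_iff two_ne_zero |>.1 h3
  have hNle : ∀ c, ENNReal.ofReal (N c) ≤ l2Sq volume (Metric.ball 0 1) (fun x => ∑ i, c i * b i x) := by
    intro c
    rw [ofReal_integral_eq_lintegral_ofReal (hNint c) (Eventually.of_forall fun x => sq_nonneg _)]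
    refine le_trans (le_of_eq (lintegral_congr fun x => ?_))
      (l2Sq_mono_set (Metric.closedBall_subset_ball (by norm_num)) _)
    rw [← ofReal_norm, ← ENNReal.ofReal_pow (norm_nonneg _), Real.norm_eq_abs, sq_abs]
  have hNsmul : ∀ (t : ℝ) c, N (t • c) = t ^ 2 * N c := by
    intro t c
    simp only [N]
    rw [← integral_const_mul]
    refine integral_congr_ae (Eventually.of_forall fun x => ?_)
    simp only [Pi.smul_apply, smul_eq_mul, mul_assoc, ← Finset.mul_sum, mul_pow]
  -- The sphere is empty only if there are no coefficients.
  rcases (Metric.sphere (0 : Fin n → ℝ) 1).eq_empty_or_nonempty with he | hne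
  · refine ⟨1, one_pos, fun c => ?_⟩
    have : c = 0 := by
      by_contra hc
      have : (‖c‖⁻¹ • c) ∈ Metric.sphere (0 : Fin n → ℝ) 1 := by
        rw [mem_sphere_zero_iff_norm, norm_smul, norm_inv, norm_norm,
          inv_mul_cancel₀ (norm_ne_zero_iff.2 hc)]
      rw [he] at this
      exact this
    simp [this]
  · obtain ⟨c₀, hc₀, hmin⟩ := (isCompact_sphere (0 : Fin n → ℝ) 1).exists_isMinOn hne hNc.continuousOn
    refine ⟨N c₀, hNpos c₀ (ne_zero_of_mem_unit_sphere ⟨c₀, hc₀⟩), fun c => ?_⟩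
    refine le_trans (ENNReal.ofReal_le_ofReal ?_) (hNle c)
    by_cases hc : c = 0
    · simp only [hc, norm_zero]
      simpa using integral_nonneg (μ := volume.restrict S) fun x => sq_nonneg (∑ i, (0 : Fin n → ℝ) i * b i x)
    have hc' := norm_pos_iff.2 hc
    have h1 : (‖c‖⁻¹ • c) ∈ Metric.sphere (0 : Fin n → ℝ) 1 := by
      rw [mem_sphere_zero_iff_norm, norm_smul, norm_inv, norm_norm, inv_mul_cancel₀ hc'.ne']
    have h2 : N c₀ ≤ N (‖c‖⁻¹ • c) := hmin h1
    rw [hNsmul] at h2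
    calc N c₀ * ‖c‖ ^ 2 ≤ (‖c‖⁻¹ ^ 2 * N c) * ‖c‖ ^ 2 := by gcongr
      _ = N c := by field_simp

theorem pds_sum {j : ℕ} {ι : Type*} (i : Fin j → Fin d) (s : Finset ι) {f : ι → E d → ℝ}
    (hf : ∀ a ∈ s, ContDiff ℝ ∞ (f a)) :
    pds i (fun x => ∑ a ∈ s, f a x) = fun x => ∑ a ∈ s, pds i (f a) x := by
  induction j generalizing f with
  | zero => simp [pds_zero]
  | succ j ih =>
    rw [pds_succ i (ContDiff.sum hf), pd_sum _ _ hf, ih _ fun a ha => contDiff_pd (hf a ha) _]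
    ext x
    exact Finset.sum_congr rfl fun a ha => by rw [pds_succ i (hf a ha)]

/-- Inverse estimates for polynomials on concentric balls. -/
theorem exists_inverse_estimate (d m J : ℕ) (L : ℝ) : ∃ C : ℝ, 0 ≤ C ∧ ∀ q : E d → ℝ, IsPoly m q →
    ∀ (x₁ : E d) (r : ℝ), 0 < r → ∀ j ≤ J, ∀ i : Fin j → Fin d,
      ENNReal.ofReal (r ^ (2 * j)) * l2Sq volume (Metric.ball x₁ (L * r)) (pds i q) ≤
        ENNReal.ofReal C * l2Sq volume (Metric.ball x₁ r) q := by
  obtain ⟨n, b, hb, hspan, hinj⟩ := exists_isPoly_basis d m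
  obtain ⟨a, ha, hlow⟩ := exists_lower_bound (fun i => (hb i).contDiff.continuous)
    fun c => hinj (1 / 2) c (by norm_num)
  have hfin : ∀ (j : ℕ) (i : Fin j → Fin d) k,
      l2Sq volume (Metric.ball 0 L) (pds i (b k)) < ⊤ := fun j i k => by
    have := isFiniteMeasure_restrict_of_isBounded (Metric.isBounded_ball (x := (0 : E d)) (r := L))
    exact l2Sq_lt_top (memLp_of_continuous Metric.isBounded_ball Metric.isOpen_ball.measurableSet
      (contDiff_pds i (hb k).contDiff).continuous)
  -- A crude constant for the reference ball: it adds the norms of all derivatives of all basis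
  -- functions on `B(0, L)`.
  let A : ℝ≥0∞ := ∑ j ∈ Finset.range (J + 1), ∑ i : Fin j → Fin d, n *
    ∑ k, l2Sq volume (Metric.ball 0 L) (pds i (b k))
  have hA : A ≠ ⊤ := by
    refine ENNReal.sum_ne_top.2 fun j _ => ENNReal.sum_ne_top.2 fun i _ => ?_
    exact ENNReal.mul_ne_top (by simp) (ENNReal.sum_ne_top.2 fun k _ => (hfin j i k).ne)
  have href : ∀ q : E d → ℝ, IsPoly m q → ∀ j ≤ J, ∀ i : Fin j → Fin d,
      l2Sq volume (Metric.ball 0 L) (pds i q) ≤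
        ENNReal.ofReal (A.toReal / a) * l2Sq volume (Metric.ball 0 1) q := by
    intro q hq j hj i
    obtain ⟨c, rfl⟩ := hspan q hq
    rw [pds_sum _ _ fun k _ => contDiff_const.mul (hb k).contDiff]
    simp only [pds_const_mul i _ (hb _).contDiff]
    have h1 : l2Sq volume (Metric.ball 0 L) (fun x => ∑ k, c k * pds i (b k) x) ≤
        ENNReal.ofReal (‖c‖ ^ 2) * A := by
      calc _ ≤ ∫⁻ x in Metric.ball (0 : E d) L,
            ENNReal.ofReal (‖c‖ ^ 2) * (n * ∑ k, ‖pds i (b k) x‖ₑ ^ 2) := by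
            refine lintegral_mono fun x => ?_
            have h2 : ‖∑ k, c k * pds i (b k) x‖ₑ ≤
                ENNReal.ofReal ‖c‖ * ∑ k, ‖pds i (b k) x‖ₑ := by
              refine (enorm_sum_le _ _).trans ?_
              rw [Finset.mul_sum]
              refine Finset.sum_le_sum fun k _ => ?_
              rw [enorm_mul, ← ofReal_norm (c k)]
              exact mul_le_mul' (ENNReal.ofReal_le_ofReal (norm_le_pi_norm c k)) le_rfl
            calc _ ≤ (ENNReal.ofReal ‖c‖ * ∑ k, ‖pds i (b k) x‖ₑ) ^ 2 := pow_le_pow_left' h2 2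
              _ ≤ _ := by
                rw [mul_pow, ENNReal.ofReal_pow (norm_nonneg _)]
                refine mul_le_mul' le_rfl ((sq_sum_enorm_le _).trans ?_)
                simp
        _ = ENNReal.ofReal (‖c‖ ^ 2) * (n * ∑ k, l2Sq volume (Metric.ball 0 L) (pds i (b k))) := by
            have hmeas : ∀ k, Measurable fun x => ‖pds i (b k) x‖ₑ ^ 2 := fun k =>
              (contDiff_pds i (hb k).contDiff).continuous.measurable.enorm.pow_const 2
            rw [lintegral_const_mul' _ _ ENNReal.ofReal_ne_top, lintegral_const_mul' _ _ (by simp),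
              lintegral_finsetSum _ fun k _ => hmeas k]
            rfl
        _ ≤ _ := by
            refine mul_le_mul' le_rfl ?_
            refine le_trans ?_ (Finset.single_le_sum (f := fun j => ∑ i : Fin j → Fin d, (n : ℝ≥0∞) *
              ∑ k, l2Sq volume (Metric.ball 0 L) (pds i (b k))) (fun _ _ => bot_le)
              (Finset.mem_range.2 (Nat.lt_succ_iff.2 hj)))
            exact Finset.single_le_sum (f := fun i : Fin j → Fin d => (n : ℝ≥0∞) *
              ∑ k, l2Sq volume (Metric.ball 0 L) (pds i (b k))) (fun _ _ => bot_le) (Finset.mem_univ i)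
    refine h1.trans ?_
    calc ENNReal.ofReal (‖c‖ ^ 2) * A = ENNReal.ofReal (A.toReal / a) * ENNReal.ofReal (a * ‖c‖ ^ 2) := by
          rw [← ENNReal.ofReal_mul (by positivity), div_mul_eq_mul_div, ← mul_assoc,
            mul_comm A.toReal a, mul_assoc, mul_div_cancel_left₀ _ ha.ne',
            ENNReal.ofReal_mul ENNReal.toReal_nonneg, ENNReal.ofReal_toReal hA, mul_comm]
      _ ≤ _ := mul_le_mul' le_rfl (hlow c)
  refine ⟨A.toReal / a, by positivity, fun q hq x₁ r hr j hj i => ?_⟩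
  have hq' : IsPoly m fun y => q (r • y + x₁) := by
    simpa using! (hq.comp_sub_const (-x₁)).comp_smul r
  have h1 := href _ hq' j hj i
  have hrd : 0 < r ^ d := by positivity
  have hmul : ∀ f : E d → ℝ, l2Sq volume (Metric.ball 0 L) (fun x => r ^ j * f x) =
      ENNReal.ofReal (r ^ (2 * j)) * l2Sq volume (Metric.ball 0 L) f := fun f => by
    simp only [l2Sq, enorm_mul, mul_pow]
    rw [lintegral_const_mul' _ _ (by simp), Real.enorm_of_nonneg (by positivity),
      ← ENNReal.ofReal_pow (by positivity)]
    ring_nf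
  rw [pds_comp_smul_add i hq.contDiff, hmul,
    l2Sq_ball_comp_smul_add (contDiff_pds i hq.contDiff).continuous.measurable x₁ hr,
    l2Sq_ball_comp_smul_add hq.contDiff.continuous.measurable x₁ hr, one_mul] at h1
  rw [← ENNReal.mul_le_mul_iff_right (a := ENNReal.ofReal (r ^ d)⁻¹)
    (by simpa using hrd) ENNReal.ofReal_ne_top]
  calc _ = _ := by ring
    _ ≤ _ := h1
    _ = _ := by ring

end Inverse

/-! ### Weak derivatives and local estimates -/

section Local

variable {d : ℕ}

theorem HasWeakDeriv.mono {k : ℕ} {D W : Set (E d)} {i : Fin k → Fin d} {u g : E d → ℝ}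
    (h : HasWeakDeriv D i u g) (hW : W ⊆ D) : HasWeakDeriv W i u g := by
  refine ⟨h.1.mono_measure (Measure.restrict_mono hW le_rfl),
    h.2.1.mono_measure (Measure.restrict_mono hW le_rfl), fun φ hφ hc hs => ?_⟩
  have key := h.2.2 φ hφ hc (hs.trans hW)
  have h0 : ∀ x ∉ W, φ x = 0 := fun x hx => image_eq_zero_of_notMem_tsupport fun h => hx (hs h)
  have h1 : ∀ x ∉ W, iteratedFDeriv ℝ k φ x = 0 := fun x hx =>
    image_eq_zero_of_notMem_tsupport fun h => hx (hs (tsupport_iteratedFDeriv_subset k h))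
  have e : ∀ F : E d → ℝ, (∀ x ∉ W, F x = 0) → ∫ x in W, F x = ∫ x in D, F x := by
    intro F hF
    rw [setIntegral_eq_integral_of_forall_compl_eq_zero hF,
      setIntegral_eq_integral_of_forall_compl_eq_zero fun x hx => hF x fun h => hx (hW h)]
  rw [e _ fun x hx => by rw [h1 x hx]; simp, e _ fun x hx => by rw [h0 x hx, mul_zero], key]

theorem HasWeakDeriv.congr {k : ℕ} {D : Set (E d)} (hD : MeasurableSet D) {i : Fin k → Fin d}
    {u u' g : E d → ℝ} (h : HasWeakDeriv D i u g) (hu : EqOn u' u D) : HasWeakDeriv D i u' g := by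
  refine ⟨h.1.ae_eq ?_, h.2.1, fun φ hφ hc hs => ?_⟩
  · filter_upwards [ae_restrict_mem hD] with x hx using (hu hx).symm
  · rw [← h.2.2 φ hφ hc hs]
    exact setIntegral_congr_fun hD fun x hx => by simp only [hu hx]

theorem hasWeakDeriv_zero {D : Set (E d)} {u : E d → ℝ} (hu : MemLp u 2 (volume.restrict D))
    (i : Fin 0 → Fin d) : HasWeakDeriv D i u u :=
  ⟨hu, hu, fun φ _ _ _ => by simp⟩

/-- Fundamental lemma of the calculus of variations. It makes the infima in `sobolevNorm` equal to
the norms of any chosen weak derivatives. -/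
theorem HasWeakDeriv.ae_eq {k : ℕ} {D : Set (E d)} (hD : IsOpen D) {i : Fin k → Fin d}
    {u g g' : E d → ℝ} (h : HasWeakDeriv D i u g) (h' : HasWeakDeriv D i u g') :
    g =ᵐ[volume.restrict D] g' := by
  have hli : LocallyIntegrableOn (fun x => g x - g' x) D volume := by
    have : LocallyIntegrable (fun x => g x - g' x) (volume.restrict D) :=
      (h.2.1.sub h'.2.1).locallyIntegrable (by norm_num)
    exact locallyIntegrableOn_of_locallyIntegrable_restrict this
  have h0 := hD.ae_eq_zero_of_integral_contDiff_smul_eq_zero (μ := volume) hli fun φ hφ hc hs => by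
    have e1 := h.2.2 φ hφ hc hs
    have e2 := h'.2.2 φ hφ hc hs
    rw [e1] at e2
    have e3 := mul_left_cancel₀ (pow_ne_zero k (by norm_num : (-1 : ℝ) ≠ 0)) e2
    have hz : ∀ x ∉ D, φ x • (g x - g' x) = 0 := fun x hx => by
      rw [image_eq_zero_of_notMem_tsupport fun h => hx (hs h), zero_smul]
    rw [← setIntegral_eq_integral_of_forall_compl_eq_zero hz]
    have hφm : MemLp φ 2 (volume.restrict D) :=
      (hφ.continuous.memLp_of_hasCompactSupport hc).restrict D
    have i1 : Integrable (fun x => g x * φ x) (volume.restrict D) := h.2.1.integrable_mul hφm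
    have i2 : Integrable (fun x => g' x * φ x) (volume.restrict D) := h'.2.1.integrable_mul hφm
    calc _ = ∫ x in D, (g x * φ x - g' x * φ x) :=
          integral_congr_ae (Eventually.of_forall fun x => by simp only [smul_eq_mul]; ring)
      _ = 0 := by rw [integral_sub i1 i2, e3, sub_self]
  filter_upwards [(ae_restrict_iff' hD.measurableSet).2 h0] with x hx using sub_eq_zero.1 hx

/-- `G j i` are the weak derivatives of `u` on `D`, up to the order `N`. -/
def IsDerivFamily (N : ℕ) (D : Set (E d)) (u : E d → ℝ)
    (G : ∀ j : ℕ, (Fin j → Fin d) → E d → ℝ) : Prop :=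
  (∀ i, G 0 i = u) ∧ ∀ j ≤ N, ∀ i, HasWeakDeriv D i u (G j i)

theorem IsDerivFamily.mono {N : ℕ} {D W : Set (E d)} {u : E d → ℝ}
    {G : ∀ j : ℕ, (Fin j → Fin d) → E d → ℝ} (h : IsDerivFamily N D u G) (hW : W ⊆ D) :
    IsDerivFamily N W u G :=
  ⟨h.1, fun j hj i => (h.2 j hj i).mono hW⟩

theorem MemSobolev.exists_family {N : ℕ} {D : Set (E d)} {u : E d → ℝ} (hD : IsOpen D)
    (h : MemSobolev N D u) : ∃ G, IsDerivFamily N D u G ∧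
      sobolevNorm N D u ^ 2 = ∑ j ∈ Finset.range (N + 1), ∑ i : Fin j → Fin d, l2Sq volume D (G j i) := by
  classical
  have hu : MemLp u 2 (volume.restrict D) := (h 0 (Nat.zero_le _) Fin.elim0).choose_spec.1
  -- The entry of order zero is `u` itself and not merely a function equal to it almost everywhere;
  -- later it is rewritten as `u`.
  let G : ∀ j : ℕ, (Fin j → Fin d) → E d → ℝ := fun j i =>
    if j = 0 then u else if hj : j ≤ N then (h j hj i).choose else 0
  have hG : IsDerivFamily N D u G := by
    refine ⟨fun i => by simp [G], fun j hj i => ?_⟩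
    by_cases hj0 : j = 0
    · subst hj0
      simpa [G] using hasWeakDeriv_zero hu i
    · simp only [G, hj0, hj, if_false, dif_pos]
      exact (h j hj i).choose_spec
  refine ⟨G, hG, ?_⟩
  rw [sobolevNorm, ← ENNReal.rpow_natCast, ← ENNReal.rpow_mul]
  norm_num
  refine Finset.sum_congr rfl fun j hj => Finset.sum_congr rfl fun i _ => ?_
  have hj' := hG.2 j (Nat.lt_succ_iff.1 (Finset.mem_range.1 hj)) i
  refine le_antisymm (iInf₂_le _ hj') (le_iInf₂ fun g hg => le_of_eq ?_)
  exact lintegral_congr_ae ((hj'.ae_eq hD hg).mono fun x hx => by simp only [hx])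

/-- Approximation of a function in `H^{m+1}` on a star-shaped set by a polynomial of degree `m`. -/
theorem exists_isPoly_approx_weak (hd : 1 ≤ d) {m : ℕ} (hm : 1 ≤ m) (κ : ℝ) : ∃ C : ℝ, 0 ≤ C ∧
    ∀ {W : Set (E d)} {b : E d} {r R : ℝ}, StarPatch W b r R → r ≤ R → R ≤ κ * r →
    ∀ {u : E d → ℝ} {G : ∀ j : ℕ, (Fin j → Fin d) → E d → ℝ}, IsDerivFamily (m + 1) W u G →
    ∀ {δ : ℝ≥0∞}, 0 < δ → ∃ P, IsPoly m P ∧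
      ∀ j ≤ 2, ∀ i : Fin j → Fin d, l2Sq volume W (fun x => G j i x - pds i P x) ≤
        ENNReal.ofReal (C * R ^ (2 * (m + 1 - j))) *
          (∑ i' : Fin (m + 1) → Fin d, l2Sq volume W (G (m + 1) i') + δ) := by
  obtain ⟨C, hC0, hC⟩ := exists_isPoly_approx hd hm κ
  refine ⟨2 + 2 * C, by positivity, fun {W b r R} hW hrR hRr {u G} hG {δ} hδ => ?_⟩
  have hR : 0 < R := hW.pos.trans_le hrR
  have hWb : Bornology.IsBounded W := Metric.isBounded_ball.subset hW.subset
  have hWm := hW.isOpen.measurableSet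
  have hu : MemLp u 2 (volume.restrict W) := (hG.2 0 (Nat.zero_le _) Fin.elim0).1
  obtain ⟨φ, hφ, hφt⟩ := exists_smooth_tendsto hW hu
  have hmem : ∀ {g : E d → ℝ}, ContDiff ℝ ∞ g → MemLp g 2 (volume.restrict W) := fun hg => by
    have := isFiniteMeasure_restrict_of_isBounded hWb
    exact memLp_of_continuous hWb hWm hg.continuous
  set S := ∑ i' : Fin (m + 1) → Fin d, l2Sq volume W (G (m + 1) i') with hS
  have hSt : S ≠ ⊤ := ENNReal.sum_ne_top.2 fun i _ => (l2Sq_lt_top (hG.2 _ le_rfl i).2.1).ne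
  -- The derivative norms of the approximants converge to `S` but may exceed it. The slack `δ` is
  -- needed even if `S = 0`, and it also absorbs the error of replacing `u` by `φ n`.
  have ev1 : ∀ᶠ n in atTop, ∑ i' : Fin (m + 1) → Fin d, l2Sq volume W (pds i' (φ n)) ≤ S + δ := by
    have h1 : Tendsto (fun n => ∑ i' : Fin (m + 1) → Fin d, l2Sq volume W (pds i' (φ n))) atTop (𝓝 S) :=
      tendsto_finsetSum _ fun i' _ => l2Sq_le_of_L2Tendsto
        (fun n => (hmem (contDiff_pds i' (hφ n))).1) (hG.2 _ le_rfl i').2.1.1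
        (hφt _ i' _ (hG.2 _ le_rfl i'))
    exact h1.eventually_le_const (ENNReal.lt_add_right hSt hδ.ne')
  have ev2 : ∀ᶠ n in atTop, ∀ j ∈ Finset.range 3, ∀ i ∈ (Finset.univ : Finset (Fin j → Fin d)),
      l2Sq volume W (fun x => pds i (φ n) x - G j i x) ≤
        ENNReal.ofReal (R ^ (2 * (m + 1 - j))) * δ := by
    refine (Filter.eventually_all_finset _).2 fun j hj =>
      (Filter.eventually_all_finset _).2 fun i _ => ?_
    have hj2 : j ≤ m + 1 := by have := Finset.mem_range.1 hj; omega
    refine (hφt j i _ (hG.2 j hj2 i)).eventually_le_const (ENNReal.mul_pos ?_ hδ.ne')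
    simpa using by positivity
  obtain ⟨n, hn1, hn2⟩ := (ev1.and ev2).exists
  obtain ⟨P, hP, hPb⟩ := hC hW hrR hRr (hφ n)
  refine ⟨P, hP, fun j hj i => ?_⟩
  have hj2 : j ≤ m + 1 := by omega
  have e : (fun x => G j i x - pds i P x) = fun x => (G j i x - pds i (φ n) x) +
      pds i (fun x => φ n x - P x) x := by
    ext x
    rw [pds_sub i (hφ n) hP.contDiff]
    ring
  rw [e]
  refine (l2Sq_add_le ((hG.2 j hj2 i).2.1.sub (hmem (contDiff_pds i (hφ n)))).1).trans ?_
  calc _ ≤ 2 * (ENNReal.ofReal (R ^ (2 * (m + 1 - j))) * (S + δ)) +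
        2 * (ENNReal.ofReal (C * R ^ (2 * (m + 1 - j))) * (S + δ)) := by
        refine add_le_add (mul_le_mul' le_rfl ?_) (mul_le_mul' le_rfl ?_)
        · exact (l2Sq_sub_comm (G j i) (pds i (φ n))).le.trans
            ((hn2 j (by simp; omega) i (Finset.mem_univ _)).trans (mul_le_mul' le_rfl le_add_self))
        · exact (hPb j hj i).trans (mul_le_mul' le_rfl hn1)
    _ = _ := by
        have : (2 + 2 * C) * R ^ (2 * (m + 1 - j)) =
          2 * R ^ (2 * (m + 1 - j)) + 2 * (C * R ^ (2 * (m + 1 - j))) := by ring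
        rw [this, ENNReal.ofReal_add (by positivity) (by positivity),
          ENNReal.ofReal_mul (p := 2) (by norm_num), ENNReal.ofReal_mul (p := 2) (by norm_num)]
        simp only [ENNReal.ofReal_ofNat]
        ring

/-- The weak derivatives up to order two are limits of derivatives of smooth functions. -/
theorem IsDerivFamily.exists_smoothApprox {N : ℕ} (hN : 2 ≤ N) {W : Set (E d)} {b : E d} {r R : ℝ}
    (hW : StarPatch W b r R) {u : E d → ℝ} {G : ∀ j : ℕ, (Fin j → Fin d) → E d → ℝ}
    (hG : IsDerivFamily N W u G) : ∃ φ : ℕ → E d → ℝ,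
      SmoothApprox W u (fun k => G 1 fun _ => k) φ ∧
      ∀ k, SmoothApprox W (G 1 fun _ => k) (fun l => G 2 ![l, k]) (fun n => pd k (φ n)) := by
  have hu : MemLp u 2 (volume.restrict W) := (hG.2 0 (Nat.zero_le _) Fin.elim0).1
  obtain ⟨φ, hφ, hφt⟩ := exists_smooth_tendsto hW hu
  have h0 := hφt 0 Fin.elim0 u (hasWeakDeriv_zero hu _)
  have h1 : ∀ k, L2Tendsto volume W (fun n => pd k (φ n)) (G 1 fun _ => k) := fun k => by
    simpa only [pds_one] using hφt 1 (fun _ => k) _ (hG.2 1 (by omega) _)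
  refine ⟨φ, ⟨hφ, hu, fun k => (hG.2 1 (by omega) _).2.1, by simpa only [pds_zero] using h0, h1⟩,
    fun k => ⟨fun n => contDiff_pd (hφ n) k, (hG.2 1 (by omega) _).2.1,
      fun l => (hG.2 2 hN _).2.1, h1 k, fun l => ?_⟩⟩
  simpa only [pds_two _ _ (hφ _)] using hφt 2 ![l, k] _ (hG.2 2 hN _)

theorem SmoothApprox.isTrace {D S : Set (E d)} (hb : Bornology.IsBounded D) (hm : MeasurableSet D)
    {w w' T : E d → ℝ} {G : Fin d → E d → ℝ} {f : ℕ → E d → ℝ} (h : SmoothApprox D w' G f)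
    (hw : EqOn w w' D) (hT : MemLp T 2 ((surf d).restrict S)) (ht : L2Tendsto (surf d) S f T) :
    IsTrace D S w T := by
  refine ⟨hT, fun x => WithLp.toLp 2 fun k => G k x, fun k => (h.hasWeakGrad hb hm k).congr hm hw,
    f, h.contDiff, ?_, ?_, ht⟩
  · refine h.tendsto.congr fun n => l2Sq_congr hm fun x hx => by simp only [hw hx]
  · have hmeas : ∀ n k, AEStronglyMeasurable (fun x => (∇ (f n) x - WithLp.toLp 2 fun k => G k x) k)
        (volume.restrict D) := fun n k => by
      simp only [PiLp.sub_apply, gradient_apply]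
      exact (contDiff_pd (h.contDiff n) k).continuous.aestronglyMeasurable.sub (h.memLp_grad k).1
    simp only [fun n => l2Sq_vector volume D (hmeas n)]
    simp only [PiLp.sub_apply, gradient_apply]
    simpa using tendsto_finsetSum Finset.univ fun k _ => h.tendsto_grad k

theorem ENNReal.le_ofReal_div_mul {a b : ℝ} (ha : 0 < a) {X Y : ℝ≥0∞}
    (h : ENNReal.ofReal a * X ≤ ENNReal.ofReal b * Y) : X ≤ ENNReal.ofReal (b / a) * Y := by
  have h0 : ENNReal.ofReal a ≠ 0 := by simpa using ha
  rw [← ENNReal.mul_le_mul_iff_right h0 ENNReal.ofReal_ne_top, ← mul_assoc,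
    ← ENNReal.ofReal_mul ha.le, mul_div_cancel₀ _ ha.ne']
  exact h

/-- The constant in the scaled trace inequality. -/
noncomputable def traceConst (d : ℕ) (M κ : ℝ) : ℝ :=
  2 * M * 2 ^ (d - 1) * κ ^ d * (1 + 16 * d * κ ^ 2) / unitBallVol d

/-- When `r`, `R` and `h` are comparable, the trace inequality takes its scaled form: `h⁻¹` in front
of the function and `h` in front of its gradient. -/
theorem SmoothApprox.exists_trace_scaled (hd : 1 ≤ d) {W : Set (E d)} {b : E d} {r R M κ h : ℝ}
    (hW : StarPatch W b r R) (hrR : r ≤ R) (hM : 0 ≤ M) (hh : 0 < h) (hhR : h ≤ R)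
    (hRh : R ≤ κ * h) (hRr : R ≤ κ * r)
    (ν : Measure (E d)) {S : Set (E d)}
    (hreg : ∀ z s, 0 ≤ s → s ≤ 2 * R →
      (ν.restrict S) (Metric.closedBall z s) ≤ ENNReal.ofReal (M * s ^ (d - 1)))
    (hsee : ∀ᵐ x ∂(ν.restrict S), Sees W b r x ∧ x ∈ Metric.ball b R)
    {w : E d → ℝ} {G : Fin d → E d → ℝ} {f : ℕ → E d → ℝ} (hf : SmoothApprox W w G f) :
    ∃ T, MemLp T 2 (ν.restrict S) ∧ L2Tendsto ν S f T ∧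
      l2Sq ν S T ≤ ENNReal.ofReal (traceConst d M κ / h) *
        (l2Sq volume W w + ENNReal.ofReal (h ^ 2) * ∑ k, l2Sq volume W (G k)) := by
  obtain ⟨T, h1, h2, h3⟩ := hf.exists_trace hd hW hrR hM ν hreg hsee
  refine ⟨T, h1, h2, ?_⟩
  have hr := hW.pos
  have hR : 0 < R := hr.trans_le hrR
  have hv := unitBallVol_pos d
  have hκ : 0 < κ := pos_of_mul_pos_left (hR.trans_le hRh) hh.le
  have h4 := ENNReal.le_ofReal_div_mul (a := unitBallVol d * r ^ d) (by positivity) (h3.trans (c := ENNReal.ofReal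
    (2 * M * (2 * R) ^ (d - 1) * (1 + 16 * d * κ ^ 2)) * (l2Sq volume W w +
      ENNReal.ofReal (h ^ 2) * ∑ k, l2Sq volume W (G k))) ?_)
  · refine h4.trans (mul_le_mul' (ENNReal.ofReal_le_ofReal ?_) le_rfl)
    obtain ⟨n, rfl⟩ : ∃ n, d = n + 1 := ⟨d - 1, by omega⟩
    rw [traceConst, div_le_div_iff₀ (by positivity) hh, div_mul_eq_mul_div, le_div_iff₀ hv]
    simp only [Nat.add_sub_cancel, mul_pow]
    have h5 : R ^ n * h ≤ κ ^ (n + 1) * r ^ (n + 1) := by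
      rw [← mul_pow, pow_succ]
      exact mul_le_mul (pow_le_pow_left₀ hR.le hRr n) (hhR.trans hRr) hh.le (by positivity)
    have h6 : 0 ≤ 2 * M * 2 ^ n * (1 + 16 * ((n + 1 : ℕ) : ℝ) * κ ^ 2) * unitBallVol (n + 1) := by
      positivity
    have := mul_le_mul_of_nonneg_left h5 h6
    calc _ = _ := by ring
      _ ≤ _ := this
      _ = _ := by ring
  · rw [ENNReal.ofReal_mul (q := 1 + 16 * d * κ ^ 2) (by positivity),
      mul_assoc (ENNReal.ofReal (2 * M * (2 * R) ^ (d - 1)))]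
    refine mul_le_mul' le_rfl ?_
    rw [mul_add]
    refine add_le_add ?_ ?_
    · refine le_mul_of_one_le_left bot_le (ENNReal.one_le_ofReal.2 ?_)
      have : 0 ≤ 16 * d * κ ^ 2 := by positivity
      linarith
    · rw [← mul_assoc, ← ENNReal.ofReal_mul (by positivity)]
      refine mul_le_mul' (ENNReal.ofReal_le_ofReal ?_) le_rfl
      have : R ^ 2 ≤ (κ * h) ^ 2 := pow_le_pow_left₀ hR.le hRh 2
      have h7 : (16 * d : ℝ) * R ^ 2 ≤ 16 * d * (κ * h) ^ 2 := by gcongr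
      nlinarith [sq_nonneg h]

end Local

/-! ### Gradients and traces of the local error -/

section LocalEnergy

variable {d : ℕ}

/-- An element outside subdomain `i` has an empty part there. The infima in the energy norm still
ask for gradients and traces on it, and these must exist for the norm to be finite. -/
theorem hasWeakGrad_empty (w : E d → ℝ) : HasWeakGrad ∅ w (0 : E d → E d) := fun j =>
  ⟨by simp, by simp, fun φ _ _ _ => by simp⟩

theorem isTrace_empty (w T : E d → ℝ) : IsTrace ∅ ∅ w T := by
  refine ⟨by simp, 0, hasWeakGrad_empty w, fun _ _ => 0, fun _ => contDiff_const, ?_, ?_, ?_⟩ <;> simp [l2Sq]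

theorem isGradTrace_empty (w : E d → ℝ) (T : E d → E d) : IsGradTrace ∅ ∅ w T :=
  ⟨0, hasWeakGrad_empty w, fun _ => isTrace_empty _ _⟩

/-- On `W`, the derivatives of `p` up to order two approximate those of a function with the weak
derivatives `G`, with the correct powers of `h`. -/
def ApproxOn (W : Set (E d)) (G : ∀ j : ℕ, (Fin j → Fin d) → E d → ℝ) (p : E d → ℝ) (h : ℝ)
    (A : ℝ≥0∞) : Prop :=
  ∀ j ≤ 2, ∀ i : Fin j → Fin d,
    l2Sq volume W (fun x => G j i x - pds i p x) ≤ ENNReal.ofReal (h ^ 2 / (h ^ 2) ^ j) * A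

variable {W D S : Set (E d)} {b : E d} {r R M κ h : ℝ} {u w p : E d → ℝ} {N : ℕ}
  {G : ∀ j : ℕ, (Fin j → Fin d) → E d → ℝ} {A : ℝ≥0∞}

theorem ApproxOn.zero (hA : ApproxOn W G p h A) (hG : IsDerivFamily N W u G) :
    l2Sq volume W (fun x => u x - p x) ≤ ENNReal.ofReal (h ^ 2) * A := by
  have := hA 0 (by norm_num) Fin.elim0
  rw [hG.1, pds_zero] at this
  simpa using this

theorem ApproxOn.one (hA : ApproxOn W G p h A) (hh : 0 < h) (k : Fin d) :
    l2Sq volume W (fun x => G 1 (fun _ => k) x - pd k p x) ≤ A := by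
  have := hA 1 (by norm_num) fun _ => k
  rw [pds_one, pow_one, div_self (by positivity)] at this
  simpa using this

theorem ApproxOn.two (hA : ApproxOn W G p h A) (hp : ContDiff ℝ ∞ p) (hh : 0 < h) (k l : Fin d) :
    ENNReal.ofReal (h ^ 2) * l2Sq volume W (fun x => G 2 ![l, k] x - pd l (pd k p) x) ≤ A := by
  have := hA 2 le_rfl ![l, k]
  rw [pds_two _ _ hp] at this
  calc _ ≤ ENNReal.ofReal (h ^ 2) * (ENNReal.ofReal (h ^ 2 / (h ^ 2) ^ 2) * A) := mul_le_mul' le_rfl this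
    _ = A := by
      rw [← mul_assoc, ← ENNReal.ofReal_mul (by positivity)]
      have : h ^ 2 * (h ^ 2 / (h ^ 2) ^ 2) = 1 := by field_simp
      rw [this]
      simp

theorem gradSq_le_of_approxOn (hW : StarPatch W b r R) (hG : IsDerivFamily N W u G) (hN : 2 ≤ N)
    (hp : ContDiff ℝ ∞ p) (hA : ApproxOn W G p h A) (hh : 0 < h) (hD : MeasurableSet D) (hDW : D ⊆ W)
    (hw : EqOn w (fun x => u x - p x) D) : gradSq D w ≤ d * A := by
  obtain ⟨φ, h0, -⟩ := hG.exists_smoothApprox hN hW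
  have hWb : Bornology.IsBounded W := Metric.isBounded_ball.subset hW.subset
  have h1 := ((h0.sub hWb hW.isOpen.measurableSet hp).mono hDW)
  have h2 := h1.hasWeakGrad (hWb.subset hDW) hD
  refine (iInf₂_le _ fun k => (h2 k).congr hD hw).trans ?_
  rw [l2Sq_vector volume D fun k => (h1.memLp_grad k).1]
  calc _ ≤ ∑ _k : Fin d, A := Finset.sum_le_sum fun k _ =>
        (l2Sq_mono_set hDW _).trans (hA.one hh k)
    _ = _ := by simp

/-- The bound comes from the star-shaped set `W`, and the approximating sequence is then restricted
to `D`. Nothing is asked of the shape of `D`, which may be a thin sliver. -/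
theorem exists_isTrace_le (hd : 1 ≤ d) (hW : StarPatch W b r R) (hrR : r ≤ R) (hM : 0 ≤ M)
    (hh : 0 < h) (hhR : h ≤ R) (hRh : R ≤ κ * h) (hRr : R ≤ κ * r)
    (hreg : ∀ z s, 0 ≤ s → s ≤ 2 * R →
      ((surf d).restrict S) (Metric.closedBall z s) ≤ ENNReal.ofReal (M * s ^ (d - 1)))
    (hsee : ∀ᵐ x ∂((surf d).restrict S), Sees W b r x ∧ x ∈ Metric.ball b R)
    (hG : IsDerivFamily N W u G) (hN : 2 ≤ N)
    (hp : ContDiff ℝ ∞ p) (hA : ApproxOn W G p h A) (hD : MeasurableSet D) (hDW : D ⊆ W)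
    (hw : EqOn w (fun x => u x - p x) D) :
    ∃ T, IsTrace D S w T ∧ MemLp T 2 ((surf d).restrict S) ∧
      l2Sq (surf d) S T ≤ ENNReal.ofReal (traceConst d M κ * (1 + d) * h) * A := by
  obtain ⟨φ, h0, -⟩ := hG.exists_smoothApprox hN hW
  have hWb : Bornology.IsBounded W := Metric.isBounded_ball.subset hW.subset
  have h1 := h0.sub hWb hW.isOpen.measurableSet hp
  obtain ⟨T, hT, ht, hb⟩ := h1.exists_trace_scaled hd hW hrR hM hh hhR hRh hRr (surf d) hreg hsee
  refine ⟨T, (h1.mono hDW).isTrace (hWb.subset hDW) hD hw hT ht, hT, hb.trans ?_⟩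
  have htc : 0 ≤ traceConst d M κ := by
    have hv := unitBallVol_pos d
    have hκ : 0 < κ := pos_of_mul_pos_left ((hW.pos.trans_le hrR).trans_le hRh) hh.le
    unfold traceConst; positivity
  calc _ ≤ ENNReal.ofReal (traceConst d M κ / h) * (ENNReal.ofReal (h ^ 2) * A +
        ENNReal.ofReal (h ^ 2) * ∑ _k : Fin d, A) := by
        refine mul_le_mul' le_rfl (add_le_add (hA.zero hG) (mul_le_mul' le_rfl ?_))
        exact Finset.sum_le_sum fun k _ => hA.one hh k
    _ = ENNReal.ofReal (traceConst d M κ / h) * (ENNReal.ofReal (h ^ 2) *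
        (ENNReal.ofReal (1 + d) * A)) := by
        rw [ENNReal.ofReal_add (by norm_num) (by positivity)]
        simp
        ring
    _ = _ := by
        rw [← mul_assoc, ← mul_assoc, ← ENNReal.ofReal_mul (by positivity),
          ← ENNReal.ofReal_mul (by positivity)]
        congr 2
        field_simp

/-- The trace inequality is applied to each first derivative. The second derivatives on the right
are the reason why the local approximation is needed up to order two. -/
theorem exists_isGradTrace_le (hd : 1 ≤ d) (hW : StarPatch W b r R) (hrR : r ≤ R) (hM : 0 ≤ M)
    (hh : 0 < h) (hhR : h ≤ R) (hRh : R ≤ κ * h) (hRr : R ≤ κ * r)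
    (hreg : ∀ z s, 0 ≤ s → s ≤ 2 * R →
      ((surf d).restrict S) (Metric.closedBall z s) ≤ ENNReal.ofReal (M * s ^ (d - 1)))
    (hsee : ∀ᵐ x ∂((surf d).restrict S), Sees W b r x ∧ x ∈ Metric.ball b R)
    (hG : IsDerivFamily N W u G) (hN : 2 ≤ N)
    (hp : ContDiff ℝ ∞ p) (hA : ApproxOn W G p h A) (hD : MeasurableSet D) (hDW : D ⊆ W)
    (hw : EqOn w (fun x => u x - p x) D) :
    ∃ T, IsGradTrace D S w T ∧ AEStronglyMeasurable T ((surf d).restrict S) ∧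
      l2Sq (surf d) S T ≤ ENNReal.ofReal (d * (traceConst d M κ * (1 + d)) / h) * A := by
  obtain ⟨φ, h0, h0'⟩ := hG.exists_smoothApprox hN hW
  have hWb : Bornology.IsBounded W := Metric.isBounded_ball.subset hW.subset
  have h1 := h0.sub hWb hW.isOpen.measurableSet hp
  have h2 := fun k => (h0' k).sub hWb hW.isOpen.measurableSet (contDiff_pd hp k)
  choose T hT ht hb using fun k =>
    (h2 k).exists_trace_scaled hd hW hrR hM hh hhR hRh hRr (surf d) hreg hsee
  have htc : 0 ≤ traceConst d M κ := by
    have hv := unitBallVol_pos d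
    have hκ : 0 < κ := pos_of_mul_pos_left ((hW.pos.trans_le hrR).trans_le hRh) hh.le
    unfold traceConst; positivity
  refine ⟨fun x => WithLp.toLp 2 fun k => T k x, ⟨_, fun k =>
    ((h1.mono hDW).hasWeakGrad (hWb.subset hDW) hD k).congr hD hw, fun k =>
    ((h2 k).mono hDW).isTrace (hWb.subset hDW) hD (fun x _ => rfl) (hT k) (ht k)⟩, ?_, ?_⟩
  · exact ((PiLp.continuous_toLp 2 _).measurable.comp_aemeasurable
      (aemeasurable_pi_lambda _ fun k => (hT k).1.aemeasurable)).aestronglyMeasurable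
  rw [l2Sq_vector (surf d) S fun k => (hT k).1]
  have hk : ∀ k, l2Sq (surf d) S (T k) ≤ ENNReal.ofReal (traceConst d M κ * (1 + d) / h) * A := by
    intro k
    refine (hb k).trans ?_
    calc _ ≤ ENNReal.ofReal (traceConst d M κ / h) * (A + ∑ _l : Fin d, A) := by
          refine mul_le_mul' le_rfl (add_le_add (hA.one hh k) ?_)
          rw [Finset.mul_sum]
          exact Finset.sum_le_sum fun l _ => hA.two hp hh k l
      _ = ENNReal.ofReal (traceConst d M κ / h) * (ENNReal.ofReal (1 + d) * A) := by
          rw [ENNReal.ofReal_add (by norm_num) (by positivity)]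
          simp
          ring
      _ = _ := by
          rw [← mul_assoc, ← ENNReal.ofReal_mul (by positivity)]
          congr 2
          field_simp
  calc _ ≤ ∑ _k : Fin d, ENNReal.ofReal (traceConst d M κ * (1 + d) / h) * A :=
        Finset.sum_le_sum fun k _ => hk k
    _ = _ := by
        rw [mul_div_assoc (d : ℝ), ENNReal.ofReal_mul (p := (d : ℝ)) (by positivity)]
        simp
        ring

end LocalEnergy

/-! ### Hypersurfaces -/

section Surface

variable {d : ℕ}

/-- Coordinates orthogonal to `ν`, from an orthonormal basis that starts with `ν`; the identity is
Pythagoras' theorem. -/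
theorem exists_complement_map {n : ℕ} {ν : E (n + 1)} (hν : ‖ν‖ = 1) :
    ∃ f : E (n + 1) → E n, ∀ x y, ‖x - y‖ ^ 2 = (inner ℝ ν (x - y)) ^ 2 + ‖f x - f y‖ ^ 2 := by
  have hon : Orthonormal ℝ (({0} : Set (Fin (n + 1))).domRestrict fun _ => ν) := by
    constructor
    · exact fun _ => hν
    · intro i j hij
      exact absurd (Subtype.ext (i.2.trans j.2.symm)) hij
  obtain ⟨B, hB⟩ := hon.exists_orthonormalBasis_extension_of_card_eq (by simp)
  have hB0 : B 0 = ν := hB 0 rfl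
  refine ⟨fun x => WithLp.toLp 2 fun k => inner ℝ (B k.succ) x, fun x y => ?_⟩
  rw [← B.sum_sq_norm_inner_right (x - y), Fin.sum_univ_succ, hB0, EuclideanSpace.norm_sq_eq]
  simp [inner_sub_right]

theorem LipschitzOnWith.euclideanHausdorffMeasure_image_le {X Y : Type*} [EMetricSpace X]
    [MeasurableSpace X] [BorelSpace X] [EMetricSpace Y] [MeasurableSpace Y] [BorelSpace Y]
    {K : NNReal} {f : X → Y} {s : Set X} (h : LipschitzOnWith K f s) (n : ℕ) :
    (Measure.euclideanHausdorffMeasure n : Measure Y) (f '' s) ≤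
      (K : ℝ≥0∞) ^ n * (Measure.euclideanHausdorffMeasure n : Measure X) s := by
  rw [Measure.euclideanHausdorffMeasure_def, Measure.euclideanHausdorffMeasure_def,
    Measure.smul_apply, Measure.smul_apply, ENNReal.smul_def, ENNReal.smul_def, smul_eq_mul,
    smul_eq_mul, mul_left_comm]
  refine mul_le_mul' le_rfl ?_
  simpa using h.hausdorffMeasure_image_le (d := n) (by positivity)

/-- The constant in the bound for the area of a hypersurface in a ball. -/
noncomputable def surfConst (d : ℕ) : ℝ := 2 ^ (d - 1) * unitBallVol (d - 1)

theorem surfConst_nonneg (d : ℕ) : 0 ≤ surfConst d := by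
  have := unitBallVol_pos (d - 1)
  unfold surfConst; positivity

/-- The points of `S` differ by vectors that are far from the direction `ν`. -/
def IsFlat (S : Set (E d)) : Prop :=
  ∃ ν : E d, ‖ν‖ = 1 ∧ ∀ x ∈ S, ∀ y ∈ S, |inner ℝ ν (x - y)| ≤ 1 / 2 * ‖x - y‖

theorem IsFlat.mono {S S' : Set (E d)} (h : IsFlat S) (hS : S' ⊆ S) : IsFlat S' :=
  let ⟨ν, h1, h2⟩ := h; ⟨ν, h1, fun x hx y hy => h2 x (hS hx) y (hS hy)⟩

/-- Projection along `ν` is injective on a flat set, and its inverse is Lipschitz with constant two.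
The area is thus at most `2 ^ (d - 1)` times the volume of the projection, which lies in a ball of
radius `s`. -/
theorem IsFlat.surf_le (hd : 1 ≤ d) {S : Set (E d)} (h : IsFlat S) (z : E d) {s : ℝ} (hs : 0 ≤ s) :
    surf d (S ∩ Metric.closedBall z s) ≤ ENNReal.ofReal (surfConst d * s ^ (d - 1)) := by
  obtain ⟨n, rfl⟩ : ∃ n, d = n + 1 := ⟨d - 1, by omega⟩
  obtain ⟨ν, hν, hS⟩ := h
  obtain ⟨f, hf⟩ := exists_complement_map hν
  set B := S ∩ Metric.closedBall z s
  have hle : ∀ x ∈ B, ∀ y ∈ B, ‖x - y‖ ≤ 2 * ‖f x - f y‖ := by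
    intro x hx y hy
    have h1 := hf x y
    have h2 := hS x hx.1 y hy.1
    have h3 : (inner ℝ ν (x - y)) ^ 2 ≤ (1 / 2 * ‖x - y‖) ^ 2 := by
      rw [← sq_abs]
      exact pow_le_pow_left₀ (abs_nonneg _) h2 2
    refine (sq_le_sq₀ (norm_nonneg _) (by positivity)).1 ?_
    nlinarith [sq_nonneg ‖f x - f y‖]
  have hinj : InjOn f B := fun x hx y hy hxy => by
    have := hle x hx y hy
    rw [hxy, sub_self, norm_zero, mul_zero] at this
    exact sub_eq_zero.1 (norm_le_zero_iff.1 this)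
  have hsub : f '' B ⊆ Metric.closedBall (f z) s := by
    rintro _ ⟨x, hx, rfl⟩
    have h1 := hf x z
    have h2 := mem_closedBall_iff_norm.1 hx.2
    rw [mem_closedBall_iff_norm]
    refine (sq_le_sq₀ (norm_nonneg _) hs).1 ?_
    nlinarith [sq_nonneg (inner ℝ ν (x - z)), norm_nonneg (x - z)]
  let g := Function.invFunOn f B
  have hg : ∀ x ∈ B, g (f x) = x := fun x hx => hinj.leftInvOn_invFunOn hx
  have hlip : LipschitzOnWith 2 g (f '' B) := by
    refine LipschitzOnWith.of_dist_le_mul ?_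
    rintro _ ⟨x, hx, rfl⟩ _ ⟨y, hy, rfl⟩
    rw [hg x hx, hg y hy, dist_eq_norm, dist_eq_norm]
    exact hle x hx y hy
  have hB : g '' (f '' B) = B := by
    ext x
    constructor
    · rintro ⟨_, ⟨y, hy, rfl⟩, rfl⟩
      rwa [hg y hy]
    · exact fun hx => ⟨f x, ⟨x, hx, rfl⟩, hg x hx⟩
  have h1 := LipschitzOnWith.euclideanHausdorffMeasure_image_le hlip n
  rw [hB, EuclideanSpace.euclideanHausdorffMeasure_eq_volume] at h1
  refine h1.trans ((mul_le_mul' le_rfl (measure_mono hsub)).trans (le_of_eq ?_))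
  rw [volume_closedBall_eq _ hs, surfConst, Nat.add_sub_cancel, mul_assoc,
    ENNReal.ofReal_mul (p := 2 ^ n) (by positivity), ENNReal.ofReal_pow (by norm_num)]
  simp

theorem IsFlat.regular (hd : 1 ≤ d) {S : Set (E d)} (h : IsFlat S) (z : E d) {s : ℝ} (hs : 0 ≤ s) :
    ((surf d).restrict S) (Metric.closedBall z s) ≤ ENNReal.ofReal (surfConst d * s ^ (d - 1)) := by
  rw [Measure.restrict_apply Metric.isClosed_closedBall.measurableSet, inter_comm]
  exact h.surf_le hd z hs

/-! ### The interface -/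

/-- In the ball `B(x₀, ρ)`, the points below `Z` in the direction `ν` are in `U`. -/
def ConeAt (U Z : Set (E d)) (x₀ : E d) (ρ ε : ℝ) (ν : E d) : Prop :=
  ∀ x ∈ Metric.ball x₀ ρ, ∀ y ∈ Metric.ball x₀ ρ, x ≠ y → ε * ‖y - x‖ ≤ inner ℝ ν (y - x) →
    y ∈ Z → x ∈ U

/-- Near `z` the defining function grows along its gradient `g` at a definite rate. If `y` is in the
closure, then `φ y ≤ 0`; a point below `y` inside the cone has a strictly smaller value and is
therefore in `U`. -/
theorem exists_coneAt_of_mem_frontier {U : Set (E d)} (hC : HasC2Boundary U)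
    {z : E d} (hz : z ∈ frontier U) {ε : ℝ} (hε : 0 < ε) :
    ∃ ρ : ℝ, 0 < ρ ∧ ∃ ν : E d, ‖ν‖ = 1 ∧ ConeAt U (closure U) z ρ ε ν := by
  obtain ⟨φ, hφ, hφ', hev⟩ := hC z hz
  set g := ∇ φ z with hg
  have hgi : ∀ v, fderiv ℝ φ z v = inner ℝ g v := fun v => by
    rw [hg, gradient, InnerProductSpace.toDual_symm_apply]
  have hg0 : g ≠ 0 := fun h => hφ' (by ext v; simp [hgi, h])
  have hgn : 0 < ‖g‖ := norm_pos_iff.2 hg0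
  have hs := hφ.hasStrictFDerivAt (by norm_num)
  -- Inside the cone the linear part is at least `‖g‖ ε ‖y - x‖`. An error of half this size keeps
  -- the difference of values positive for all pairs of nearby points, as strict differentiability
  -- allows.
  have hlo := (hs.isLittleO.def (c := ‖g‖ * ε / 2) (by positivity))
  have hcont : ∀ᶠ y in 𝓝 z, ContinuousAt φ y :=
    (hφ.eventually (by simp)).mono fun y hy => hy.continuousAt
  rw [nhds_prod_eq] at hlo
  obtain ⟨P, hP, Q, hQ, hPQ⟩ := eventually_prod_iff.1 hlo
  obtain ⟨ρ, hρ, hball⟩ := Metric.eventually_nhds_iff_ball.1 (((hP.and hQ).and hcont).and hev)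
  refine ⟨ρ, hρ, ‖g‖⁻¹ • g, by rw [norm_smul, norm_inv, norm_norm, inv_mul_cancel₀ hgn.ne'],
    fun x hx y hy hxy hc hyc => ?_⟩
  obtain ⟨⟨⟨_, hxQ⟩, _⟩, hxU⟩ := hball x hx
  obtain ⟨⟨⟨hyP, _⟩, hycont⟩, _⟩ := hball y hy
  have h1 := hPQ hyP hxQ
  simp only at h1
  have hφy : φ y ≤ 0 := by
    refine le_of_not_gt fun hpos => ?_
    have h2 : ∀ᶠ w in 𝓝 y, 0 < φ w := hycont.eventually_const_lt hpos
    have h3 : ∀ᶠ w in 𝓝 y, w ∈ Metric.ball z ρ := Metric.isOpen_ball.mem_nhds hy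
    obtain ⟨w, hwU, hw1, hw2⟩ := ((mem_closure_iff_frequently.1 hyc).and_eventually (h2.and h3)).exists
    have := ((hball w hw2).2).1 hwU
    linarith
  rw [hxU]
  rw [inner_smul_left, RCLike.conj_to_real] at hc
  have h4 : ‖g‖ * (ε * ‖y - x‖) ≤ inner ℝ g (y - x) := by
    calc _ ≤ ‖g‖ * (‖g‖⁻¹ * inner ℝ g (y - x)) := by gcongr
      _ = _ := by field_simp
  have hpos : 0 < ‖y - x‖ := norm_pos_iff.2 (sub_ne_zero.2 hxy.symm)
  rw [hgi, Real.norm_eq_abs, abs_le] at h1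
  have h5 : 0 < ‖g‖ * ε / 2 * ‖y - x‖ := by positivity
  nlinarith [h1.1]

/-- The frontier is compact, so a Lebesgue number of the cover by the local balls gives one radius
for all of its points. -/
theorem exists_coneAt {U : Set (E d)} (hC : HasC2Boundary U) (hb : Bornology.IsBounded U) {ε : ℝ}
    (hε : 0 < ε) : ∃ ρ : ℝ, 0 < ρ ∧ ∀ x₀ ∈ frontier U, ∃ ν : E d, ‖ν‖ = 1 ∧
      ConeAt U (closure U) x₀ ρ ε ν := by
  choose ρ hρ ν hν hcone using fun z : frontier U => exists_coneAt_of_mem_frontier hC z.2 hε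
  have hcomp : IsCompact (frontier U) :=
    hb.isCompact_closure.of_isClosed_subset isClosed_frontier frontier_subset_closure
  obtain ⟨δ, hδ, h⟩ := lebesgue_number_lemma_of_metric hcomp
    (c := fun z : frontier U => Metric.ball (z : E d) (ρ z)) (fun _ => Metric.isOpen_ball)
    fun z hz => mem_iUnion.2 ⟨⟨z, hz⟩, Metric.mem_ball_self (hρ _)⟩
  refine ⟨δ, hδ, fun x₀ hx₀ => ?_⟩
  obtain ⟨z, hz⟩ := h x₀ hx₀
  exact ⟨ν z, hν z, fun x hx y hy => hcone z x (hz hx) y (hz hy)⟩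

/-- Contraposition, with the roles of the two points exchanged and the axis reversed. The outer
subdomain thereby inherits the cone condition. -/
theorem ConeAt.compl {U Z : Set (E d)} {x₀ ν : E d} {ρ ε : ℝ} (h : ConeAt U Z x₀ ρ ε ν) :
    ConeAt Zᶜ Uᶜ x₀ ρ ε (-ν) := by
  intro x hx y hy hxy hc hyU hxZ
  refine hyU (h y hy x hx hxy.symm ?_ hxZ)
  rwa [norm_sub_rev, ← neg_sub y x, inner_neg_right, ← inner_neg_left]

/-- If two frontier points differed by a vector close to the direction `ν`, the lower one would lie
in the open set `U` and could not be on its frontier. -/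
theorem ConeAt.isFlat {U : Set (E d)} (hU : IsOpen U) {x₀ ν : E d} {ρ ε : ℝ} (hν : ‖ν‖ = 1)
    (hε : ε ≤ 1 / 2) (h : ConeAt U (closure U) x₀ ρ ε ν) : IsFlat (frontier U ∩ Metric.ball x₀ ρ) := by
  refine ⟨ν, hν, fun x hx y hy => ?_⟩
  have key : ∀ x ∈ frontier U ∩ Metric.ball x₀ ρ, ∀ y ∈ frontier U ∩ Metric.ball x₀ ρ,
      inner ℝ ν (y - x) ≤ 1 / 2 * ‖y - x‖ := by
    intro x hx y hy
    by_contra! hc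
    have hxy : x ≠ y := by
      rintro rfl
      simp at hc
    have hxU : x ∈ U := h x hx.2 y hy.2 hxy
      ((mul_le_mul_of_nonneg_right hε (norm_nonneg _)).trans hc.le) (frontier_subset_closure hy.1)
    have := hx.1
    rw [hU.frontier_eq] at this
    exact this.2 hxU
  rw [abs_le]
  constructor
  · have := key x hx y hy
    rw [norm_sub_rev, ← neg_sub x y, inner_neg_right] at this
    linarith
  · exact key y hy x hx

/-- One-sided neighbourhoods of interface points are star-shaped. -/
theorem ConeAt.starPatch {U Z : Set (E d)} (hU : IsOpen U) (hUZ : U ⊆ Z) {x₀ ν : E d} {ρ ϱ : ℝ}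
    (hν : ‖ν‖ = 1) (h : ConeAt U Z x₀ ρ (1 / 16) ν) (hx₀ : x₀ ∈ Z) (hϱ : 0 < ϱ) (hϱρ : ϱ ≤ ρ) :
    StarPatch (U ∩ Metric.ball x₀ ϱ) (x₀ - (ϱ / 2) • ν) (ϱ / 8) (3 / 2 * ϱ) ∧
    ∀ x ∈ Z ∩ Metric.ball x₀ ϱ,
      Sees (U ∩ Metric.ball x₀ ϱ) (x₀ - (ϱ / 2) • ν) (ϱ / 8) x ∧
        x ∈ Metric.ball (x₀ - (ϱ / 2) • ν) (3 / 2 * ϱ) := by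
  set b := x₀ - (ϱ / 2) • ν with hb
  have hbx : ‖b - x₀‖ = ϱ / 2 := by
    rw [hb, sub_sub_cancel_left, norm_neg, norm_smul, hν, mul_one, Real.norm_of_nonneg (by positivity)]
  have hρ : 0 < ρ := hϱ.trans_le hϱρ
  have hx₀b : x₀ ∈ Metric.ball x₀ ρ := Metric.mem_ball_self hρ
  have hball : ∀ y ∈ Metric.ball b (ϱ / 8), y ∈ Metric.ball x₀ ϱ := by
    intro y hy
    rw [mem_ball_iff_norm] at hy ⊢
    have := norm_sub_le_norm_sub_add_norm_sub y b x₀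
    linarith
  have hlow : ∀ y ∈ Metric.ball b (ϱ / 8), inner ℝ ν (y - x₀) ≤ -(3 / 8 * ϱ) := by
    intro y hy
    rw [mem_ball_iff_norm] at hy
    have e : y - x₀ = (y - b) - (ϱ / 2) • ν := by rw [hb]; abel
    have h1 : inner ℝ ν (y - b) ≤ ‖y - b‖ := by
      simpa [hν] using real_inner_le_norm ν (y - b)
    rw [e, inner_sub_right, inner_smul_right, real_inner_self_eq_norm_sq, hν]
    linarith
  have hin : ∀ p ∈ Metric.ball x₀ ϱ, p ≠ x₀ → 1 / 16 * ‖p - x₀‖ ≤ -inner ℝ ν (p - x₀) → p ∈ U := by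
    intro p hp hne hc
    refine h p (Metric.ball_subset_ball hϱρ hp) x₀ hx₀b hne ?_ hx₀
    rwa [norm_sub_rev, ← neg_sub p x₀, inner_neg_right]
  have hsees : ∀ x ∈ Z ∩ Metric.ball x₀ ϱ, Sees (U ∩ Metric.ball x₀ ϱ) b (ϱ / 8) x := by
    intro x hx y hy t ht
    have hy' := hball y hy
    have hp : x + t • (y - x) ∈ Metric.ball x₀ ϱ :=
      (convex_ball x₀ ϱ).add_smul_sub_mem hx.2 hy' ⟨ht.1.le, ht.2⟩
    refine ⟨?_, hp⟩
    set p := x + t • (y - x) with hpdef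
    have hly := hlow y hy
    -- Either `p` lies in the cone below `x₀`, or its height exceeds `-ϱ/16`. In the second case
    -- `y`, at height at most `-3ϱ/8`, is so much lower than `x` that the segment is steep: it rises
    -- by more than `5ϱ/16` over a length below `2ϱ`. Then `p` lies in the cone below `x` itself.
    by_cases hc : p ≠ x₀ ∧ 1 / 16 * ‖p - x₀‖ ≤ -inner ℝ ν (p - x₀)
    · exact hin p hp hc.1 hc.2
    have hpn := mem_ball_iff_norm.1 hp
    have h1 : -(ϱ / 16) < inner ℝ ν (p - x₀) := by
      by_cases hpx : p = x₀
      · rw [hpx, sub_self, inner_zero_right]; linarith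
      · have : ¬ (1 / 16 * ‖p - x₀‖ ≤ -inner ℝ ν (p - x₀)) := fun h' => hc ⟨hpx, h'⟩
        linarith
    have h2 : inner ℝ ν (p - y) = (1 - t) * inner ℝ ν (x - y) := by
      have : p - y = (1 - t) • (x - y) := by rw [hpdef]; module
      rw [this, inner_smul_right]
    have h3 : inner ℝ ν (p - y) = inner ℝ ν (p - x₀) - inner ℝ ν (y - x₀) := by
      rw [← inner_sub_right, sub_sub_sub_cancel_right]
    have h4 : 5 / 16 * ϱ < (1 - t) * inner ℝ ν (x - y) := by linarith
    have h5 : 5 / 16 * ϱ < inner ℝ ν (x - y) := by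
      have ht1 : 0 ≤ 1 - t := by linarith [ht.2]
      have ht2 : 1 - t ≤ 1 := by linarith [ht.1]
      have : 0 < inner ℝ ν (x - y) := by
        by_contra! hneg
        nlinarith
      nlinarith
    have h6 : ‖x - y‖ < 2 * ϱ := by
      have h7 := norm_sub_le_norm_sub_add_norm_sub x x₀ y
      have h8 := mem_ball_iff_norm.1 hx.2
      have h9 := mem_ball_iff_norm'.1 hy'
      linarith
    have hxp : x - p = t • (x - y) := by rw [hpdef]; module
    have hxy : x - y ≠ 0 := by
      intro h0
      rw [h0, inner_zero_right] at h5
      linarith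
    refine h p (Metric.ball_subset_ball hϱρ hp) x (Metric.ball_subset_ball hϱρ hx.2) ?_ ?_ hx.1
    · intro hpx
      rw [hpx, sub_self, eq_comm, smul_eq_zero] at hxp
      exact hxp.elim ht.1.ne' hxy
    · rw [hxp, norm_smul, inner_smul_right, Real.norm_of_nonneg ht.1.le]
      have : 1 / 16 * ‖x - y‖ ≤ inner ℝ ν (x - y) := by linarith
      nlinarith [ht.1]
  have hR : ∀ x ∈ Metric.ball x₀ ϱ, x ∈ Metric.ball b (3 / 2 * ϱ) := by
    intro x hx
    have h1 := mem_ball_iff_norm.1 hx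
    rw [mem_ball_iff_norm]
    have := norm_sub_le_norm_sub_add_norm_sub x x₀ b
    rw [norm_sub_rev x₀ b] at this
    linarith
  refine ⟨⟨hU.inter Metric.isOpen_ball, by positivity, fun x hx => hR x hx.2, ?_,
    fun x hx => hsees x ⟨hUZ hx.1, hx.2⟩⟩, fun x hx => ⟨hsees x hx, hR x hx.2⟩⟩
  · intro y hy
    have hly := hlow y hy
    have hyn := mem_ball_iff_norm.1 (hball y hy)
    refine ⟨hin y (hball y hy) ?_ (by linarith), hball y hy⟩
    rintro rfl
    rw [sub_self, inner_zero_right] at hly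
    linarith

end Surface

/-! ### Patches -/

section Patch

variable {d : ℕ} {Ω Ω₀ : Set (E d)}

theorem Sees.mono_radius {W : Set (E d)} {b x : E d} {r r' : ℝ} (h : Sees W b r x) (hr : r' ≤ r) :
    Sees W b r' x :=
  fun y hy => h y (Metric.ball_subset_ball hr hy)

theorem StarPatch.mono_radius {W : Set (E d)} {b : E d} {r r' R : ℝ} (h : StarPatch W b r R)
    (hr : r' ≤ r) (hr' : 0 < r') : StarPatch W b r' R :=
  ⟨h.isOpen, hr', h.subset, (Metric.ball_subset_ball hr).trans h.ball_subset,
    fun x hx => (h.star x hx).mono_radius hr⟩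

/-- A closed set that contains subdomain `i`, its faces and the interface. -/
def closedRegion (Ω Ω₀ : Set (E d)) (i : Fin 2) : Set (E d) :=
  if i = 0 then closure Ω₀ else closure Ω \ Ω₀

/-- `W` is a star-shaped subset of subdomain `i` that contains all of its points near `z`. -/
structure IsPatch (Ω Ω₀ : Set (E d)) (i : Fin 2) (z : E d) (h r : ℝ) (W : Set (E d)) (b : E d) :
    Prop where
  star : StarPatch W b r (9 * h)
  subset : W ⊆ subdomain Ω Ω₀ i
  superset : subdomain Ω Ω₀ i ∩ Metric.ball z (3 * h) ⊆ W
  sees : ∀ x ∈ closedRegion Ω Ω₀ i ∩ Metric.ball z (3 * h), Sees W b r x ∧ x ∈ Metric.ball b (9 * h)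

theorem IsPreconnected.subset_of_disjoint_frontier {X : Type*} [TopologicalSpace X] {W U : Set X}
    (hW : IsPreconnected W) (hU : IsOpen U) (h : W ∩ frontier U = ∅) (hne : (W ∩ U).Nonempty) :
    W ⊆ U := by
  have hcov : W ⊆ U ∪ (closure U)ᶜ := by
    intro x hx
    by_cases hxU : x ∈ U
    · exact Or.inl hxU
    · refine Or.inr fun hxc => ?_
      have : x ∈ W ∩ frontier U := ⟨hx, by rw [hU.frontier_eq]; exact ⟨hxc, hxU⟩⟩
      rw [h] at this
      exact this
  refine hW.subset_left_of_subset_union hU isClosed_closure.isOpen_compl ?_ hcov hne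
  exact disjoint_compl_right.mono_left subset_closure

theorem IsPreconnected.subset_subdomain {W : Set (E d)} (hW : IsPreconnected W) (hΩ₀ : IsOpen Ω₀)
    (hWΩ : W ⊆ Ω) (h : W ∩ frontier Ω₀ = ∅) {i : Fin 2} (hne : (W ∩ subdomain Ω Ω₀ i).Nonempty) :
    W ⊆ subdomain Ω Ω₀ i := by
  unfold subdomain at hne ⊢
  split_ifs at hne ⊢ with hi
  · exact IsPreconnected.subset_of_disjoint_frontier hW hΩ₀ h hne
  · refine fun x hx => ⟨hWΩ hx, fun hxc => ?_⟩
    obtain ⟨y, hy, _, hyc⟩ := hne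
    have hxΩ₀ : x ∈ Ω₀ := by
      by_contra hx0
      have : x ∈ W ∩ frontier Ω₀ := ⟨hx, by rw [hΩ₀.frontier_eq]; exact ⟨hxc, hx0⟩⟩
      rw [h] at this
      exact this
    exact hyc (subset_closure (IsPreconnected.subset_of_disjoint_frontier hW hΩ₀ h ⟨x, hx, hxΩ₀⟩ hy))

theorem isOpen_subdomain (hΩ : IsOpen Ω) (hΩ₀ : IsOpen Ω₀) (i : Fin 2) :
    IsOpen (subdomain Ω Ω₀ i) := by
  unfold subdomain
  split_ifs
  · exact hΩ₀
  · exact hΩ.sdiff isClosed_closure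

theorem subdomain_subset (hsub : closure Ω₀ ⊆ Ω) (i : Fin 2) : subdomain Ω Ω₀ i ⊆ Ω := by
  unfold subdomain
  split_ifs
  · exact subset_closure.trans hsub
  · exact sdiff_subset

theorem closedRegion_subset (hsub : closure Ω₀ ⊆ Ω) (i : Fin 2) : closedRegion Ω Ω₀ i ⊆ closure Ω := by
  unfold closedRegion
  split_ifs
  · exact hsub.trans subset_closure
  · exact sdiff_subset

theorem faceRegion_subset (i : Fin 2) : faceRegion Ω Ω₀ i ⊆ closedRegion Ω Ω₀ i := by
  unfold faceRegion closedRegion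
  split_ifs
  · exact subset_closure
  · exact sdiff_subset_sdiff_right subset_closure

theorem frontier_subset_closedRegion (hΩ₀ : IsOpen Ω₀) (hsub : closure Ω₀ ⊆ Ω) (i : Fin 2) :
    frontier Ω₀ ⊆ closedRegion Ω Ω₀ i := by
  rw [hΩ₀.frontier_eq]
  unfold closedRegion
  split_ifs
  · exact sdiff_subset
  · exact sdiff_subset_sdiff_left (hsub.trans subset_closure)

/-- The radius `ρ` is small enough for the local geometry of the interface. -/
structure IsInterfaceRadius (Ω Ω₀ : Set (E d)) (ρ : ℝ) : Prop where
  pos : 0 < ρ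
  cone : ∀ x₀ ∈ frontier Ω₀, ∃ ν : E d, ‖ν‖ = 1 ∧ ConeAt Ω₀ (closure Ω₀) x₀ ρ (1 / 16) ν
  ball_subset : ∀ x₀ ∈ frontier Ω₀, Metric.ball x₀ ρ ⊆ Ω

/-- Besides the cone condition, balls about interface points must stay in `Ω`; the compact closure
of `Ω₀` has a positive distance from the complement of `Ω`. -/
theorem exists_interfaceRadius (hΩ : IsOpen Ω) (hΩb : Bornology.IsBounded Ω)
    (hsub : closure Ω₀ ⊆ Ω) (hΓ : HasC2Boundary Ω₀) : ∃ ρ, IsInterfaceRadius Ω Ω₀ ρ := by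
  have hb : Bornology.IsBounded Ω₀ := hΩb.subset (subset_closure.trans hsub)
  obtain ⟨ρ, hρ, hcone⟩ := exists_coneAt hΓ hb (ε := 1 / 16) (by norm_num)
  obtain ⟨δ, hδ, hth⟩ := hb.isCompact_closure.exists_thickening_subset_open hΩ hsub
  refine ⟨min ρ δ, lt_min hρ hδ, fun x₀ hx₀ => ?_, fun x₀ hx₀ => ?_⟩
  · obtain ⟨ν, hν, h⟩ := hcone x₀ hx₀
    exact ⟨ν, hν, fun x hx y hy => h x (Metric.ball_subset_ball (min_le_left _ _) hx) y
      (Metric.ball_subset_ball (min_le_left _ _) hy)⟩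
  · refine (Metric.ball_subset_ball (min_le_right _ _)).trans (Subset.trans ?_ hth)
    exact Metric.ball_subset_thickening (frontier_subset_closure hx₀) δ

/-- If an interface point `x₀` lies within `3h` of `z`, the part of `B(x₀, 6h)` on side `i` is a
patch; its radii `6h/8` and `9h` explain the numbers in the statement. Otherwise convexity of `Ω`
provides the patch. -/
theorem IsInterfaceRadius.exists_isPatch {ρ h r : ℝ} (hρ : IsInterfaceRadius Ω Ω₀ ρ) (hΩ : IsOpen Ω)
    (hΩc : Convex ℝ Ω) (hΩ₀ : IsOpen Ω₀) (hsub : closure Ω₀ ⊆ Ω) (hh : 0 < h) (hhρ : 6 * h ≤ ρ)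
    (hr : 0 < r) (hrh : r ≤ 3 / 4 * h) {i : Fin 2} {z x₁ : E d}
    (hball : Metric.ball x₁ r ⊆ subdomain Ω Ω₀ i) (hx₁ : ‖x₁ - z‖ ≤ h) :
    ∃ W b, IsPatch Ω Ω₀ i z h r W b := by
  by_cases hc : ∃ x₀ ∈ frontier Ω₀, ‖x₀ - z‖ < 3 * h
  · obtain ⟨x₀, hx₀, hx₀z⟩ := hc
    have hbz : Metric.ball z (3 * h) ⊆ Metric.ball x₀ (6 * h) := by
      intro x hx
      rw [mem_ball_iff_norm] at hx ⊢
      have := norm_sub_le_norm_sub_add_norm_sub x z x₀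
      rw [norm_sub_rev z x₀] at this
      linarith
    have hbΩ : Metric.ball x₀ (6 * h) ⊆ Ω :=
      (Metric.ball_subset_ball hhρ).trans (hρ.ball_subset x₀ hx₀)
    obtain ⟨ν, hν, hcone⟩ := hρ.cone x₀ hx₀
    have hfr := hx₀
    rw [hΩ₀.frontier_eq] at hfr
    have hr8 : r ≤ 6 * h / 8 := by linarith
    have h9 : 3 / 2 * (6 * h) = 9 * h := by ring
    fin_cases i
    · obtain ⟨h1, h2⟩ := hcone.starPatch hΩ₀ subset_closure hν hfr.1 (ϱ := 6 * h) (by positivity) hhρ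
      rw [h9] at h1 h2
      exact ⟨_, _, h1.mono_radius hr8 hr, inter_subset_left, fun x hx => ⟨hx.1, hbz hx.2⟩,
        fun x hx => ⟨(h2 x ⟨hx.1, hbz hx.2⟩).1.mono_radius hr8, (h2 x ⟨hx.1, hbz hx.2⟩).2⟩⟩
    · obtain ⟨h1, h2⟩ := hcone.compl.starPatch isClosed_closure.isOpen_compl
        (compl_subset_compl.2 subset_closure) (by rwa [norm_neg]) hfr.2 (ϱ := 6 * h) (by positivity) hhρ
      rw [h9] at h1 h2
      exact ⟨_, _, h1.mono_radius hr8 hr, fun x hx => ⟨hbΩ hx.2, hx.1⟩,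
        fun x hx => ⟨hx.1.2, hbz hx.2⟩,
        fun x hx => ⟨(h2 x ⟨hx.1.2, hbz hx.2⟩).1.mono_radius hr8, (h2 x ⟨hx.1.2, hbz hx.2⟩).2⟩⟩
  · push Not at hc
    set W := Ω ∩ Metric.ball z (3 * h) with hW
    have hWc : Convex ℝ W := hΩc.inter (convex_ball _ _)
    have hbW : Metric.ball x₁ r ⊆ W := by
      refine fun x hx => ⟨subdomain_subset hsub i (hball hx), ?_⟩
      rw [mem_ball_iff_norm] at hx ⊢
      have := norm_sub_le_norm_sub_add_norm_sub x x₁ z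
      linarith
    have hWo : IsOpen W := hΩ.inter Metric.isOpen_ball
    have hWi : W ⊆ subdomain Ω Ω₀ i := by
      refine IsPreconnected.subset_subdomain hWc.isPreconnected hΩ₀ inter_subset_left ?_
        ⟨x₁, hbW (Metric.mem_ball_self hr), hball (Metric.mem_ball_self hr)⟩
      refine eq_empty_of_forall_notMem fun x hx => ?_
      exact absurd (mem_ball_iff_norm.1 hx.1.2) (not_lt.2 (hc x hx.2))
    have hsees : ∀ x ∈ closure Ω ∩ Metric.ball z (3 * h), Sees W x₁ r x := by
      intro x hx y hy t ht
      have hy' := hbW hy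
      refine ⟨?_, (convex_ball z (3 * h)).add_smul_sub_mem hx.2 hy'.2 ⟨ht.1.le, ht.2⟩⟩
      have := hΩc.add_smul_sub_mem_interior' hx.1 (by rw [hΩ.interior_eq]; exact hy'.1) ht
      rwa [hΩ.interior_eq] at this
    have h9 : ∀ x ∈ Metric.ball z (3 * h), x ∈ Metric.ball x₁ (9 * h) := by
      intro x hx
      rw [mem_ball_iff_norm] at hx ⊢
      have := norm_sub_le_norm_sub_add_norm_sub x z x₁
      rw [norm_sub_rev z x₁] at this
      linarith
    exact ⟨W, x₁, ⟨hWo, hr, fun x hx => h9 x hx.2, hbW, fun x hx => hsees x ⟨subset_closure hx.1, hx.2⟩⟩,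
      hWi, fun x hx => ⟨subdomain_subset hsub i hx.1, hx.2⟩,
      fun x hx => ⟨hsees x ⟨closedRegion_subset hsub i hx.1, hx.2⟩, h9 x hx.2⟩⟩

end Patch

/-! ### Simplices -/

section Simplex

variable {d : ℕ} {K : Finset (E d)} {lam : E d → E d → ℝ}

/-- `lam z` are the barycentric coordinates of the nondegenerate simplex `K`. -/
structure IsBary (K : Finset (E d)) (lam : E d → E d → ℝ) : Prop where
  affine : ∀ z ∈ K, ∃ (a : E d) (c : ℝ), ∀ x, lam z x = inner ℝ a x + c
  sum_one : ∀ x, ∑ z ∈ K, lam z x = 1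
  sum_smul : ∀ x, ∑ z ∈ K, lam z x • z = x
  vertex : ∀ z ∈ K, ∀ y ∈ K, lam z y = if y = z then 1 else 0
  mem_hull : ∀ x, x ∈ hull K ↔ ∀ z ∈ K, 0 ≤ lam z x

theorem exists_isBary (hK : AffineIndependent ℝ ((↑) : K → E d)) (hc : K.card = d + 1) :
    ∃ lam, IsBary K lam := by
  classical
  have htop : affineSpan ℝ (range ((↑) : K → E d)) = ⊤ := by
    rw [hK.affineSpan_eq_top_iff_card_eq_finrank_add_one]
    simp [hc]
  let B : AffineBasis K ℝ (E d) := ⟨(↑), hK, htop⟩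
  have hB : ∀ z : K, B z = z := fun _ => rfl
  refine ⟨fun z x => if h : z ∈ K then B.coord ⟨z, h⟩ x else 0, ?_, ?_, ?_, ?_, ?_⟩
  · intro z hz
    let f := B.coord ⟨z, hz⟩
    refine ⟨(InnerProductSpace.toDual ℝ (E d)).symm f.linear.toContinuousLinearMap, f 0, fun x => ?_⟩
    rw [InnerProductSpace.toDual_symm_apply, dif_pos hz]
    exact congrFun f.decomp x
  · intro x
    rw [← Finset.sum_coe_sort]
    simpa using B.sum_coord_apply_eq_one x
  · intro x
    rw [← Finset.sum_coe_sort]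
    simpa [hB] using B.linear_combination_coord_eq_self x
  · intro z hz y hy
    rw [dif_pos hz, show y = B ⟨y, hy⟩ from rfl, B.coord_apply]
    simp only [hB, Subtype.mk.injEq, eq_comm]
  · intro x
    have h := B.convexHull_eq_nonneg_coord
    have hr : range B = (K : Set (E d)) := by
      ext y
      constructor
      · rintro ⟨z, rfl⟩
        exact z.2
      · exact fun hy => ⟨⟨y, hy⟩, rfl⟩
    rw [hr] at h
    rw [hull, h]
    constructor
    · intro hx z hz
      rw [dif_pos hz]
      exact hx ⟨z, hz⟩
    · intro hx z
      have := hx z z.2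
      rwa [dif_pos z.2] at this

theorem convex_hull (s : Finset (E d)) : Convex ℝ (hull s) := convex_convexHull ℝ _

theorem isCompact_hull (s : Finset (E d)) : IsCompact (hull s) :=
  s.finite_toSet.isCompact_convexHull ℝ

theorem subset_hull {s : Finset (E d)} {x : E d} (hx : x ∈ s) : x ∈ hull s :=
  subset_convexHull ℝ _ hx

theorem hull_mono {s t : Finset (E d)} (h : s ⊆ t) : hull s ⊆ hull t :=
  convexHull_mono (Finset.coe_subset.2 h)

theorem norm_sub_le_diam {s : Finset (E d)} {x y : E d} (hx : x ∈ hull s) (hy : y ∈ hull s) :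
    ‖x - y‖ ≤ diam s := by
  rw [← dist_eq_norm]
  exact Metric.dist_le_diam_of_mem (isCompact_hull s).isBounded hx hy

theorem diam_mono {s t : Finset (E d)} (h : s ⊆ t) : diam s ≤ diam t :=
  Metric.diam_mono (hull_mono h) (isCompact_hull t).isBounded

theorem isOpen_cell (K : Finset (E d)) : IsOpen (cell K) := isOpen_interior

theorem cell_subset_hull (K : Finset (E d)) : cell K ⊆ hull K := interior_subset

theorem convex_cell (K : Finset (E d)) : Convex ℝ (cell K) := (convex_hull K).interior

theorem hull_subset_closure_cell (h : (cell K).Nonempty) : hull K ⊆ closure (cell K) := by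
  rw [cell, (convex_hull K).closure_interior_eq_closure_of_nonempty_interior h]
  exact subset_closure

theorem IsBary.convex_comb (h : IsBary K lam) {z : E d} (hz : z ∈ K) {x y : E d} {a b : ℝ}
    (hab : a + b = 1) : lam z (a • x + b • y) = a * lam z x + b * lam z y := by
  obtain ⟨v, c, e⟩ := h.affine z hz
  rw [e, e, e, inner_add_right, inner_smul_right, inner_smul_right]
  linear_combination -c * hab

/-- Both coordinates are affine and agree at the shared vertices, hence on their convex hull. -/
theorem IsBary.eqOn_hull_inter [DecidableEq (E d)] {K' : Finset (E d)} {lam' : E d → E d → ℝ}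
    (h : IsBary K lam) (h' : IsBary K' lam') {z : E d} (hz : z ∈ K ∩ K') {x : E d}
    (hx : x ∈ hull (K ∩ K')) : lam z x = lam' z x := by
  have hz' := Finset.mem_inter.1 hz
  have hconv : Convex ℝ {x | lam z x = lam' z x} := by
    intro x hx y hy a b _ _ hab
    simp only [mem_ofPred_eq] at hx hy ⊢
    rw [h.convex_comb hz'.1 hab, h'.convex_comb hz'.2 hab, hx, hy]
  refine convexHull_min (fun y hy => ?_) hconv hx
  have hy' := Finset.mem_inter.1 (Finset.mem_coe.1 hy)
  simp only [mem_ofPred_eq]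
  rw [h.vertex z hz'.1 y hy'.1, h'.vertex z hz'.2 y hy'.2]

theorem IsBary.eq_zero_of_mem_hull (h : IsBary K lam) {s : Finset (E d)} (hs : s ⊆ K) {z : E d}
    (hz : z ∈ K) (hzs : z ∉ s) {x : E d} (hx : x ∈ hull s) : lam z x = 0 := by
  have hconv : Convex ℝ {x | lam z x = 0} := by
    intro x hx y hy a b _ _ hab
    simp only [mem_ofPred_eq] at hx hy ⊢
    rw [h.convex_comb hz hab, hx, hy]
    ring
  refine convexHull_min (fun y hy => ?_) hconv hx
  simp only [mem_ofPred_eq]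
  rw [h.vertex z hz y (hs hy), if_neg]
  rintro rfl
  exact hzs hy

theorem IsBary.le_one (h : IsBary K lam) {z : E d} (hz : z ∈ K) {x : E d} (hx : x ∈ hull K) :
    lam z x ≤ 1 := by
  rw [← h.sum_one x]
  exact Finset.single_le_sum (fun y hy => (h.mem_hull x).1 hx y hy) hz

/-- Two vertices of a simplex have at least the distance of the diameter of each inscribed ball. -/
theorem IsBary.two_mul_le_norm_sub (h : IsBary K lam) {p q : E d} (hp : p ∈ K) (hq : q ∈ K)
    (hpq : p ≠ q) {x₁ : E d} {r : ℝ} (hr : 0 ≤ r) (hball : Metric.closedBall x₁ r ⊆ hull K) :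
    2 * r ≤ ‖p - q‖ := by
  have hpos : 0 < ‖p - q‖ := norm_pos_iff.2 (sub_ne_zero.2 hpq)
  obtain ⟨v, c, e⟩ := h.affine p hp
  have h1 : inner ℝ v (p - q) = 1 := by
    have h2 := h.vertex p hp p hp
    have h3 := h.vertex p hp q hq
    rw [if_neg hpq.symm] at h3
    rw [if_pos rfl] at h2
    rw [e] at h2 h3
    rw [inner_sub_right]
    linarith
  set w := (r / ‖p - q‖) • (p - q) with hw
  have hwn : ‖w‖ ≤ r := by
    rw [hw, norm_smul, Real.norm_of_nonneg (by positivity), div_mul_cancel₀ _ hpos.ne']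
  have m1 : x₁ + w ∈ hull K := hball (by simpa [mem_closedBall_iff_norm] using hwn)
  have m2 : x₁ - w ∈ hull K := hball (by
    rw [mem_closedBall_iff_norm, sub_sub_cancel_left, norm_neg]; exact hwn)
  have h4 := h.le_one hp m1
  have h5 := (h.mem_hull _).1 m2 p hp
  have h6 : inner ℝ v w = r / ‖p - q‖ := by rw [hw, inner_smul_right, h1, mul_one]
  rw [e, inner_add_right, h6] at h4
  rw [e, inner_sub_right, h6] at h5
  have h7 : 2 * (r / ‖p - q‖) ≤ 1 := by linarith
  rw [mul_div_assoc', div_le_one hpos] at h7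
  exact h7

/-- The coordinate of the opposite vertex vanishes on the face and is nonnegative on the simplex, so
its negative normalized gradient is the outward normal. -/
theorem exists_isOutwardNormal (hd : 1 ≤ d) (h : IsBary K lam) (hc : K.card = d + 1) {e : Finset (E d)}
    (he : e ⊆ K) (hec : e.card = d) : ∃ n, IsOutwardNormal K e n := by
  classical
  obtain ⟨v, hv⟩ : ∃ v, K \ e = {v} := by
    rw [← Finset.card_eq_one, Finset.card_sdiff_of_subset he, hc, hec]
    omega
  have hvK : v ∈ K ∧ v ∉ e := by
    have : v ∈ K \ e := by simp [hv]
    simpa using this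
  obtain ⟨a, c, ha⟩ := h.affine v hvK.1
  have hz : ∀ x ∈ e, lam v x = 0 := fun x hx => by
    rw [h.vertex v hvK.1 x (he hx), if_neg]
    rintro rfl
    exact hvK.2 hx
  obtain ⟨x₀, hx₀⟩ : e.Nonempty := Finset.card_pos.1 (by omega)
  have ha0 : a ≠ 0 := by
    intro ha0
    have h1 := hz x₀ hx₀
    have h2 := h.vertex v hvK.1 v hvK.1
    rw [ha, ha0, inner_zero_left] at h1 h2
    rw [if_pos rfl] at h2
    linarith
  have han : 0 < ‖a‖ := norm_pos_iff.2 ha0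
  refine ⟨-(‖a‖⁻¹ • a), ?_, fun x hx y hy => ?_, fun x hx z hzK => ?_⟩
  · rw [norm_neg, norm_smul, norm_inv, norm_norm, inv_mul_cancel₀ han.ne']
  · have h1 := hz x hx
    have h2 := hz y hy
    rw [ha] at h1 h2
    rw [inner_neg_left, inner_smul_left, inner_sub_right]
    have : inner ℝ a y - inner ℝ a x = 0 := by linarith
    rw [this]; simp
  · have h1 := hz x hx
    have h2 := (h.mem_hull z).1 (subset_hull hzK) v hvK.1
    rw [ha] at h1 h2
    rw [inner_neg_left, inner_smul_left, inner_sub_right, RCLike.conj_to_real]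
    have : 0 ≤ inner ℝ a z - inner ℝ a x := by linarith
    have := mul_nonneg (inv_nonneg.2 han.le) this
    linarith

end Simplex

/-! ### Meshes -/

section Mesh

variable {d : ℕ} {Ω Ω₀ : Set (E d)}

theorem IsConvexPolytopalDomain.isOpen (h : IsConvexPolytopalDomain Ω) : IsOpen Ω := by
  obtain ⟨-, P, rfl⟩ := h
  exact isOpen_interior

theorem IsConvexPolytopalDomain.convex (h : IsConvexPolytopalDomain Ω) : Convex ℝ Ω := by
  obtain ⟨-, P, rfl⟩ := h
  exact (convex_hull P).interior

theorem IsConvexPolytopalDomain.isBounded (h : IsConvexPolytopalDomain Ω) : Bornology.IsBounded Ω := by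
  obtain ⟨-, P, rfl⟩ := h
  exact (isCompact_hull P).isBounded.subset interior_subset

theorem IsConvexPolytopalDomain.interior_closure (h : IsConvexPolytopalDomain Ω) :
    interior (closure Ω) = Ω := by
  have ho := h.isOpen.interior_eq
  rw [h.convex.interior_closure_eq_interior_of_nonempty_interior (by rw [ho]; exact h.1), ho]

namespace Mesh

variable {𝒯 : Mesh Ω} {K e : Finset (E d)}

theorem mem_elements : K ∈ 𝒯.elements ↔ K ∈ 𝒯.complex.faces ∧ K.card = d + 1 := by
  simp [elements]

theorem mem_facets : e ∈ 𝒯.facets ↔ e ∈ 𝒯.complex.faces ∧ e.card = d := by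
  simp [facets]

theorem mem_neighbours : K ∈ 𝒯.neighbours e ↔ K ∈ 𝒯.elements ∧ e ⊆ K := by
  simp [neighbours]

theorem mem_inner {i : Fin 2} : K ∈ 𝒯.inner Ω₀ i ↔ K ∈ 𝒯.elements ∧ cell K ⊆ subdomain Ω Ω₀ i := by
  simp [inner]

theorem mem_cut : K ∈ 𝒯.cut Ω₀ ↔ K ∈ 𝒯.elements ∧ (cell K ∩ frontier Ω₀).Nonempty := by
  simp [cut]

theorem exists_isBary (hK : K ∈ 𝒯.elements) : ∃ lam, IsBary K lam :=
  UnfittedFEM.exists_isBary (𝒯.complex.indep (mem_elements.1 hK).1) (mem_elements.1 hK).2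

theorem hull_subset (hK : K ∈ 𝒯.elements) : hull K ⊆ closure Ω := by
  rw [← 𝒯.space_eq]
  exact 𝒯.complex.convexHull_subset_space (mem_elements.1 hK).1

theorem cell_subset (hΩ : IsConvexPolytopalDomain Ω) (hK : K ∈ 𝒯.elements) : cell K ⊆ Ω := by
  rw [← hΩ.interior_closure]
  exact interior_mono (hull_subset hK)

theorem diam_le_size (hK : K ∈ 𝒯.elements) : diam K ≤ 𝒯.size :=
  le_csSup ((𝒯.elements.finite_toSet.image diam).bddAbove) ⟨K, hK, rfl⟩

theorem exists_ne_of_mem_elements (hd : 1 ≤ d) (hK : K ∈ 𝒯.elements) : ∃ p ∈ K, ∃ q ∈ K, p ≠ q :=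
  Finset.one_lt_card.1 (by rw [(mem_elements.1 hK).2]; omega)

theorem size_pos (hd : 1 ≤ d) (hne : Ω.Nonempty) : 0 < 𝒯.size := by
  obtain ⟨x, hx⟩ := hne
  have hx' : x ∈ 𝒯.complex.space := by rw [𝒯.space_eq]; exact subset_closure hx
  obtain ⟨s, hs, -⟩ := 𝒯.complex.mem_space_iff.1 hx'
  obtain ⟨K, hK, -, hc⟩ := 𝒯.pure s hs
  have hKe : K ∈ 𝒯.elements := mem_elements.2 ⟨hK, hc⟩
  obtain ⟨p, hp, q, hq, hpq⟩ := exists_ne_of_mem_elements hd hKe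
  calc 0 < ‖p - q‖ := norm_pos_iff.2 (sub_ne_zero.2 hpq)
    _ ≤ diam K := norm_sub_le_diam (subset_hull hp) (subset_hull hq)
    _ ≤ _ := diam_le_size hKe

theorem exists_mem_elements (hne : Ω.Nonempty) : ∃ K, K ∈ 𝒯.elements := by
  obtain ⟨x, hx⟩ := hne
  have hx' : x ∈ 𝒯.complex.space := by rw [𝒯.space_eq]; exact subset_closure hx
  obtain ⟨s, hs, -⟩ := 𝒯.complex.mem_space_iff.1 hx'
  obtain ⟨K, hK, -, hc⟩ := 𝒯.pure s hs
  exact ⟨K, mem_elements.2 ⟨hK, hc⟩⟩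

theorem exists_closedBall_subset {σ : ℝ} (hd : 1 ≤ d) (hne : Ω.Nonempty) (hσ : 𝒯.IsQuasiUniform σ)
    (hK : K ∈ 𝒯.elements) :
    0 < σ ∧ ∃ x₁, Metric.closedBall x₁ (𝒯.size / (2 * σ)) ⊆ hull K := by
  have hs := size_pos (𝒯 := 𝒯) hd hne
  have h1 := hσ K hK
  obtain ⟨p, hp, -⟩ := exists_ne_of_mem_elements hd hK
  have h0 : (0 : ℝ) ∈ {r : ℝ | ∃ x, Metric.closedBall x r ⊆ hull K} :=
    ⟨p, by simpa using subset_hull hp⟩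
  -- For an unbounded set of radii the real supremum is zero by convention, so boundedness need not
  -- be settled.
  have hin : 0 ≤ inradius K := by
    by_cases hb : BddAbove {r : ℝ | ∃ x, Metric.closedBall x r ⊆ hull K}
    · exact le_csSup hb h0
    · rw [inradius, Real.sSup_of_not_bddAbove hb]
  have hσ0 : 0 < σ := by
    by_contra! hneg
    nlinarith
  refine ⟨hσ0, ?_⟩
  -- The factor two gives strict inequality below the supremum of the radii, so its attainment is
  -- not needed.
  have h2 : 𝒯.size / (2 * σ) < inradius K := by
    rw [div_lt_iff₀ (by positivity)]
    nlinarith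
  obtain ⟨r, ⟨x, hx⟩, hr⟩ := exists_lt_of_lt_csSup ⟨0, h0⟩ h2
  exact ⟨x, (Metric.closedBall_subset_closedBall hr.le).trans hx⟩

theorem cell_nonempty (hK : K ∈ 𝒯.elements) : (cell K).Nonempty := by
  rw [cell, hull, interior_convexHull_nonempty_iff_affineSpan_eq_top]
  have h1 := 𝒯.complex.indep (mem_elements.1 hK).1
  have h2 := h1.affineSpan_eq_top_iff_card_eq_finrank_add_one.2 (by simp [(mem_elements.1 hK).2])
  simpa using h2

/-- In a simplicial complex the closed simplices meet in the hull of their common vertices. That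
hull has interior points only if there are `d + 1` common vertices, and then the simplices coincide.
-/
theorem disjoint_cell {K' : Finset (E d)} (hK : K ∈ 𝒯.elements) (hK' : K' ∈ 𝒯.elements)
    (hne : K ≠ K') : Disjoint (cell K) (cell K') := by
  classical
  rw [Set.disjoint_iff_inter_eq_empty]
  by_contra hcon
  have h1 : (interior (convexHull ℝ ((K ∩ K' : Finset (E d)) : Set (E d)))).Nonempty := by
    refine (nonempty_iff_ne_empty.2 hcon).mono ?_
    rw [cell, cell, ← interior_inter]
    refine interior_mono ?_
    have := 𝒯.complex.inter_subset_convexHull (mem_elements.1 hK).1 (mem_elements.1 hK').1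
    rwa [← Finset.coe_inter] at this
  rw [interior_convexHull_nonempty_iff_affineSpan_eq_top] at h1
  have h2 : AffineIndependent ℝ ((↑) : (K ∩ K' : Finset (E d)) → E d) :=
    (𝒯.complex.indep (mem_elements.1 hK).1).mono (Finset.coe_subset.2 Finset.inter_subset_left)
  have h3 := h2.affineSpan_eq_top_iff_card_eq_finrank_add_one.1
    ((congrArg (affineSpan ℝ) Subtype.range_coe).trans h1)
  simp only [Fintype.card_coe, finrank_euclideanSpace_fin] at h3
  have e1 : K ∩ K' = K := Finset.eq_of_subset_of_card_le Finset.inter_subset_left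
    (by rw [h3, (mem_elements.1 hK).2])
  have e2 : K ∩ K' = K' := Finset.eq_of_subset_of_card_le Finset.inter_subset_right
    (by rw [h3, (mem_elements.1 hK').2])
  exact hne (e1.symm.trans e2)

/-- An open simplex is connected, so without interface points it lies entirely in one subdomain. -/
theorem mem_cut_or_mem_inner (hΩ : IsConvexPolytopalDomain Ω) (hΩ₀ : IsOpen Ω₀)
    (hK : K ∈ 𝒯.elements) : K ∈ 𝒯.cut Ω₀ ∨ ∃ i, K ∈ 𝒯.inner Ω₀ i := by
  by_cases hc : (cell K ∩ frontier Ω₀).Nonempty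
  · exact Or.inl (mem_cut.2 ⟨hK, hc⟩)
  · right
    rw [not_nonempty_iff_eq_empty] at hc
    obtain ⟨x, hx⟩ := cell_nonempty hK
    have hpre := (convex_cell K).isPreconnected
    have hsubd : ∀ i, x ∈ subdomain Ω Ω₀ i → K ∈ 𝒯.inner Ω₀ i := fun i hxi =>
      mem_inner.2 ⟨hK, IsPreconnected.subset_subdomain hpre hΩ₀ (cell_subset hΩ hK) hc ⟨x, hx, hxi⟩⟩
    by_cases hx0 : x ∈ Ω₀
    · exact ⟨0, hsubd 0 (by simpa [subdomain] using hx0)⟩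
    · refine ⟨1, hsubd 1 ?_⟩
      simp only [subdomain, one_ne_zero, if_false]
      refine ⟨cell_subset hΩ hK hx, fun hxc => ?_⟩
      have : x ∈ cell K ∩ frontier Ω₀ := ⟨hx, by rw [hΩ₀.frontier_eq]; exact ⟨hxc, hx0⟩⟩
      rw [hc] at this
      exact this

theorem ball_subset_cell {x₁ : E d} {r : ℝ} (h : Metric.closedBall x₁ r ⊆ hull K) :
    Metric.ball x₁ r ⊆ cell K :=
  interior_maximal (Metric.ball_subset_closedBall.trans h) Metric.isOpen_ball

/-- Elements with large inscribed balls in a common ball are not too many. -/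
theorem card_mul_pow_le {S : Finset (Finset (E d))} (hS : S ⊆ 𝒯.elements) {x : E d} {r L : ℝ}
    (hr : 0 < r) (hL : 0 < L) (h : ∀ K ∈ S, ∃ x₁, Metric.closedBall x₁ r ⊆ hull K ∧
      Metric.ball x₁ r ⊆ Metric.ball x L) : (S.card : ℝ) * r ^ d ≤ L ^ d := by
  choose! x₁ h1 h2 using h
  have hv := unitBallVol_pos d
  have hdisj : (S : Set (Finset (E d))).PairwiseDisjoint fun K => Metric.ball (x₁ K) r := by
    intro K hK K' hK' hne
    exact (disjoint_cell (hS hK) (hS hK') hne).mono (ball_subset_cell (h1 K hK))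
      (ball_subset_cell (h1 K' hK'))
  have h3 : ∑ K ∈ S, volume (Metric.ball (x₁ K) r) ≤ volume (Metric.ball x L) := by
    rw [← measure_biUnion_finset hdisj fun K _ => Metric.isOpen_ball.measurableSet]
    exact measure_mono (iUnion₂_subset h2)
  simp only [volume_ball_eq _ hr, volume_ball_eq _ hL, Finset.sum_const, nsmul_eq_mul] at h3
  rw [← ENNReal.ofReal_natCast, ← ENNReal.ofReal_mul (by positivity),
    ENNReal.ofReal_le_ofReal_iff (by positivity)] at h3
  nlinarith

theorem neighbours_nonempty (he : e ∈ 𝒯.facets) : (𝒯.neighbours e).Nonempty := by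
  obtain ⟨t, ht, hst, hc⟩ := 𝒯.pure e (mem_facets.1 he).1
  exact ⟨t, mem_neighbours.2 ⟨mem_elements.2 ⟨ht, hc⟩, hst⟩⟩

theorem two_mul_le_diam_of_mem_facets (hd : 2 ≤ d) (he : e ∈ 𝒯.facets) (hK : K ∈ 𝒯.elements)
    (heK : e ⊆ K) {x₁ : E d} {r : ℝ} (hr : 0 ≤ r) (hball : Metric.closedBall x₁ r ⊆ hull K) :
    2 * r ≤ diam e := by
  obtain ⟨lam, hlam⟩ := exists_isBary hK
  obtain ⟨p, hp, q, hq, hpq⟩ := Finset.one_lt_card.1 (by rw [(mem_facets.1 he).2]; omega)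
  exact (hlam.two_mul_le_norm_sub (heK hp) (heK hq) hpq hr hball).trans
    (norm_sub_le_diam (subset_hull hp) (subset_hull hq))

theorem two_mul_le_diam (hd : 1 ≤ d) (hK : K ∈ 𝒯.elements) {x₁ : E d} {r : ℝ} (hr : 0 ≤ r)
    (hball : Metric.closedBall x₁ r ⊆ hull K) : 2 * r ≤ diam K := by
  obtain ⟨lam, hlam⟩ := exists_isBary hK
  obtain ⟨p, hp, q, hq, hpq⟩ := exists_ne_of_mem_elements hd hK
  exact (hlam.two_mul_le_norm_sub hp hq hpq hr hball).trans
    (norm_sub_le_diam (subset_hull hp) (subset_hull hq))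

theorem isOutwardNormal_outwardNormal (hd : 1 ≤ d) (he : e ∈ 𝒯.facets) (hK : K ∈ 𝒯.elements)
    (heK : e ⊆ K) : IsOutwardNormal K e (outwardNormal K e) := by
  obtain ⟨lam, hlam⟩ := exists_isBary hK
  exact Classical.epsilon_spec (exists_isOutwardNormal hd hlam (mem_elements.1 hK).2 heK
    (mem_facets.1 he).2)

theorem isFlat_hull_facet (hd : 1 ≤ d) (he : e ∈ 𝒯.facets) (hK : K ∈ 𝒯.elements)
    (heK : e ⊆ K) : IsFlat (hull e) := by
  have h := isOutwardNormal_outwardNormal hd he hK heK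
  set n := outwardNormal K e
  obtain ⟨x₀, hx₀⟩ : e.Nonempty := Finset.card_pos.1 (by rw [(mem_facets.1 he).2]; omega)
  have key : ∀ x ∈ hull e, Inner.inner ℝ n (x - x₀) = 0 := by
    intro x hx
    have hconv : Convex ℝ {x : E d | Inner.inner ℝ n (x - x₀) = 0} := by
      intro x hx y hy a b _ _ hab
      simp only [mem_ofPred_eq] at hx hy ⊢
      have : a • x + b • y - x₀ = a • (x - x₀) + b • (y - x₀) := by
        have hx0 : x₀ = (a + b) • x₀ := by rw [hab, one_smul]
        conv_lhs => rw [hx0]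
        module
      rw [this, inner_add_right, inner_smul_right, inner_smul_right, hx, hy]
      simp
    exact convexHull_min (fun y hy => h.2.1 x₀ hx₀ y hy) hconv hx
  refine ⟨n, h.1, fun x hx y hy => ?_⟩
  have : Inner.inner ℝ n (x - y) = 0 := by
    rw [← sub_sub_sub_cancel_right x y x₀, inner_sub_right, key x hx, key y hy, sub_zero]
  rw [this, abs_zero]
  positivity

end Mesh

/-- Sums of `L²` norms on sets with finite overlap. -/
theorem sum_l2Sq_le_of_overlap {ι : Type*} {s : Finset ι} {V : ι → Set (E d)} {D : Set (E d)} {N : ℕ}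
    (hV : ∀ a ∈ s, MeasurableSet (V a)) (hVD : ∀ a ∈ s, V a ⊆ D)
    (hN : ∀ x, ∀ t ⊆ s, (∀ a ∈ t, x ∈ V a) → t.card ≤ N)
    {g : E d → ℝ} (hg : AEStronglyMeasurable g (volume.restrict D)) :
    ∑ a ∈ s, l2Sq volume (V a) g ≤ N * l2Sq volume D g := by
  classical
  have h1 : ∀ a ∈ s, l2Sq volume (V a) g = ∫⁻ x in D, (V a).indicator (fun x => ‖g x‖ₑ ^ 2) x := by
    intro a ha
    rw [lintegral_indicator (hV a ha), Measure.restrict_restrict (hV a ha),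
      inter_eq_left.2 (hVD a ha), l2Sq]
  rw [Finset.sum_congr rfl h1, ← lintegral_finsetSum' _ fun a ha =>
    (hg.enorm.pow_const 2).indicator (hV a ha), l2Sq, ← lintegral_const_mul' _ _ (by simp)]
  refine lintegral_mono fun x => ?_
  simp only [indicator_apply]
  rw [← Finset.sum_filter, Finset.sum_const, nsmul_eq_mul]
  refine mul_le_mul' ?_ le_rfl
  exact_mod_cast hN x _ (Finset.filter_subset _ _) fun a ha => (Finset.mem_filter.1 ha).2

end Mesh

/-! ### A quasi-interpolant -/

section FE

variable {d : ℕ}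

/-- The extrapolation to the vertex `z` of the polynomial that belongs to `z`. -/
noncomputable def vertexPoly (m : ℕ) (z : E d) (q : E d → ℝ) : E d → ℝ :=
  fun x => q x + (m : ℝ)⁻¹ * ∑ k, (z k - x k) * pd k q x

/-- The finite element function on the simplex `K` that belongs to the polynomials `P z`. -/
noncomputable def fePoly (m : ℕ) (K : Finset (E d)) (lam P : E d → E d → ℝ) : E d → ℝ :=
  fun x => ∑ z ∈ K, lam z x * vertexPoly m z (P z) x

theorem IsBary.isPoly {K : Finset (E d)} {lam : E d → E d → ℝ} (h : IsBary K lam) {z : E d}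
    (hz : z ∈ K) : IsPoly 1 (lam z) := by
  obtain ⟨a, c, e⟩ := h.affine z hz
  have : lam z = fun x => ∑ k, a k * x k + c := by
    ext x
    rw [e, PiLp.inner_apply]
    simp [mul_comm]
  rw [this]
  exact (IsPoly.sum _ fun k _ => (isPoly_coord k).const_mul _).add (isPoly_const 1 c)

/-- The extrapolation has degree `m - 1` by Euler's identity, which leaves room for one factor of
degree one. -/
theorem isPoly_fePoly {m : ℕ} (hm : 1 ≤ m) {K : Finset (E d)} {lam P : E d → E d → ℝ}
    (h : IsBary K lam) (hP : ∀ z, IsPoly m (P z)) : IsPoly m (fePoly m K lam P) := by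
  refine IsPoly.sum _ fun z hz => ?_
  have := (h.isPoly hz).mul ((hP z).add_euler hm z)
  rwa [Nat.add_sub_cancel' hm] at this

theorem vertexPoly_sub {m : ℕ} (z : E d) {p q : E d → ℝ} (hp : ContDiff ℝ ∞ p)
    (hq : ContDiff ℝ ∞ q) (x : E d) :
    vertexPoly m z p x - vertexPoly m z q x = vertexPoly m z (fun x => p x - q x) x := by
  simp only [vertexPoly, pd_sub _ hp hq, mul_sub, Finset.sum_sub_distrib]
  ring

/-- If all vertices carry the same polynomial, the corrections cancel, because `∑ λ_z (z - x) = 0`.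
-/
theorem IsBary.sum_mul_vertexPoly {m : ℕ} {K : Finset (E d)} {lam : E d → E d → ℝ}
    (h : IsBary K lam) (q : E d → ℝ) (x : E d) : ∑ z ∈ K, lam z x * vertexPoly m z q x = q x := by
  have h1 : ∀ k, ∑ z ∈ K, lam z x * (z k - x k) = 0 := fun k => by
    have h2 := congrArg (fun v : E d => v k) (h.sum_smul x)
    simp only [WithLp.ofLp_sum, Finset.sum_apply, PiLp.smul_apply, smul_eq_mul] at h2
    simp only [mul_sub, Finset.sum_sub_distrib, h2, ← Finset.sum_mul, h.sum_one, one_mul, sub_self]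
  have h2 : ∀ z, lam z x * vertexPoly m z q x = lam z x * q x +
      (m : ℝ)⁻¹ * ∑ k, (lam z x * (z k - x k)) * pd k q x := fun z => by
    simp only [vertexPoly, mul_add, Finset.mul_sum]
    congr 1
    exact Finset.sum_congr rfl fun k _ => by ring
  simp only [h2, Finset.sum_add_distrib, ← Finset.mul_sum, ← Finset.sum_mul, h.sum_one, one_mul]
  rw [Finset.sum_comm]
  simp only [← Finset.sum_mul, h1]
  simp

theorem enorm_vertexPoly_sq_le {m : ℕ} (hm : 1 ≤ m) {z x : E d} {h : ℝ} (hzx : ‖z - x‖ ≤ h)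
    (q : E d → ℝ) : ‖vertexPoly m z q x‖ₑ ^ 2 ≤
      2 * ‖q x‖ₑ ^ 2 + 2 * (ENNReal.ofReal (d * h ^ 2) * ∑ k, ‖pd k q x‖ₑ ^ 2) := by
  have hh : 0 ≤ h := (norm_nonneg _).trans hzx
  refine (enorm_add_sq_le _ _).trans (add_le_add le_rfl (mul_le_mul' le_rfl ?_))
  have h1 : ‖(m : ℝ)⁻¹ * ∑ k, (z k - x k) * pd k q x‖ₑ ≤ ENNReal.ofReal h * ∑ k, ‖pd k q x‖ₑ := by
    rw [enorm_mul]
    have h2 : ‖(m : ℝ)⁻¹‖ₑ ≤ 1 := by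
      rw [← ofReal_norm, ENNReal.ofReal_le_one, norm_inv, Real.norm_natCast]
      exact inv_le_one_of_one_le₀ (by exact_mod_cast hm)
    refine (mul_le_mul' h2 (enorm_sum_le _ _)).trans ?_
    rw [one_mul, Finset.mul_sum]
    refine Finset.sum_le_sum fun k _ => ?_
    rw [enorm_mul]
    refine mul_le_mul' ?_ le_rfl
    have := enorm_apply_le (z - x) k
    rw [PiLp.sub_apply] at this
    refine this.trans ?_
    rw [← ofReal_norm]
    exact ENNReal.ofReal_le_ofReal hzx
  calc _ ≤ (ENNReal.ofReal h * ∑ k, ‖pd k q x‖ₑ) ^ 2 := pow_le_pow_left' h1 2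
    _ ≤ ENNReal.ofReal h ^ 2 * (d * ∑ k, ‖pd k q x‖ₑ ^ 2) := by
      rw [mul_pow]
      refine mul_le_mul' le_rfl ((sq_sum_enorm_le _).trans (by simp))
    _ = _ := by
      rw [ENNReal.ofReal_mul (by positivity), ENNReal.ofReal_pow hh]
      simp
      ring

theorem l2Sq_vertexPoly_le {m : ℕ} (hm : 1 ≤ m) {z : E d} {h : ℝ} {S : Set (E d)}
    (hS : MeasurableSet S) (hzx : ∀ x ∈ S, ‖z - x‖ ≤ h) {q : E d → ℝ} (hq : ContDiff ℝ ∞ q) :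
    l2Sq volume S (vertexPoly m z q) ≤
      2 * l2Sq volume S q + 2 * (ENNReal.ofReal (d * h ^ 2) * ∑ k, l2Sq volume S (pd k q)) := by
  have hmq : Measurable fun x => ‖q x‖ₑ ^ 2 := hq.continuous.measurable.enorm.pow_const 2
  have hmk : ∀ k, Measurable fun x => ‖pd k q x‖ₑ ^ 2 := fun k =>
    (contDiff_pd hq k).continuous.measurable.enorm.pow_const 2
  calc _ ≤ ∫⁻ x in S, (2 * ‖q x‖ₑ ^ 2 + 2 * (ENNReal.ofReal (d * h ^ 2) * ∑ k, ‖pd k q x‖ₑ ^ 2)) :=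
        setLIntegral_mono' hS fun x hx => enorm_vertexPoly_sq_le hm (hzx x hx) q
    _ = _ := by
        rw [lintegral_add_left (hmq.const_mul 2), lintegral_const_mul' _ _ (by simp),
          lintegral_const_mul' _ _ (by simp), lintegral_const_mul' _ _ ENNReal.ofReal_ne_top,
          lintegral_finsetSum _ fun k _ => hmk k]
        rfl

theorem IsBary.l2Sq_sum_mul_le {K : Finset (E d)} {lam : E d → E d → ℝ}
    (hlam : IsBary K lam) {S : Set (E d)} (hS : MeasurableSet S) (hSK : S ⊆ hull K)
    {D : E d → E d → ℝ} (hD : ∀ z, Continuous (D z)) :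
    l2Sq volume S (fun x => ∑ z ∈ K, lam z x * D z x) ≤ K.card * ∑ z ∈ K, l2Sq volume S (D z) := by
  calc _ ≤ ∫⁻ x in S, (K.card : ℝ≥0∞) * ∑ z ∈ K, ‖D z x‖ₑ ^ 2 := by
        refine setLIntegral_mono' hS fun x hx => ?_
        have h1 : ‖∑ z ∈ K, lam z x * D z x‖ₑ ≤ ∑ z : K, ‖D z x‖ₑ := by
          refine (enorm_sum_le _ _).trans ?_
          rw [Finset.sum_coe_sort K fun z => ‖D z x‖ₑ]
          refine Finset.sum_le_sum fun z hz => ?_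
          rw [enorm_mul]
          refine mul_le_of_le_one_left bot_le ?_
          rw [Real.enorm_of_nonneg ((hlam.mem_hull x).1 (hSK hx) z hz), ENNReal.ofReal_le_one]
          exact hlam.le_one hz (hSK hx)
        refine (pow_le_pow_left' h1 2).trans ((sq_sum_enorm_le _).trans ?_)
        rw [Finset.sum_coe_sort K fun z => ‖D z x‖ₑ ^ 2]
        simp
    _ = _ := by
        rw [lintegral_const_mul' _ _ (by simp), lintegral_finsetSum _ fun z _ =>
          (hD z).measurable.enorm.pow_const 2]
        rfl

theorem continuous_vertexPoly (m : ℕ) (z : E d) {q : E d → ℝ} (hq : ContDiff ℝ ∞ q) :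
    Continuous (vertexPoly m z q) := by
  unfold vertexPoly
  refine hq.continuous.add (continuous_const.mul (continuous_finsetSum _ fun k _ => ?_))
  exact (continuous_const.sub (by fun_prop)).mul (contDiff_pd hq k).continuous

/-- The error of the finite element function, in terms of the errors of the local polynomials. -/
theorem exists_fePoly_error (d : ℕ) {m : ℕ} (hm : 1 ≤ m) (L τ : ℝ) : ∃ C : ℝ, 0 ≤ C ∧
    ∀ {K : Finset (E d)} {lam P : E d → E d → ℝ} {h r : ℝ} {x₁ : E d}, IsBary K lam →
    K.card = d + 1 → 0 < r → r ≤ h → h ≤ τ * r → Metric.closedBall x₁ r ⊆ hull K →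
    (∀ z ∈ K, ∀ x ∈ hull K, ‖z - x‖ ≤ h) → (∀ z, IsPoly m (P z)) →
    ∀ {W : E d → Set (E d)}, (∀ z ∈ K, Metric.ball x₁ r ⊆ W z) →
    ∀ {z₀ : E d}, z₀ ∈ K → W z₀ ⊆ Metric.ball x₁ (L * r) →
    ∀ {G : ∀ j : ℕ, (Fin j → Fin d) → E d → ℝ} {B : E d → ℝ≥0∞},
    (∀ j ≤ 2, ∀ i, AEStronglyMeasurable (G j i) (volume.restrict (W z₀))) →
    (∀ z ∈ K, ApproxOn (W z) G (P z) h (B z)) →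
    ApproxOn (W z₀) G (fePoly m K lam P) h (ENNReal.ofReal C * ∑ z ∈ K, B z) := by
  obtain ⟨C, hC0, hC⟩ := exists_inverse_estimate d m 2 L
  -- The factors are the number of vertices, the bound for one extrapolated difference, and the
  -- multiple of `∑ B z` that bounds `∑ (B z + B z₀)`.
  let c₁ : ℝ := (d + 1) * (4 * (1 + d ^ 2)) * (d + 2)
  have hc₁ : 0 ≤ c₁ := by positivity
  refine ⟨2 + 2 * (C * (max 1 τ) ^ 4 * c₁), by positivity,
    fun {K lam P h r x₁} hlam hcard hr hrh hτ hball hdiam hP {W} hW {z₀} hz₀ hWL {G B} hGm hA => ?_⟩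
  have hh : 0 < h := hr.trans_le hrh
  have hPs := fun z => (hP z).contDiff
  set S := Metric.ball x₁ r with hS
  have hSm : MeasurableSet S := Metric.isOpen_ball.measurableSet
  have hSK : S ⊆ hull K := Metric.ball_subset_closedBall.trans hball
  have hGS : ∀ j ≤ 2, ∀ i, AEStronglyMeasurable (G j i) (volume.restrict S) := fun j hj i =>
    (hGm j hj i).mono_measure (Measure.restrict_mono (hW z₀ hz₀) le_rfl)
  -- differences of the local polynomials
  have hdiff : ∀ z ∈ K, ∀ j ≤ 2, ∀ i : Fin j → Fin d,
      l2Sq volume S (pds i fun x => P z x - P z₀ x) ≤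
        ENNReal.ofReal (h ^ 2 / (h ^ 2) ^ j) * (2 * (B z + B z₀)) := by
    intro z hz j hj i
    have e : pds i (fun x => P z x - P z₀ x) =
        fun x => (G j i x - pds i (P z₀) x) - (G j i x - pds i (P z) x) := by
      rw [pds_sub i (hPs z) (hPs z₀)]
      ext x; ring
    rw [e]
    refine (l2Sq_sub_le ((hGS j hj i).sub
      (contDiff_pds i (hPs z₀)).continuous.aestronglyMeasurable)).trans ?_
    calc _ ≤ 2 * (ENNReal.ofReal (h ^ 2 / (h ^ 2) ^ j) * B z₀) +
          2 * (ENNReal.ofReal (h ^ 2 / (h ^ 2) ^ j) * B z) :=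
          add_le_add (mul_le_mul' le_rfl ((l2Sq_mono_set (hW z₀ hz₀) _).trans (hA z₀ hz₀ j hj i)))
            (mul_le_mul' le_rfl ((l2Sq_mono_set (hW z hz) _).trans (hA z hz j hj i)))
      _ = _ := by ring
  have hD : ∀ z ∈ K, l2Sq volume S (vertexPoly m z fun x => P z x - P z₀ x) ≤
      ENNReal.ofReal (4 * (1 + d ^ 2) * h ^ 2) * (B z + B z₀) := by
    intro z hz
    have h0 := hdiff z hz 0 (by norm_num) Fin.elim0
    have h1 : ∀ k, l2Sq volume S (pd k fun x => P z x - P z₀ x) ≤ 2 * (B z + B z₀) := fun k => by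
      have := hdiff z hz 1 (by norm_num) fun _ => k
      rw [pds_one, pow_one, div_self (by positivity)] at this
      simpa using this
    rw [pds_zero] at h0
    simp only [pow_zero, div_one] at h0
    refine (l2Sq_vertexPoly_le hm hSm (fun x hx => hdiam z hz x (hSK hx))
      ((hPs z).sub (hPs z₀))).trans ?_
    calc _ ≤ 2 * (ENNReal.ofReal (h ^ 2) * (2 * (B z + B z₀))) +
          2 * (ENNReal.ofReal (d * h ^ 2) * ∑ _k : Fin d, 2 * (B z + B z₀)) :=
          add_le_add (mul_le_mul' le_rfl h0) (mul_le_mul' le_rfl (mul_le_mul' le_rfl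
            (Finset.sum_le_sum fun k _ => h1 k)))
      _ = _ := by
          rw [Finset.sum_const, Finset.card_univ, Fintype.card_fin, nsmul_eq_mul,
            ENNReal.ofReal_mul (p := 4 * (1 + d ^ 2)) (by positivity),
            ENNReal.ofReal_mul (p := (4 : ℝ)) (by positivity),
            ENNReal.ofReal_add zero_le_one (by positivity), ENNReal.ofReal_pow (by positivity) (n := 2),
            ENNReal.ofReal_mul (p := (d : ℝ)) (by positivity), ENNReal.ofReal_pow hh.le]
          simp
          ring
  -- the correction
  set q : E d → ℝ := fun x => fePoly m K lam P x - P z₀ x with hq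
  have hqP : IsPoly m q := (isPoly_fePoly hm hlam hP).sub (hP z₀)
  -- Reproduction of `P z₀` turns the correction into a combination of differences of local
  -- polynomials. Each is small on the inscribed ball, where both polynomials approximate the same
  -- function.
  have hqe : q = fun x => ∑ z ∈ K, lam z x * vertexPoly m z (fun x => P z x - P z₀ x) x := by
    ext x
    rw [hq]
    simp only [← vertexPoly_sub _ (hPs _) (hPs z₀), mul_sub, Finset.sum_sub_distrib,
      hlam.sum_mul_vertexPoly, fePoly]
  have hsum : ∀ z ∈ K, B z ≤ ∑ z ∈ K, B z := fun z hz =>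
    Finset.single_le_sum (f := B) (fun _ _ => bot_le) hz
  have hqS : l2Sq volume S q ≤ ENNReal.ofReal (c₁ * h ^ 2) * ∑ z ∈ K, B z := by
    rw [hqe]
    refine (hlam.l2Sq_sum_mul_le hSm hSK fun z =>
      continuous_vertexPoly m z ((hPs z).sub (hPs z₀))).trans ?_
    calc _ ≤ (K.card : ℝ≥0∞) * ∑ z ∈ K, ENNReal.ofReal (4 * (1 + d ^ 2) * h ^ 2) * (B z + B z₀) :=
          mul_le_mul' le_rfl (Finset.sum_le_sum hD)
      _ = ENNReal.ofReal (d + 1) * (ENNReal.ofReal (4 * (1 + d ^ 2) * h ^ 2) *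
          (∑ z ∈ K, B z + (d + 1) * B z₀)) := by
          rw [← Finset.mul_sum, Finset.sum_add_distrib, Finset.sum_const, nsmul_eq_mul, hcard,
            ENNReal.ofReal_add (by positivity) zero_le_one]
          simp
      _ ≤ ENNReal.ofReal (d + 1) * (ENNReal.ofReal (4 * (1 + d ^ 2) * h ^ 2) *
          (∑ z ∈ K, B z + (d + 1) * ∑ z ∈ K, B z)) := by
          refine mul_le_mul' le_rfl (mul_le_mul' le_rfl (add_le_add le_rfl
            (mul_le_mul' le_rfl (hsum z₀ hz₀))))
      _ = ENNReal.ofReal (d + 1) * (ENNReal.ofReal (4 * (1 + d ^ 2) * h ^ 2) *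
          (ENNReal.ofReal (d + 2) * ∑ z ∈ K, B z)) := by
          rw [ENNReal.ofReal_add (by positivity) zero_le_two]
          simp
          ring
      _ = _ := by
          rw [← mul_assoc, ← mul_assoc, ← ENNReal.ofReal_mul (by positivity),
            ← ENNReal.ofReal_mul (by positivity)]
          congr 2
          simp only [c₁]
          ring
  intro j hj i
  have e : (fun x => G j i x - pds i (fePoly m K lam P) x) =
      fun x => (G j i x - pds i (P z₀) x) - pds i q x := by
    rw [hq, pds_sub i (isPoly_fePoly hm hlam hP).contDiff (hPs z₀)]
    ext x; ring
  rw [e]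
  refine (l2Sq_sub_le ((hGm j hj i).sub
    (contDiff_pds i (hPs z₀)).continuous.aestronglyMeasurable)).trans ?_
  -- The correction is a polynomial, so its size on the inscribed ball controls its derivatives on
  -- the larger ball that contains the patch.
  have h2 : l2Sq volume (W z₀) (pds i q) ≤
      ENNReal.ofReal (h ^ 2 / (h ^ 2) ^ j) * (ENNReal.ofReal (C * (max 1 τ) ^ 4 * c₁) * ∑ z ∈ K, B z) := by
    have h3 := hC q hqP x₁ r hr j hj i
    have h4 := (mul_le_mul' le_rfl (l2Sq_mono_set hWL (pds i q))).trans
      (h3.trans (mul_le_mul' le_rfl hqS))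
    rw [← mul_assoc, ← ENNReal.ofReal_mul hC0] at h4
    have h5 := ENNReal.le_ofReal_div_mul (by positivity) h4
    refine h5.trans ?_
    rw [← mul_assoc (ENNReal.ofReal (h ^ 2 / (h ^ 2) ^ j)), ← ENNReal.ofReal_mul (by positivity)]
    refine mul_le_mul' (ENNReal.ofReal_le_ofReal ?_) le_rfl
    -- The exponent four is `2 * j` for `j = 2`; the maximum with one makes it valid for smaller
    -- `j`.
    have h6 : (h ^ 2) ^ j ≤ max 1 τ ^ 4 * r ^ (2 * j) := by
      have hm1 : (1 : ℝ) ≤ max 1 τ := le_max_left _ _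
      have h7 : h ≤ max 1 τ * r := hτ.trans (mul_le_mul_of_nonneg_right (le_max_right _ _) hr.le)
      calc (h ^ 2) ^ j = h ^ (2 * j) := by rw [pow_mul]
        _ ≤ (max 1 τ * r) ^ (2 * j) := pow_le_pow_left₀ hh.le h7 _
        _ = max 1 τ ^ (2 * j) * r ^ (2 * j) := mul_pow _ _ _
        _ ≤ _ := by
          refine mul_le_mul_of_nonneg_right (pow_le_pow_right₀ hm1 (by omega)) (by positivity)
    rw [div_mul_eq_mul_div, div_le_div_iff₀ (by positivity) (by positivity)]
    have h8 : 0 ≤ C * (c₁ * h ^ 2) := by positivity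
    calc _ ≤ C * (c₁ * h ^ 2) * (max 1 τ ^ 4 * r ^ (2 * j)) := mul_le_mul_of_nonneg_left h6 h8
      _ = _ := by ring
  calc _ ≤ 2 * (ENNReal.ofReal (h ^ 2 / (h ^ 2) ^ j) * ∑ z ∈ K, B z) +
        2 * (ENNReal.ofReal (h ^ 2 / (h ^ 2) ^ j) *
          (ENNReal.ofReal (C * (max 1 τ) ^ 4 * c₁) * ∑ z ∈ K, B z)) := by
        refine add_le_add (mul_le_mul' le_rfl ((hA z₀ hz₀ j hj i).trans ?_)) (mul_le_mul' le_rfl h2)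
        exact mul_le_mul' le_rfl (hsum z₀ hz₀)
    _ = _ := by
        rw [ENNReal.ofReal_add (by norm_num) (by positivity), ENNReal.ofReal_mul (p := (2 : ℝ)) (by norm_num)]
        simp only [ENNReal.ofReal_ofNat]
        ring

end FE

/-! ### The finite element function -/

section FESpace

variable {d : ℕ} {Ω Ω₀ : Set (E d)} {𝒯 : Mesh Ω} {m : ℕ} {lam : Finset (E d) → E d → E d → ℝ}

theorem IsPoly.exists_eqPolyOn {f : E d → ℝ} (hf : IsPoly m f) {v : E d → ℝ} {S : Set (E d)}
    (h : EqOn v f S) : ∃ p : MvPolynomial (Fin d) ℝ, p.totalDegree ≤ m ∧ EqPolyOn v p S := by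
  obtain ⟨p, hp, e⟩ := hf
  exact ⟨p, hp, fun x hx => (h hx).trans (e x)⟩

/-- On the intersection the coordinates of unshared vertices vanish, and those of shared vertices
agree. The contribution of a vertex depends on no other data of the element; this is the continuity
of the finite element function. -/
theorem fePoly_eq_of_mem_hull {K K' : Finset (E d)} (hK : K ∈ 𝒯.elements) (hK' : K' ∈ 𝒯.elements)
    (h : IsBary K (lam K)) (h' : IsBary K' (lam K')) (P : E d → E d → ℝ) {x : E d}
    (hx : x ∈ hull K) (hx' : x ∈ hull K') :
    fePoly m K (lam K) P x = fePoly m K' (lam K') P x := by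
  classical
  have hmem : x ∈ hull (K ∩ K') := by
    have := 𝒯.complex.inter_subset_convexHull (Mesh.mem_elements.1 hK).1
      (Mesh.mem_elements.1 hK').1 ⟨hx, hx'⟩
    rwa [← Finset.coe_inter] at this
  have key : ∀ {L : Finset (E d)}, IsBary L (lam L) → K ∩ K' ⊆ L → fePoly m L (lam L) P x =
      ∑ z ∈ K ∩ K', lam L z x * vertexPoly m z (P z) x := fun hL hsub =>
    (Finset.sum_subset hsub fun z hz hzn => by
      rw [hL.eq_zero_of_mem_hull hsub hz hzn hmem, zero_mul]).symm
  rw [key h Finset.inter_subset_left, key h' Finset.inter_subset_right]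
  exact Finset.sum_congr rfl fun z hz => by rw [h.eqOn_hull_inter h' hz hmem]

theorem continuousOn_finset_biUnion {ι X Y : Type*} [TopologicalSpace X] [TopologicalSpace Y]
    {s : Finset ι} {F : ι → Set X} (hF : ∀ a ∈ s, IsClosed (F a)) {f : X → Y}
    (hf : ∀ a ∈ s, ContinuousOn f (F a)) : ContinuousOn f (⋃ a ∈ s, F a) := by
  classical
  induction s using Finset.induction_on with
  | empty => simp
  | insert a s ha ih =>
    rw [Finset.set_biUnion_insert]
    refine ContinuousOn.union_of_isClosed (hf a (by simp))
      (ih (fun b hb => hF b (by simp [hb])) fun b hb => hf b (by simp [hb])) (hF a (by simp)) ?_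
    exact isClosed_biUnion_finset fun b hb => hF b (by simp [hb])

theorem subdomain_disjoint {i j : Fin 2} {x : E d} (hi : x ∈ subdomain Ω Ω₀ i)
    (hj : x ∈ subdomain Ω Ω₀ j) : i = j := by
  unfold subdomain at hi hj
  split_ifs at hi hj with h1 h2 h2
  · rw [h1, h2]
  · exact absurd (subset_closure hi) hj.2
  · exact absurd (subset_closure hj) hi.2
  · omega

theorem notMem_frontier_of_mem_subdomain (hΩ₀ : IsOpen Ω₀) {i : Fin 2} {x : E d}
    (hi : x ∈ subdomain Ω Ω₀ i) : x ∉ frontier Ω₀ := by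
  rw [hΩ₀.frontier_eq]
  unfold subdomain at hi
  split_ifs at hi with h
  · exact fun hx => hx.2 hi
  · exact fun hx => hi.2 hx.1

/-- The finite element functions that belong to the polynomials `P i z` are in the space. -/
theorem exists_mem_extSpace (hΩ₀ : IsOpen Ω₀) (hm : 1 ≤ m)
    (hlam : ∀ K ∈ 𝒯.elements, IsBary K (lam K)) (κ : Fin 2 → SpaceKind)
    {A : Fin 2 → Finset (E d) → Finset (E d)} (hA : 𝒯.IsAssignment Ω₀ A)
    {P : Fin 2 → E d → E d → ℝ} (hP : ∀ i z, IsPoly m (P i z)) :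
    ∃ w ∈ extSpace 𝒯 Ω₀ m κ A, ∀ i,
      (∀ K ∈ 𝒯.inner Ω₀ i, EqOn w (fePoly m K (lam K) (P i)) (cell K)) ∧
      ∀ K ∈ 𝒯.cut Ω₀, EqOn w (fePoly m (A i K) (lam (A i K)) (P i)) (part Ω Ω₀ K i) := by
  classical
  -- Any inner element that contains `x` may be chosen, because the values agree on intersections.
  -- The continuous function serves both kinds of spaces.
  let v : Fin 2 → E d → ℝ := fun i x =>
    if h : ∃ K ∈ 𝒯.inner Ω₀ i, x ∈ hull K then fePoly m h.choose (lam h.choose) (P i) x else 0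
  have hv : ∀ i, ∀ K ∈ 𝒯.inner Ω₀ i, EqOn (v i) (fePoly m K (lam K) (P i)) (hull K) := by
    intro i K hK x hx
    have h : ∃ K ∈ 𝒯.inner Ω₀ i, x ∈ hull K := ⟨K, hK, hx⟩
    simp only [v]
    rw [dif_pos h]
    have h1 := (Mesh.mem_inner.1 h.choose_spec.1).1
    have h2 := (Mesh.mem_inner.1 hK).1
    exact fePoly_eq_of_mem_hull h1 h2 (hlam _ h1) (hlam _ h2) _ h.choose_spec.2 hx
  have hpoly : ∀ i, ∀ K ∈ 𝒯.elements, IsPoly m (fePoly m K (lam K) (P i)) := fun i K hK =>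
    isPoly_fePoly hm (hlam K hK) (hP i)
  -- `B i K` is the element whose polynomial is used on the part of `K` in subdomain `i`, and `ind`
  -- picks the subdomain of a point. The value of `ind` on the interface is irrelevant, since parts
  -- avoid it.
  let B : Fin 2 → Finset (E d) → Finset (E d) := fun i K => if K ∈ 𝒯.cut Ω₀ then A i K else K
  let ind : E d → Fin 2 := fun x => if x ∈ Ω₀ then 0 else 1
  have hind : ∀ i x, x ∈ subdomain Ω Ω₀ i → ind x = i := by
    intro i x hx
    simp only [ind]
    by_cases h1 : i = 0
    · rw [subdomain, if_pos h1] at hx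
      rw [if_pos hx, h1]
    · rw [subdomain, if_neg h1] at hx
      rw [if_neg fun h => hx.2 (subset_closure h)]
      omega
  let w : E d → ℝ := fun x => if h : ∃ K ∈ 𝒯.elements, x ∈ cell K then
    fePoly m (B (ind x) h.choose) (lam (B (ind x) h.choose)) (P (ind x)) x else 0
  have hw : ∀ K ∈ 𝒯.elements, ∀ i, ∀ x ∈ part Ω Ω₀ K i,
      w x = fePoly m (B i K) (lam (B i K)) (P i) x := by
    intro K hK i x hx
    have h : ∃ K ∈ 𝒯.elements, x ∈ cell K := ⟨K, hK, hx.1⟩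
    have hcK : h.choose = K := by
      by_contra hne
      exact Set.disjoint_left.1 (Mesh.disjoint_cell h.choose_spec.1 hK hne) h.choose_spec.2 hx.1
    simp only [w]
    rw [dif_pos h, hcK, hind i x hx.2]
  have hw1 : ∀ i, ∀ K ∈ 𝒯.inner Ω₀ i, EqOn w (fePoly m K (lam K) (P i)) (cell K) := by
    intro i K hK x hx
    obtain ⟨hKe, hKs⟩ := Mesh.mem_inner.1 hK
    have hcut : K ∉ 𝒯.cut Ω₀ := fun hc => by
      obtain ⟨-, y, hy, hyf⟩ := Mesh.mem_cut.1 hc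
      exact notMem_frontier_of_mem_subdomain hΩ₀ (hKs hy) hyf
    have := hw K hKe i x ⟨hx, hKs hx⟩
    rwa [show B i K = K from if_neg hcut] at this
  have hw2 : ∀ i, ∀ K ∈ 𝒯.cut Ω₀,
      EqOn w (fePoly m (A i K) (lam (A i K)) (P i)) (part Ω Ω₀ K i) := by
    intro i K hK x hx
    have := hw K (Mesh.mem_cut.1 hK).1 i x hx
    rwa [show B i K = A i K from if_pos hK] at this
  refine ⟨w, ⟨v, fun i => ⟨fun K hK => ?_, fun _ => ?_⟩, fun i K hK => ?_, fun i K hK => ?_⟩,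
    fun i => ⟨hw1 i, hw2 i⟩⟩
  · exact (hpoly i K (Mesh.mem_inner.1 hK).1).exists_eqPolyOn
      ((hv i K hK).mono (cell_subset_hull K))
  · refine continuousOn_finset_biUnion (fun K _ => (isCompact_hull K).isClosed) fun K hK => ?_
    exact ((hpoly i K (Mesh.mem_inner.1 hK).1).contDiff.continuous.continuousOn).congr (hv i K hK)
  · exact (hw1 i K hK).trans ((hv i K hK).mono (cell_subset_hull K)).symm
  · have hAK := (hA K hK i).2
    obtain ⟨p, hp, e⟩ := hpoly i _ (Mesh.mem_inner.1 hAK).1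
    refine ⟨p, hp, fun x hx => ?_, fun x hx => ?_⟩
    · exact (hv i _ hAK (cell_subset_hull _ hx)).trans (e x)
    · exact (hw2 i K hK hx).trans (e x)

end FESpace

/-! ### Bounds on one element -/

section LocalBounds

variable {d : ℕ} {Ω Ω₀ : Set (E d)} {𝒯 : Mesh Ω} {K : Finset (E d)} {i : Fin 2}

/-- Bounds for `w` on the part of `K` in subdomain `i` and for its traces on hypersurfaces. -/
structure LocalBounds (Ω Ω₀ : Set (E d)) (K : Finset (E d)) (i : Fin 2) (w : E d → ℝ) (c h : ℝ)
    (a : ℝ≥0∞) : Prop where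
  grad : gradSq (part Ω Ω₀ K i) w ≤ ENNReal.ofReal c * a
  trace : ∀ S, MeasurableSet S → IsFlat S → S ⊆ closedRegion Ω Ω₀ i → S ⊆ hull K →
    ∃ T, IsTrace (part Ω Ω₀ K i) S w T ∧ AEStronglyMeasurable T ((surf d).restrict S) ∧
      l2Sq (surf d) S T ≤ ENNReal.ofReal (c * h) * a
  gradTrace : ∀ S, MeasurableSet S → IsFlat S → S ⊆ closedRegion Ω Ω₀ i → S ⊆ hull K →
    ∃ T, IsGradTrace (part Ω Ω₀ K i) S w T ∧ AEStronglyMeasurable T ((surf d).restrict S) ∧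
      l2Sq (surf d) S T ≤ ENNReal.ofReal (c / h) * a

/-- The constant in the bounds on one element. -/
noncomputable def localConst (d : ℕ) (κ : ℝ) : ℝ := d + (1 + d) * (traceConst d (surfConst d) κ * (1 + d))

theorem traceConst_nonneg {M κ : ℝ} (hM : 0 ≤ M) (hκ : 0 ≤ κ) : 0 ≤ traceConst d M κ := by
  have hv := unitBallVol_pos d
  unfold traceConst
  positivity

theorem localConst_nonneg {κ : ℝ} (hκ : 0 ≤ κ) : 0 ≤ localConst d κ := by
  have := traceConst_nonneg (d := d) (surfConst_nonneg d) hκ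
  unfold localConst
  positivity

/-- The closed element is within reach `3h` of `z`, so its part in subdomain `i` lies in the patch,
and the patch sees all points of its faces and of its interface piece. -/
theorem IsPatch.localBounds (hd : 1 ≤ d) (hΩ : IsOpen Ω) (hΩ₀ : IsOpen Ω₀) {z b : E d} {h r κ : ℝ}
    {W : Set (E d)} (hW : IsPatch Ω Ω₀ i z h r W b) (hh : 0 < h) (hrh : r ≤ h) (hκ : 9 ≤ κ)
    (hκr : 9 * h ≤ κ * r) {N : ℕ} (hN : 2 ≤ N) {u p w : E d → ℝ}
    {G : ∀ j : ℕ, (Fin j → Fin d) → E d → ℝ} (hG : IsDerivFamily N W u G) (hp : ContDiff ℝ ∞ p)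
    {a : ℝ≥0∞} (ha : ApproxOn W G p h a) (hK : hull K ⊆ Metric.ball z (3 * h))
    (hw : EqOn w (fun x => u x - p x) (part Ω Ω₀ K i)) :
    LocalBounds Ω Ω₀ K i w (localConst d κ) h a := by
  have hD : MeasurableSet (part Ω Ω₀ K i) :=
    ((isOpen_cell K).inter (isOpen_subdomain hΩ hΩ₀ i)).measurableSet
  have hDW : part Ω Ω₀ K i ⊆ W := fun x hx => hW.superset ⟨hx.2, hK (cell_subset_hull K hx.1)⟩
  have htc := traceConst_nonneg (d := d) (M := surfConst d) (κ := κ) (surfConst_nonneg d) (by linarith)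
  have hsee : ∀ S : Set (E d), MeasurableSet S → S ⊆ closedRegion Ω Ω₀ i → S ⊆ hull K →
      ∀ᵐ x ∂((surf d).restrict S), Sees W b r x ∧ x ∈ Metric.ball b (9 * h) :=
    fun S hS h1 h2 => ae_restrict_of_forall_mem hS fun x hx => hW.sees x ⟨h1 hx, hK (h2 hx)⟩
  have h9 : 9 * h ≤ κ * h := mul_le_mul_of_nonneg_right hκ hh.le
  refine ⟨?_, fun S hS hf h1 h2 => ?_, fun S hS hf h1 h2 => ?_⟩
  · refine (gradSq_le_of_approxOn hW.star hG hN hp ha hh hD hDW hw).trans (mul_le_mul' ?_ le_rfl)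
    rw [← ENNReal.ofReal_natCast]
    refine ENNReal.ofReal_le_ofReal ?_
    unfold localConst
    have : 0 ≤ (1 + (d : ℝ)) * (traceConst d (surfConst d) κ * (1 + d)) := by positivity
    linarith
  · obtain ⟨T, hT, hm, hb⟩ := exists_isTrace_le hd hW.star (by linarith) (surfConst_nonneg d) hh
      (by linarith) h9 hκr (fun z s hs _ => hf.regular hd z hs) (hsee S hS h1 h2) hG hN hp ha hD hDW hw
    refine ⟨T, hT, hm.1, hb.trans (mul_le_mul' (ENNReal.ofReal_le_ofReal ?_) le_rfl)⟩
    refine mul_le_mul_of_nonneg_right ?_ hh.le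
    unfold localConst
    have : 0 ≤ (d : ℝ) * (traceConst d (surfConst d) κ * (1 + d)) := by positivity
    linarith [Nat.cast_nonneg (α := ℝ) d]
  · obtain ⟨T, hT, hm, hb⟩ := exists_isGradTrace_le hd hW.star (by linarith) (surfConst_nonneg d) hh
      (by linarith) h9 hκr (fun z s hs _ => hf.regular hd z hs) (hsee S hS h1 h2) hG hN hp ha hD hDW hw
    refine ⟨T, hT, hm, hb.trans (mul_le_mul' (ENNReal.ofReal_le_ofReal ?_) le_rfl)⟩
    refine div_le_div_of_nonneg_right ?_ hh.le
    unfold localConst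
    have : 0 ≤ (traceConst d (surfConst d) κ * (1 + d)) := by positivity
    linarith [Nat.cast_nonneg (α := ℝ) d]

theorem part_eq_empty {j : Fin 2} (hK : K ∈ 𝒯.inner Ω₀ j) (hij : i ≠ j) : part Ω Ω₀ K i = ∅ :=
  eq_empty_of_forall_notMem fun _ hx =>
    hij (subdomain_disjoint hx.2 ((Mesh.mem_inner.1 hK).2 hx.1))

/-- A point of the face is a limit of points of the open simplex. If it lay in the region of
subdomain `i`, nearby points of the simplex would lie in that subdomain. -/
theorem facePart_eq_empty (hΩ : IsConvexPolytopalDomain Ω) (hΩ₀ : IsOpen Ω₀) {e : Finset (E d)}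
    (hK : K ∈ 𝒯.elements) (heK : e ⊆ K) (h : part Ω Ω₀ K i = ∅) : facePart Ω Ω₀ e i = ∅ := by
  refine eq_empty_of_forall_notMem fun x hx => ?_
  have hx' := hull_subset_closure_cell (Mesh.cell_nonempty hK) (hull_mono heK hx.1)
  have key : ∀ U : Set (E d), IsOpen U → x ∈ U → (∀ y ∈ cell K, y ∈ U → y ∈ subdomain Ω Ω₀ i) →
      False := fun U hU hxU hs => by
    obtain ⟨y, hyU, hyK⟩ := mem_closure_iff.1 hx' U hU hxU
    exact notMem_empty y (h ▸ (⟨hyK, hs y hyK hyU⟩ : y ∈ part Ω Ω₀ K i))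
  have h2 := hx.2
  unfold faceRegion at h2
  unfold subdomain at key
  by_cases hi : i = 0
  · simp only [if_pos hi] at h2 key
    exact key _ hΩ₀ h2 fun y _ hy => hy
  · simp only [if_neg hi] at h2 key
    exact key _ isClosed_closure.isOpen_compl h2.2 fun y hyK hy => ⟨Mesh.cell_subset hΩ hK hyK, hy⟩

theorem measurableSet_facePart (hΩ₀ : IsOpen Ω₀) (e : Finset (E d)) (i : Fin 2) :
    MeasurableSet (facePart Ω Ω₀ e i) := by
  refine (isCompact_hull e).isClosed.measurableSet.inter ?_
  unfold faceRegion
  split_ifs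
  · exact hΩ₀.measurableSet
  · exact isClosed_closure.measurableSet.diff isClosed_closure.measurableSet

theorem measurableSet_interfacePart (K : Finset (E d)) : MeasurableSet (interfacePart Ω₀ K) :=
  (isOpen_cell K).measurableSet.inter isClosed_frontier.measurableSet

/-- The square of a sum of `L²` functions. -/
theorem l2Sq_le_card_mul_sum {F H ι : Type*} [NormedAddCommGroup F] [NormedAddCommGroup H]
    {μ : Measure (E d)} {S : Set (E d)} {s : Finset ι} {f : ι → E d → F} {g : E d → H}
    (hf : ∀ k ∈ s, AEStronglyMeasurable (f k) (μ.restrict S)) (hg : ∀ x, ‖g x‖ₑ ≤ ∑ k ∈ s, ‖f k x‖ₑ) :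
    l2Sq μ S g ≤ s.card * ∑ k ∈ s, l2Sq μ S (f k) := by
  unfold l2Sq
  rw [← lintegral_finsetSum' _ fun k hk => (hf k hk).enorm.pow_const 2,
    ← lintegral_const_mul' _ _ (by simp)]
  refine lintegral_mono fun x => ?_
  have h := sq_sum_enorm_le fun k : s => ‖f k x‖ₑ
  rw [Finset.sum_coe_sort s fun k => ‖f k x‖ₑ, Finset.sum_coe_sort s fun k => ‖f k x‖ₑ ^ 2,
    Fintype.card_coe] at h
  exact (pow_le_pow_left' (hg x) 2).trans h

end LocalBounds

/-! ### The energy norm -/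

section EnergyBound

variable {d : ℕ} {Ω Ω₀ : Set (E d)} {𝒯 : Mesh Ω} {K e : Finset (E d)} {i : Fin 2} {w : E d → ℝ}
  {c h : ℝ}

theorem gradSq_empty (w : E d → ℝ) : gradSq ∅ w = 0 := by
  exact le_antisymm ((iInf₂_le _ (hasWeakGrad_empty w)).trans (by simp [l2Sq])) bot_le

/-- The last alternative covers elements inside the other subdomain. They contribute nothing to the
terms with index `i`, so no polynomial is needed there. -/
theorem mem_inner_or_mem_cut_or_part_eq_empty (hΩ : IsConvexPolytopalDomain Ω) (hΩ₀ : IsOpen Ω₀)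
    (hK : K ∈ 𝒯.elements) (heK : e ⊆ K) (i : Fin 2) :
    (K ∈ 𝒯.inner Ω₀ i ∨ K ∈ 𝒯.cut Ω₀) ∨ part Ω Ω₀ K i = ∅ ∧ facePart Ω Ω₀ e i = ∅ := by
  rcases Mesh.mem_cut_or_mem_inner hΩ hΩ₀ hK with h | ⟨j, h⟩
  · exact Or.inl (Or.inr h)
  · by_cases hij : i = j
    · exact Or.inl (Or.inl (hij ▸ h))
    · exact Or.inr ⟨part_eq_empty h hij, facePart_eq_empty hΩ hΩ₀ hK heK (part_eq_empty h hij)⟩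

/-- Bounds for `w` on all parts of elements. -/
def BoundedOnParts (𝒯 : Mesh Ω) (Ω₀ : Set (E d)) (w : E d → ℝ) (c h : ℝ)
    (a : Fin 2 → Finset (E d) → ℝ≥0∞) : Prop :=
  ∀ i, ∀ K ∈ 𝒯.elements, (K ∈ 𝒯.inner Ω₀ i ∨ K ∈ 𝒯.cut Ω₀) → LocalBounds Ω Ω₀ K i w c h (a i K)

variable {a : Fin 2 → Finset (E d) → ℝ≥0∞}

theorem facePart_subset (heK : e ⊆ K) : facePart Ω Ω₀ e i ⊆ hull K :=
  inter_subset_left.trans (hull_mono heK)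

theorem BoundedOnParts.gradSq_le (hb : BoundedOnParts 𝒯 Ω₀ w c h a) (hΩ : IsConvexPolytopalDomain Ω)
    (hΩ₀ : IsOpen Ω₀) (hK : K ∈ 𝒯.elements) (i : Fin 2) :
    gradSq (part Ω Ω₀ K i) w ≤ ENNReal.ofReal c * a i K := by
  rcases mem_inner_or_mem_cut_or_part_eq_empty hΩ hΩ₀ hK subset_rfl i with h' | ⟨h', -⟩
  · exact (hb i K hK h').grad
  · rw [h', gradSq_empty]
    exact bot_le

theorem BoundedOnParts.exists_faceTrace (hb : BoundedOnParts 𝒯 Ω₀ w c h a)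
    (hΩ : IsConvexPolytopalDomain Ω) (hΩ₀ : IsOpen Ω₀) (hd : 1 ≤ d) (he : e ∈ 𝒯.facets)
    (hK : K ∈ 𝒯.elements) (heK : e ⊆ K) (i : Fin 2) :
    ∃ T, IsTrace (part Ω Ω₀ K i) (facePart Ω Ω₀ e i) w T ∧
      AEStronglyMeasurable T ((surf d).restrict (facePart Ω Ω₀ e i)) ∧
      l2Sq (surf d) (facePart Ω Ω₀ e i) T ≤ ENNReal.ofReal (c * h) * a i K := by
  rcases mem_inner_or_mem_cut_or_part_eq_empty hΩ hΩ₀ hK heK i with h' | ⟨h1, h2⟩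
  · exact (hb i K hK h').trace _ (measurableSet_facePart hΩ₀ e i)
      ((Mesh.isFlat_hull_facet hd he hK heK).mono inter_subset_left)
      (inter_subset_right.trans (faceRegion_subset i)) (facePart_subset heK)
  · rw [h1, h2]
    exact ⟨0, isTrace_empty _ _, aestronglyMeasurable_const, by simp [l2Sq]⟩

theorem BoundedOnParts.exists_faceGradTrace (hb : BoundedOnParts 𝒯 Ω₀ w c h a)
    (hΩ : IsConvexPolytopalDomain Ω) (hΩ₀ : IsOpen Ω₀) (hd : 1 ≤ d) (he : e ∈ 𝒯.facets)
    (hK : K ∈ 𝒯.elements) (heK : e ⊆ K) (i : Fin 2) :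
    ∃ T, IsGradTrace (part Ω Ω₀ K i) (facePart Ω Ω₀ e i) w T ∧
      AEStronglyMeasurable T ((surf d).restrict (facePart Ω Ω₀ e i)) ∧
      l2Sq (surf d) (facePart Ω Ω₀ e i) T ≤ ENNReal.ofReal (c / h) * a i K := by
  rcases mem_inner_or_mem_cut_or_part_eq_empty hΩ hΩ₀ hK heK i with h' | ⟨h1, h2⟩
  · exact (hb i K hK h').gradTrace _ (measurableSet_facePart hΩ₀ e i)
      ((Mesh.isFlat_hull_facet hd he hK heK).mono inter_subset_left)
      (inter_subset_right.trans (faceRegion_subset i)) (facePart_subset heK)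
  · rw [h1, h2]
    exact ⟨0, isGradTrace_empty _ _, aestronglyMeasurable_const, by simp [l2Sq]⟩

theorem BoundedOnParts.faceAverSq_le (hb : BoundedOnParts 𝒯 Ω₀ w c h a)
    (hΩ : IsConvexPolytopalDomain Ω) (hΩ₀ : IsOpen Ω₀) (hd : 1 ≤ d) (he : e ∈ 𝒯.facets) (i : Fin 2) :
    faceAverSq 𝒯 Ω₀ e i w ≤ (𝒯.neighbours e).card *
      ∑ K ∈ 𝒯.neighbours e, ENNReal.ofReal (c / h) * a i K := by
  have h1 := fun K (hK : K ∈ 𝒯.neighbours e) => hb.exists_faceGradTrace hΩ hΩ₀ hd he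
    (Mesh.mem_neighbours.1 hK).1 (Mesh.mem_neighbours.1 hK).2 i
  choose! T hT hm hle using h1
  refine (iInf₂_le T hT).trans ?_
  refine (l2Sq_le_card_mul_sum hm fun x => ?_).trans (mul_le_mul' le_rfl (Finset.sum_le_sum hle))
  have h2 : ‖((𝒯.neighbours e).card : ℝ)⁻¹‖ ≤ 1 := by
    rw [norm_inv, Real.norm_natCast]
    exact Nat.cast_inv_le_one _
  rw [enorm_smul]
  calc _ ≤ 1 * ‖∑ K ∈ 𝒯.neighbours e, T K x‖ₑ := by
        refine mul_le_mul' ?_ le_rfl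
        rw [← ofReal_norm, ← ENNReal.ofReal_one]
        exact ENNReal.ofReal_le_ofReal h2
    _ ≤ _ := by
        rw [one_mul]
        exact enorm_sum_le _ _

theorem BoundedOnParts.faceJumpSq_le (hb : BoundedOnParts 𝒯 Ω₀ w c h a)
    (hΩ : IsConvexPolytopalDomain Ω) (hΩ₀ : IsOpen Ω₀) (hd : 1 ≤ d) (he : e ∈ 𝒯.facets) (i : Fin 2) :
    faceJumpSq 𝒯 Ω₀ e i w ≤ (𝒯.neighbours e).card *
      ∑ K ∈ 𝒯.neighbours e, ENNReal.ofReal (c * h) * a i K := by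
  have h1 := fun K (hK : K ∈ 𝒯.neighbours e) => hb.exists_faceTrace hΩ hΩ₀ hd he
    (Mesh.mem_neighbours.1 hK).1 (Mesh.mem_neighbours.1 hK).2 i
  choose! T hT hm hle using h1
  refine (iInf₂_le T hT).trans ?_
  refine (l2Sq_le_card_mul_sum (f := T) hm fun x => ?_).trans
    (mul_le_mul' le_rfl (Finset.sum_le_sum hle))
  refine (enorm_sum_le _ _).trans (Finset.sum_le_sum fun K hK => ?_)
  obtain ⟨hKe, heK⟩ := Mesh.mem_neighbours.1 hK
  have hn := (Mesh.isOutwardNormal_outwardNormal hd he hKe heK).1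
  rw [enorm_smul, ← ofReal_norm (outwardNormal K e), hn, ENNReal.ofReal_one, mul_one]

theorem BoundedOnParts.interfaceAverSq_le (hb : BoundedOnParts 𝒯 Ω₀ w c h a) (hΩ₀ : IsOpen Ω₀)
    (hsub : closure Ω₀ ⊆ Ω) (hK : K ∈ 𝒯.cut Ω₀) (hf : IsFlat (interfacePart Ω₀ K)) :
    interfaceAverSq Ω Ω₀ K w ≤ 2 * ∑ i, ENNReal.ofReal (c / h) * a i K := by
  choose T hT hm hle using fun i => (hb i K (Mesh.mem_cut.1 hK).1 (Or.inr hK)).gradTrace _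
    (measurableSet_interfacePart K) hf
    (inter_subset_right.trans (frontier_subset_closedRegion hΩ₀ hsub i))
    (inter_subset_left.trans (cell_subset_hull K))
  refine (iInf₂_le T hT).trans ?_
  have := l2Sq_le_card_mul_sum (s := Finset.univ) (g := fun x => (1 / 2 : ℝ) • (T 0 x + T 1 x))
    (fun i _ => hm i) fun x => ?_
  · refine this.trans (mul_le_mul' (by simp) (Finset.sum_le_sum fun i _ => hle i))
  · rw [enorm_smul, Fin.sum_univ_two]
    calc _ ≤ 1 * ‖T 0 x + T 1 x‖ₑ := by
          refine mul_le_mul' ?_ le_rfl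
          rw [← ofReal_norm, ← ENNReal.ofReal_one]
          exact ENNReal.ofReal_le_ofReal (by norm_num)
      _ ≤ _ := by
          rw [one_mul]
          exact enorm_add_le _ _

theorem BoundedOnParts.interfaceJumpSq_le (hb : BoundedOnParts 𝒯 Ω₀ w c h a) (hΩ₀ : IsOpen Ω₀)
    (hsub : closure Ω₀ ⊆ Ω) (hK : K ∈ 𝒯.cut Ω₀) (hf : IsFlat (interfacePart Ω₀ K)) :
    interfaceJumpSq Ω Ω₀ K w ≤ 2 * ∑ i, ENNReal.ofReal (c * h) * a i K := by
  choose T hT hm hle using fun i => (hb i K (Mesh.mem_cut.1 hK).1 (Or.inr hK)).trace _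
    (measurableSet_interfacePart K) hf
    (inter_subset_right.trans (frontier_subset_closedRegion hΩ₀ hsub i))
    (inter_subset_left.trans (cell_subset_hull K))
  refine (iInf₂_le T hT).trans ?_
  have := l2Sq_le_card_mul_sum (s := Finset.univ) (g := fun x => T 0 x - T 1 x)
    (fun i _ => hm i) fun x => ?_
  · refine this.trans (mul_le_mul' (by simp) (Finset.sum_le_sum fun i _ => hle i))
  · rw [Fin.sum_univ_two]
    exact enorm_sub_le

/-- Each element is a neighbour of few faces. -/
theorem Mesh.sum_facets_sum_neighbours_le (𝒯 : Mesh Ω) (f : Finset (E d) → ℝ≥0∞) :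
    ∑ e ∈ 𝒯.facets, ∑ K ∈ 𝒯.neighbours e, f K ≤ 2 ^ (d + 1) * ∑ K ∈ 𝒯.elements, f K := by
  classical
  rw [Finset.sum_comm' (t' := 𝒯.elements) (s' := fun K => {e ∈ 𝒯.facets | e ⊆ K})
    fun e K => by rw [Finset.mem_filter, Mesh.mem_neighbours]; tauto, Finset.mul_sum]
  refine Finset.sum_le_sum fun K hK => ?_
  rw [Finset.sum_const, nsmul_eq_mul]
  refine mul_le_mul' ?_ le_rfl
  have : ({e ∈ 𝒯.facets | e ⊆ K} : Finset _).card ≤ 2 ^ (d + 1) := by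
    rw [← (Mesh.mem_elements.1 hK).2, ← Finset.card_powerset]
    exact Finset.card_le_card fun e he => Finset.mem_powerset.2 (Finset.mem_filter.1 he).2
  exact_mod_cast this

/-- The energy norm is bounded by the bounds on the parts of the elements. -/
theorem BoundedOnParts.energyNorm_sq_le {r σ ρ n : ℝ} (hb : BoundedOnParts 𝒯 Ω₀ w c h a)
    (hΩ : IsConvexPolytopalDomain Ω) (hΩ₀ : IsOpen Ω₀) (hsub : closure Ω₀ ⊆ Ω) (hd : 2 ≤ d)
    (hρ : IsInterfaceRadius Ω Ω₀ ρ) (hh : 0 < h) (hr : 0 < r) (hhr : h ≤ σ * r) (hhρ : h < ρ) (hc : 0 ≤ c) (hn0 : 0 ≤ n)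
    (hdiam : ∀ K ∈ 𝒯.elements, diam K ≤ h)
    (hball : ∀ K ∈ 𝒯.elements, ∃ x₁, Metric.closedBall x₁ r ⊆ hull K)
    (hn : ∀ e ∈ 𝒯.facets, ((𝒯.neighbours e).card : ℝ) ≤ n) :
    energyNorm 𝒯 Ω₀ w ^ 2 ≤ ENNReal.ofReal ((1 + 2 ^ (d + 1) * n + 2) * (c + c * σ)) *
      ∑ i, ∑ K ∈ 𝒯.elements, a i K := by
  classical
  have hσ : 0 < σ := pos_of_mul_pos_left (hh.trans_le hhr) hr.le
  have hd1 : 1 ≤ d := by omega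
  set S := ∑ i, ∑ K ∈ 𝒯.elements, a i K with hS
  have hde : ∀ e ∈ 𝒯.facets, diam e ≤ h ∧ (diam e)⁻¹ ≤ r⁻¹ := fun e he => by
    obtain ⟨K, hK⟩ := Mesh.neighbours_nonempty he
    obtain ⟨hKe, heK⟩ := Mesh.mem_neighbours.1 hK
    obtain ⟨x₁, hx₁⟩ := hball K hKe
    have := Mesh.two_mul_le_diam_of_mem_facets hd he hKe heK hr.le hx₁
    exact ⟨(diam_mono heK).trans (hdiam K hKe), inv_anti₀ hr (by linarith)⟩
  have hdK : ∀ K ∈ 𝒯.elements, (diam K)⁻¹ ≤ r⁻¹ := fun K hK => by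
    obtain ⟨x₁, hx₁⟩ := hball K hK
    have := Mesh.two_mul_le_diam hd1 hK hr.le hx₁
    exact inv_anti₀ hr (by linarith)
  -- Inverse diameters are at most `r⁻¹`; comparability of `h` and `r` cancels the powers in the
  -- jump terms.
  have hchr : r⁻¹ * (c * h) ≤ c * σ := by
    rw [inv_mul_le_iff₀ hr]
    nlinarith
  have hhc : h * (c / h) = c := by field_simp
  -- A cut element contains an interface point and has diameter below `ρ`, so the cone condition at
  -- this point covers the whole piece.
  have hflat : ∀ K ∈ 𝒯.cut Ω₀, IsFlat (interfacePart Ω₀ K) := fun K hK => by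
    obtain ⟨hKe, x₀, hx₀⟩ := Mesh.mem_cut.1 hK
    obtain ⟨ν, hν, hcone⟩ := hρ.cone x₀ hx₀.2
    refine (hcone.isFlat hΩ₀ hν (by norm_num)).mono fun x hx => ⟨hx.2, ?_⟩
    rw [mem_ball_iff_norm]
    exact ((norm_sub_le_diam (cell_subset_hull K hx.1) (cell_subset_hull K hx₀.1)).trans
      (hdiam K hKe)).trans_lt hhρ
  -- The four face and interface terms have one shape: a power of a diameter, a count of elements,
  -- and a power of `h` that balances the first.
  have aux : ∀ {x X y y' n n' Q}, 0 ≤ X → 0 ≤ n' → x ≤ X → n ≤ n' → X * y ≤ y' →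
      ENNReal.ofReal x * (ENNReal.ofReal n * (ENNReal.ofReal y * Q)) ≤
        ENNReal.ofReal (n' * y') * Q := fun {x X y y' n n' Q} hX hn' hx hn hy => by
    calc _ ≤ ENNReal.ofReal X * (ENNReal.ofReal n' * (ENNReal.ofReal y * Q)) :=
          mul_le_mul' (ENNReal.ofReal_le_ofReal hx)
            (mul_le_mul' (ENNReal.ofReal_le_ofReal hn) le_rfl)
      _ = ENNReal.ofReal (n' * (X * y)) * Q := by
          rw [ENNReal.ofReal_mul hn', ENNReal.ofReal_mul hX]
          ring
      _ ≤ _ := mul_le_mul' (ENNReal.ofReal_le_ofReal (mul_le_mul_of_nonneg_left hy hn')) le_rfl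
  have t1 : ∑ K ∈ 𝒯.elements, ∑ i, gradSq (part Ω Ω₀ K i) w ≤ ENNReal.ofReal c * S := by
    rw [Finset.sum_comm, hS, Finset.mul_sum]
    refine Finset.sum_le_sum fun i _ => ?_
    rw [Finset.mul_sum]
    exact Finset.sum_le_sum fun K hK => hb.gradSq_le hΩ hΩ₀ hK i
  have hfaces : ∀ {q : Finset (E d) → Fin 2 → ℝ≥0∞} {y : ℝ},
      (∀ e ∈ 𝒯.facets, ∀ i, q e i ≤ ENNReal.ofReal (n * y) * ∑ K ∈ 𝒯.neighbours e, a i K) →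
      ∑ e ∈ 𝒯.facets, ∑ i, q e i ≤ ENNReal.ofReal (n * y) * (2 ^ (d + 1) * S) := fun {q y} hq => by
    rw [Finset.sum_comm, hS, Finset.mul_sum, Finset.mul_sum]
    refine Finset.sum_le_sum fun i _ => ?_
    refine (Finset.sum_le_sum fun e he => hq e he i).trans ?_
    rw [← Finset.mul_sum]
    exact mul_le_mul' le_rfl (𝒯.sum_facets_sum_neighbours_le _)
  have hcuts : ∀ {q : Finset (E d) → ℝ≥0∞} {y : ℝ},
      (∀ K ∈ 𝒯.cut Ω₀, q K ≤ ENNReal.ofReal (2 * y) * ∑ i, a i K) →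
      ∑ K ∈ 𝒯.cut Ω₀, q K ≤ ENNReal.ofReal (2 * y) * S := fun {q y} hq => by
    refine (Finset.sum_le_sum hq).trans ?_
    rw [← Finset.mul_sum, hS, Finset.sum_comm (t := 𝒯.elements)]
    exact mul_le_mul' le_rfl
      (Finset.sum_le_sum_of_subset fun K hK => (Mesh.mem_cut.1 hK).1)
  have t2 : ∑ e ∈ 𝒯.facets, ∑ i, ENNReal.ofReal (diam e) * faceAverSq 𝒯 Ω₀ e i w ≤
      ENNReal.ofReal (n * c) * (2 ^ (d + 1) * S) := hfaces fun e he i => by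
    refine (mul_le_mul' le_rfl (hb.faceAverSq_le hΩ hΩ₀ hd1 he i)).trans ?_
    rw [← Finset.mul_sum, ← ENNReal.ofReal_natCast]
    exact aux hh.le hn0 (hde e he).1 (hn e he) hhc.le
  have t3 : ∑ e ∈ 𝒯.facets, ∑ i, ENNReal.ofReal (diam e)⁻¹ * faceJumpSq 𝒯 Ω₀ e i w ≤
      ENNReal.ofReal (n * (c * σ)) * (2 ^ (d + 1) * S) := hfaces fun e he i => by
    refine (mul_le_mul' le_rfl (hb.faceJumpSq_le hΩ hΩ₀ hd1 he i)).trans ?_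
    rw [← Finset.mul_sum, ← ENNReal.ofReal_natCast]
    exact aux (by positivity) hn0 (hde e he).2 (hn e he) hchr
  have t4 : ∑ K ∈ 𝒯.cut Ω₀, ENNReal.ofReal (diam K) * interfaceAverSq Ω Ω₀ K w ≤
      ENNReal.ofReal (2 * c) * S := hcuts fun K hK => by
    refine (mul_le_mul' le_rfl (hb.interfaceAverSq_le hΩ₀ hsub hK (hflat K hK))).trans ?_
    rw [← Finset.mul_sum, ← ENNReal.ofReal_ofNat]
    exact aux hh.le (by norm_num) (hdiam K (Mesh.mem_cut.1 hK).1) le_rfl hhc.le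
  have t5 : ∑ K ∈ 𝒯.cut Ω₀, ENNReal.ofReal (diam K)⁻¹ * interfaceJumpSq Ω Ω₀ K w ≤
      ENNReal.ofReal (2 * (c * σ)) * S := hcuts fun K hK => by
    refine (mul_le_mul' le_rfl (hb.interfaceJumpSq_le hΩ₀ hsub hK (hflat K hK))).trans ?_
    rw [← Finset.mul_sum, ← ENNReal.ofReal_ofNat]
    exact aux (by positivity) (by norm_num) (hdK K (Mesh.mem_cut.1 hK).1) le_rfl hchr
  rw [energyNorm, ← ENNReal.rpow_natCast, ← ENNReal.rpow_mul]
  norm_num only [Nat.cast_ofNat, one_div, inv_mul_cancel₀, ENNReal.rpow_one]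
  refine (add_le_add (add_le_add (add_le_add (add_le_add t1 t2) t3) t4) t5).trans ?_
  have hcσ : 0 ≤ c * σ := by positivity
  have e2 : ((2 : ℝ≥0∞) ^ (d + 1)) = ENNReal.ofReal (2 ^ (d + 1)) := by
    rw [ENNReal.ofReal_pow (by norm_num), ENNReal.ofReal_ofNat]
  have hp : (0 : ℝ) ≤ 2 ^ (d + 1) := by positivity
  rw [e2, ← mul_assoc (ENNReal.ofReal (n * c)), ← mul_assoc (ENNReal.ofReal (n * (c * σ))),
    ← ENNReal.ofReal_mul' hp, ← ENNReal.ofReal_mul' hp]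
  rw [← add_mul, ← add_mul, ← add_mul, ← add_mul, ← ENNReal.ofReal_add hc (by positivity),
    ← ENNReal.ofReal_add (by positivity) (by positivity),
    ← ENNReal.ofReal_add (by positivity) (by positivity),
    ← ENNReal.ofReal_add (by positivity) (by positivity)]
  refine mul_le_mul' (ENNReal.ofReal_le_ofReal ?_) le_rfl
  linarith

end EnergyBound

/-! ### The approximation by the extended finite element space -/

section Approximation

variable {d : ℕ} {Ω Ω₀ : Set (E d)} {𝒯 : Mesh Ω} {K : Finset (E d)} {i : Fin 2} {h r : ℝ}

/-- Approximation by a polynomial on a patch. -/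
theorem exists_isPoly_approxOn (hd : 1 ≤ d) {m : ℕ} (hm : 1 ≤ m) (τ : ℝ) : ∃ C : ℝ, 0 ≤ C ∧
    ∀ {Ω Ω₀ : Set (E d)} {i : Fin 2} {z b : E d} {h r : ℝ} {W : Set (E d)},
    IsPatch Ω Ω₀ i z h r W b → 0 < h → r ≤ h → h ≤ τ * r →
    ∀ {u : E d → ℝ} {G : ∀ j : ℕ, (Fin j → Fin d) → E d → ℝ}, IsDerivFamily (m + 1) W u G →
    ∀ {δ : ℝ≥0∞}, 0 < δ → ∃ P, IsPoly m P ∧ ApproxOn W G P h (ENNReal.ofReal (C * h ^ (2 * m)) *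
      (∑ i' : Fin (m + 1) → Fin d, l2Sq volume W (G (m + 1) i') + δ)) := by
  obtain ⟨C, hC0, hC⟩ := exists_isPoly_approx_weak hd hm (9 * τ)
  refine ⟨C * 9 ^ (2 * (m + 1)), by positivity, fun {Ω Ω₀ i z b h r W} hW hh hrh hτ u G hG δ hδ => ?_⟩
  obtain ⟨P, hP, hle⟩ := hC hW.star (by linarith) (by linarith) hG hδ
  refine ⟨P, hP, fun j hj k => (hle j hj k).trans ?_⟩
  rw [← mul_assoc (ENNReal.ofReal (h ^ 2 / (h ^ 2) ^ j)), ← ENNReal.ofReal_mul (by positivity)]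
  refine mul_le_mul' (ENNReal.ofReal_le_ofReal ?_) le_rfl
  -- The subtraction is not truncated, because `j ≤ 2 ≤ m + 1`.
  have e1 : h ^ 2 / (h ^ 2) ^ j * h ^ (2 * m) = h ^ (2 * (m + 1 - j)) := by
    rw [div_mul_eq_mul_div, div_eq_iff (by positivity), ← pow_mul, ← pow_add, ← pow_add]
    congr 1
    omega
  calc C * (9 * h) ^ (2 * (m + 1 - j)) = C * 9 ^ (2 * (m + 1 - j)) * h ^ (2 * (m + 1 - j)) := by
        rw [mul_pow, mul_assoc]
    _ ≤ C * 9 ^ (2 * (m + 1)) * h ^ (2 * (m + 1 - j)) := by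
        refine mul_le_mul_of_nonneg_right (mul_le_mul_of_nonneg_left ?_ hC0) (by positivity)
        exact pow_le_pow_right₀ (by norm_num) (by omega)
    _ = _ := by rw [← e1]; ring

theorem IsPatch.ball_subset (hh : 0 < h) {z b x₁ : E d} {r' : ℝ} {W : Set (E d)}
    (hW : IsPatch Ω Ω₀ i z h r W b) (hK : K ∈ 𝒯.inner Ω₀ i) (hz : z ∈ K) (hdiam : diam K ≤ h)
    (hball : Metric.closedBall x₁ r' ⊆ hull K) : Metric.ball x₁ r' ⊆ W := fun x hx => by
  refine hW.superset ⟨(Mesh.mem_inner.1 hK).2 (Mesh.ball_subset_cell hball hx), ?_⟩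
  rw [mem_ball_iff_norm]
  have := norm_sub_le_diam (hball (Metric.ball_subset_closedBall hx)) (subset_hull hz)
  linarith

theorem norm_sub_le_of_touching {K' : Finset (E d)} (hKK' : (hull K' ∩ hull K).Nonempty)
    (hK : diam K ≤ h) (hK' : diam K' ≤ h) {x y : E d} (hx : x ∈ hull K) (hy : y ∈ hull K') :
    ‖x - y‖ ≤ 2 * h := by
  obtain ⟨p, hp', hp⟩ := hKK'
  have h1 := norm_sub_le_norm_sub_add_norm_sub x p y
  have h2 := norm_sub_le_diam hx hp
  have h3 := norm_sub_le_diam hp' hy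
  linarith

/-- Two points of the patch are within `9h` of its centre, hence within `18h` of each other. -/
theorem IsPatch.subset_ball {z b x₁ : E d} {W : Set (E d)}
    (hW : IsPatch Ω Ω₀ i z h r W b) (hx₁ : x₁ ∈ W) : W ⊆ Metric.ball x₁ (18 * h) := fun x hx => by
  have h1 := hW.star.subset hx
  have h2 := hW.star.subset hx₁
  rw [mem_ball_iff_norm] at h1 h2 ⊢
  have := norm_sub_le_norm_sub_add_norm_sub x b x₁
  rw [norm_sub_rev b x₁] at this
  linarith

/-- The patches that belong to the vertices of elements close to `K` have finite overlap. -/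
theorem sum_l2Sq_patches_le {S : Finset (Finset (E d))}
    (hS : S ⊆ 𝒯.elements) {base : Finset (E d) → Finset (E d)}
    (hbase : ∀ K ∈ S, base K ∈ 𝒯.inner Ω₀ i ∧ (hull (base K) ∩ hull K).Nonempty)
    {W : E d → Set (E d)} {b : E d → E d} (hW : ∀ K ∈ S, ∀ z ∈ base K, IsPatch Ω Ω₀ i z h r (W z) (b z))
    (hh : 0 < h) (hr : 0 < r) {τ : ℝ} (hτ : h ≤ τ * r) (hdiam : ∀ K ∈ 𝒯.elements, diam K ≤ h)
    (hball : ∀ K ∈ 𝒯.elements, ∃ x₁, Metric.closedBall x₁ r ⊆ hull K) {g : E d → ℝ}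
    (hg : AEStronglyMeasurable g (volume.restrict (subdomain Ω Ω₀ i))) :
    ∑ K ∈ S, ∑ z ∈ base K, l2Sq volume (W z) g ≤
      ((⌊(20 * τ) ^ d⌋₊ * (d + 1) : ℕ) : ℝ≥0∞) * l2Sq volume (subdomain Ω Ω₀ i) g := by
  classical
  rw [Finset.sum_sigma' S base fun _ z => l2Sq volume (W z) g]
  refine sum_l2Sq_le_of_overlap (V := fun p : (_ : Finset (E d)) × E d => W p.2) (fun p hp => ?_)
    (fun p hp => ?_) (fun x t ht htx => ?_) hg
  · obtain ⟨h1, h2⟩ := Finset.mem_sigma.1 hp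
    exact (hW _ h1 _ h2).star.isOpen.measurableSet
  · obtain ⟨h1, h2⟩ := Finset.mem_sigma.1 hp
    exact (hW _ h1 _ h2).subset
  have hTS : t.image Sigma.fst ⊆ S := fun K hK => by
    obtain ⟨p, hp, rfl⟩ := Finset.mem_image.1 hK
    exact (Finset.mem_sigma.1 (ht hp)).1
  have h1 : t.card ≤ (t.image Sigma.fst).card * (d + 1) := by
    have : t ⊆ (t.image Sigma.fst).sigma base := fun p hp =>
      Finset.mem_sigma.2 ⟨Finset.mem_image_of_mem _ hp, (Finset.mem_sigma.1 (ht hp)).2⟩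
    refine (Finset.card_le_card this).trans (le_of_eq ?_)
    rw [Finset.card_sigma]
    refine Finset.sum_const_nat fun K hK => ?_
    exact (Mesh.mem_elements.1 (Mesh.mem_inner.1 (hbase K (hTS hK)).1).1).2
  -- If `x` lies in a patch of `K`, then it is within `18h` of the inscribed centre of the base
  -- element, and `K`, which touches that element, is within another `2h`. Packing of inscribed
  -- balls does the rest.
  have h2 : ((t.image Sigma.fst).card : ℝ) * r ^ d ≤ (20 * h) ^ d := by
    refine Mesh.card_mul_pow_le (hTS.trans hS) (x := x) hr (by positivity) fun K hK => ?_
    obtain ⟨p, hp, rfl⟩ := Finset.mem_image.1 hK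
    obtain ⟨hpS, hpb⟩ := Finset.mem_sigma.1 (ht hp)
    obtain ⟨hin, htouch⟩ := hbase _ hpS
    have hKe := hS hpS
    have hbe := (Mesh.mem_inner.1 hin).1
    obtain ⟨x₁, hx₁⟩ := hball _ hbe
    obtain ⟨x₂, hx₂⟩ := hball _ hKe
    refine ⟨x₂, hx₂, fun y hy => ?_⟩
    have hP := hW _ hpS _ hpb
    have hxb := hP.subset_ball (hP.ball_subset hh hin hpb (hdiam _ hbe) hx₁ (Metric.mem_ball_self hr))
      (htx p hp)
    have h3 := norm_sub_le_of_touching htouch (hdiam _ hKe) (hdiam _ hbe)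
      (hx₂ (Metric.ball_subset_closedBall hy)) (hx₁ (Metric.mem_closedBall_self hr.le))
    rw [mem_ball_iff_norm] at hxb ⊢
    have := norm_sub_le_norm_sub_add_norm_sub y x₁ x
    rw [norm_sub_rev x₁ x] at this
    linarith
  have h3 : (t.image Sigma.fst).card ≤ ⌊(20 * τ) ^ d⌋₊ := by
    refine Nat.le_floor ?_
    have h4 : (20 * h) ^ d ≤ (20 * τ) ^ d * r ^ d := by
      rw [← mul_pow]
      exact pow_le_pow_left₀ (by positivity) (by linarith) _
    exact le_of_mul_le_mul_right (h2.trans h4) (by positivity)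
  exact h1.trans (Nat.mul_le_mul_right _ h3)

/-- Inscribed balls of the elements around a face are disjoint and lie in a ball of radius `2h`
about one of its vertices. This coarse packing bound suffices in place of the count of at most two.
-/
theorem Mesh.card_neighbours_le {e : Finset (E d)} (hd : 1 ≤ d) (he : e ∈ 𝒯.facets) (hh : 0 < h)
    (hr : 0 < r) {τ : ℝ} (hτ : h ≤ τ * r) (hdiam : ∀ K ∈ 𝒯.elements, diam K ≤ h)
    (hball : ∀ K ∈ 𝒯.elements, ∃ x₁, Metric.closedBall x₁ r ⊆ hull K) :
    ((𝒯.neighbours e).card : ℝ) ≤ (2 * τ) ^ d := by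
  obtain ⟨z, hz⟩ : e.Nonempty := Finset.card_pos.1 (by rw [(Mesh.mem_facets.1 he).2]; omega)
  have h2 : ((𝒯.neighbours e).card : ℝ) * r ^ d ≤ (2 * h) ^ d := by
    refine Mesh.card_mul_pow_le (𝒯 := 𝒯) (fun K hK => (Mesh.mem_neighbours.1 hK).1) (x := z) hr
      (by positivity) fun K hK => ?_
    obtain ⟨hKe, heK⟩ := Mesh.mem_neighbours.1 hK
    obtain ⟨x₁, hx₁⟩ := hball _ hKe
    refine ⟨x₁, hx₁, fun y hy => ?_⟩
    rw [mem_ball_iff_norm]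
    have := norm_sub_le_diam (hx₁ (Metric.ball_subset_closedBall hy)) (subset_hull (heK hz))
    have := hdiam _ hKe
    linarith
  have h4 : (2 * h) ^ d ≤ (2 * τ) ^ d * r ^ d := by
    rw [← mul_pow]
    exact pow_le_pow_left₀ (by positivity) (by linarith) _
  exact le_of_mul_le_mul_right (h2.trans h4) (by positivity)

end Approximation

/-! ### The error estimate -/

section Main

variable {d : ℕ} {Ω Ω₀ : Set (E d)}

theorem subdomain_subset_union (i : Fin 2) : subdomain Ω Ω₀ i ⊆ Ω₀ ∪ (Ω \ closure Ω₀) := by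
  unfold subdomain
  split_ifs
  · exact subset_union_left
  · exact subset_union_right

/-- The local polynomials live on patches at vertices of inner elements; interpolation, local bounds
and finite overlap then combine. The number `M` depends on the mesh, which is harmless because it
only multiplies the arbitrary `δ`. -/
theorem exists_mem_extSpace_energyNorm_sq_le (hd : 2 ≤ d) (hΩ : IsConvexPolytopalDomain Ω)
    (hΩ₀ : IsOpen Ω₀) (hsub : closure Ω₀ ⊆ Ω) {ρ : ℝ} (hρ : IsInterfaceRadius Ω Ω₀ ρ)
    {m : ℕ} (hm : 1 ≤ m) (σ : ℝ) : ∃ C : ℝ, 0 ≤ C ∧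
    ∀ (𝒯 : Mesh Ω), 𝒯.IsQuasiUniform σ → 6 * 𝒯.size ≤ ρ →
    ∀ (κ : Fin 2 → SpaceKind) {A : Fin 2 → Finset (E d) → Finset (E d)}, 𝒯.IsAssignment Ω₀ A →
    ∀ {u : E d → ℝ} {G : ∀ j : ℕ, (Fin j → Fin d) → E d → ℝ},
    IsDerivFamily (m + 1) (Ω₀ ∪ (Ω \ closure Ω₀)) u G → ∃ M : ℕ, ∀ {δ : ℝ≥0∞}, 0 < δ →
    ∃ v ∈ extSpace 𝒯 Ω₀ m κ A, energyNorm 𝒯 Ω₀ (fun x => u x - v x) ^ 2 ≤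
      ENNReal.ofReal (C * 𝒯.size ^ (2 * m)) *
        (∑ i' : Fin (m + 1) → Fin d, l2Sq volume (Ω₀ ∪ (Ω \ closure Ω₀)) (G (m + 1) i') + M * δ) := by
  classical
  have hd1 : 1 ≤ d := by omega
  -- The sign of `σ` is known only once a mesh is given, while the constants must be fixed before.
  -- The two is the loss in passing from the inradius to an actual inscribed ball.
  set τ : ℝ := 2 * |σ| with hτdef
  have hτ0 : 0 ≤ τ := by positivity
  obtain ⟨C₁, hC₁, hpoly⟩ := exists_isPoly_approxOn hd1 hm τ
  -- A patch lies in a ball of radius `18h = 18 τ r` about the centre of the inscribed ball.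
  obtain ⟨C₂, hC₂, hfe⟩ := exists_fePoly_error d hm (18 * τ) τ
  set κ' : ℝ := max 9 (9 * τ) with hκ'
  set c := localConst d κ' with hcdef
  have hc : 0 ≤ c := localConst_nonneg (by positivity)
  set C₃ : ℝ := (1 + 2 ^ (d + 1) * (2 * τ) ^ d + 2) * (c + c * τ) with hC₃def
  have hC₃ : 0 ≤ C₃ := by positivity
  -- The added one gives `N ≥ 1`, so that `N` also dominates the coefficient of the sum of the `δ`.
  set N : ℕ := ⌊(20 * τ) ^ d⌋₊ * (d + 1) + 1 with hN
  refine ⟨C₃ * (C₂ * C₁ * (2 * N)), by positivity, fun 𝒯 hσ hsize κ A hA u G hG => ?_⟩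
  refine ⟨𝒯.elements.card * (d + 1), fun {δ} hδ => ?_⟩
  set D := Ω₀ ∪ (Ω \ closure Ω₀) with hD
  set h := 𝒯.size with hhdef
  have hh : 0 < h := Mesh.size_pos hd1 hΩ.1
  obtain ⟨K₀, hK₀⟩ := Mesh.exists_mem_elements (𝒯 := 𝒯) hΩ.1
  have hσ0 : 0 < σ := (Mesh.exists_closedBall_subset hd1 hΩ.1 hσ hK₀).1
  have hτσ : τ = 2 * σ := by rw [hτdef, abs_of_pos hσ0]
  set r := h / τ with hrdef
  have hτpos : 0 < τ := by rw [hτσ]; positivity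
  have hr : 0 < r := by positivity
  have hτr : h = τ * r := by rw [hrdef]; field_simp
  have hball : ∀ K ∈ 𝒯.elements, ∃ x₁, Metric.closedBall x₁ r ⊆ hull K := fun K hK => by
    rw [hrdef, hτσ]
    exact (Mesh.exists_closedBall_subset hd1 hΩ.1 hσ hK).2
  have hdiam : ∀ K ∈ 𝒯.elements, diam K ≤ h := fun K hK => Mesh.diam_le_size hK
  have hrh : 2 * r ≤ h := by
    obtain ⟨x₁, hx₁⟩ := hball K₀ hK₀
    exact (Mesh.two_mul_le_diam hd1 hK₀ hr.le hx₁).trans (hdiam K₀ hK₀)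
  choose! lam hlam using fun K (hK : K ∈ 𝒯.elements) => Mesh.exists_isBary hK
  have hGi := fun i => hG.mono (subdomain_subset_union (Ω := Ω) (Ω₀ := Ω₀) i)
  -- One patch and one polynomial per subdomain and vertex, whatever element it is seen from; this
  -- is what makes the interpolant continuous. Points that are not such vertices receive the zero
  -- polynomial.
  have hpatch : ∀ (i : Fin 2) (z : E d), ∃ W b P, IsPoly m P ∧ ((∃ K ∈ 𝒯.inner Ω₀ i, z ∈ K) →
      IsPatch Ω Ω₀ i z h r W b ∧ ApproxOn W G P h (ENNReal.ofReal (C₁ * h ^ (2 * m)) *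
      (∑ i' : Fin (m + 1) → Fin d, l2Sq volume W (G (m + 1) i') + δ))) := by
    intro i z
    by_cases hz : ∃ K ∈ 𝒯.inner Ω₀ i, z ∈ K
    · obtain ⟨K, hK, hzK⟩ := hz
      have hKe := (Mesh.mem_inner.1 hK).1
      obtain ⟨x₁, hx₁⟩ := hball K hKe
      obtain ⟨W, b, hW⟩ := hρ.exists_isPatch hΩ.isOpen hΩ.convex hΩ₀ hsub hh hsize hr
        (by linarith) ((Mesh.ball_subset_cell hx₁).trans (Mesh.mem_inner.1 hK).2)
        ((norm_sub_le_diam (hx₁ (Metric.mem_closedBall_self hr.le)) (subset_hull hzK)).trans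
          (hdiam K hKe))
      obtain ⟨P, hP, hle⟩ := hpoly hW hh (by linarith) hτr.le ((hGi i).mono hW.subset) hδ
      exact ⟨W, b, P, hP, fun _ => ⟨hW, hle⟩⟩
    · exact ⟨∅, 0, fun _ => 0, ⟨0, by simp, fun x => by simp⟩, fun h' => absurd h' hz⟩
  choose W b P hP hWP using hpatch
  obtain ⟨v, hv, hvp⟩ := exists_mem_extSpace hΩ₀ hm hlam κ hA hP
  refine ⟨v, hv, ?_⟩
  -- Inner and cut elements are treated alike: the polynomial comes from a base element that touches
  -- `K`, and any vertex of it gives a patch that reaches over `K`.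
  let base : Fin 2 → Finset (E d) → Finset (E d) := fun i K => if K ∈ 𝒯.cut Ω₀ then A i K else K
  let S : Fin 2 → Finset (Finset (E d)) := fun i =>
    {K ∈ 𝒯.elements | K ∈ 𝒯.inner Ω₀ i ∨ K ∈ 𝒯.cut Ω₀}
  let B : Fin 2 → E d → ℝ≥0∞ := fun i z => ENNReal.ofReal (C₁ * h ^ (2 * m)) *
    (∑ i' : Fin (m + 1) → Fin d, l2Sq volume (W i z) (G (m + 1) i') + δ)
  let a : Fin 2 → Finset (E d) → ℝ≥0∞ := fun i K =>
    if K ∈ S i then ENNReal.ofReal C₂ * ∑ z ∈ base i K, B i z else 0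
  have hbase : ∀ i, ∀ K ∈ S i, (base i K ∈ 𝒯.inner Ω₀ i ∧ (hull (base i K) ∩ hull K).Nonempty) ∧
      EqOn v (fePoly m (base i K) (lam (base i K)) (P i)) (part Ω Ω₀ K i) := by
    intro i K hK
    obtain ⟨hKe, hK'⟩ := Finset.mem_filter.1 hK
    by_cases hcut : K ∈ 𝒯.cut Ω₀
    · simp only [base, if_pos hcut]
      obtain ⟨h1, h2⟩ := hA K hcut i
      exact ⟨⟨h2, h1.2⟩, (hvp i).2 K hcut⟩
    · simp only [base, if_neg hcut]
      have hin := hK'.resolve_right hcut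
      refine ⟨⟨hin, ?_⟩, ((hvp i).1 K hin).mono inter_subset_left⟩
      rw [inter_self]
      exact (Mesh.cell_nonempty hKe).mono (cell_subset_hull K)
  have hbounds : BoundedOnParts 𝒯 Ω₀ (fun x => u x - v x) c h a := by
    intro i K hK hact
    have hKS : K ∈ S i := Finset.mem_filter.2 ⟨hK, hact⟩
    obtain ⟨⟨hin, htouch⟩, heq⟩ := hbase i K hKS
    have hbe := (Mesh.mem_inner.1 hin).1
    obtain ⟨z₀, hz₀⟩ : (base i K).Nonempty :=
      Finset.card_pos.1 (by rw [(Mesh.mem_elements.1 hbe).2]; omega)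
    obtain ⟨x₁, hx₁⟩ := hball _ hbe
    have hWz := fun z (hz : z ∈ base i K) => (hWP i z ⟨_, hin, hz⟩)
    have hsubW := fun z (hz : z ∈ base i K) =>
      (hWz z hz).1.ball_subset hh hin hz (hdiam _ hbe) hx₁
    have hGW := (hGi i).mono (hWz z₀ hz₀).1.subset
    have happ := hfe (h := h) (W := W i) (P := P i) (G := G) (B := B i) (hlam _ hbe)
      (Mesh.mem_elements.1 hbe).2 hr (by linarith)
      hτr.le hx₁ (fun z hz x hx => (norm_sub_le_diam (subset_hull hz) hx).trans (hdiam _ hbe)) (hP i)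
      hsubW hz₀ (((hWz z₀ hz₀).1.subset_ball (hsubW z₀ hz₀ (Metric.mem_ball_self hr))).trans
        (by rw [mul_assoc, ← hτr]))
      (fun j hj k => (hGW.2 j (by omega) k).2.1.1)
      (fun z hz => (hWz z hz).2)
    simp only [a, if_pos hKS]
    refine (hWz z₀ hz₀).1.localBounds hd1 hΩ.isOpen hΩ₀ hh (by linarith) (le_max_left _ _) ?_
      (show 2 ≤ m + 1 by omega) hGW (isPoly_fePoly hm (hlam _ hbe) (hP i)).contDiff happ
      (fun x hx => ?_) fun x hx => by simp only [heq hx]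
    · calc 9 * h = 9 * τ * r := by rw [mul_assoc, ← hτr]
        _ ≤ κ' * r := mul_le_mul_of_nonneg_right (le_max_right _ _) hr.le
    · rw [mem_ball_iff_norm]
      have := norm_sub_le_of_touching htouch (hdiam _ hK) (hdiam _ hbe) hx (subset_hull hz₀)
      linarith
  refine (hbounds.energyNorm_sq_le hΩ hΩ₀ hsub hd hρ hh hr hτr.le (by linarith) hc
    (show 0 ≤ (2 * τ) ^ d by positivity) hdiam hball
    fun e he => Mesh.card_neighbours_le hd1 he hh hr hτr.le hdiam hball).trans ?_
  set X := ∑ i' : Fin (m + 1) → Fin d, l2Sq volume D (G (m + 1) i') with hX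
  have hsum : ∀ i, ∑ K ∈ 𝒯.elements, a i K ≤ ENNReal.ofReal (C₂ * (C₁ * h ^ (2 * m))) *
      (N * (X + (𝒯.elements.card * (d + 1) : ℕ) * δ)) := by
    intro i
    have hSe : S i ⊆ 𝒯.elements := Finset.filter_subset _ _
    have e1 : ∑ K ∈ 𝒯.elements, a i K = ENNReal.ofReal (C₂ * (C₁ * h ^ (2 * m))) *
        (∑ i' : Fin (m + 1) → Fin d, ∑ K ∈ S i, ∑ z ∈ base i K, l2Sq volume (W i z) (G (m + 1) i') +
          ∑ K ∈ S i, ∑ z ∈ base i K, δ) := by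
      rw [← Finset.sum_filter, Finset.filter_mem_eq_inter, Finset.inter_eq_right.2 hSe,
        ENNReal.ofReal_mul hC₂, mul_assoc, Finset.sum_comm (t := S i), ← Finset.sum_add_distrib,
        Finset.mul_sum, Finset.mul_sum]
      refine Finset.sum_congr rfl fun K _ => ?_
      rw [Finset.sum_comm (t := base i K), ← Finset.sum_add_distrib, ← Finset.mul_sum]
    rw [e1]
    refine mul_le_mul' le_rfl ?_
    rw [mul_add]
    refine add_le_add ?_ ?_
    · rw [hX, Finset.mul_sum]
      refine Finset.sum_le_sum fun i' _ => ?_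
      refine (sum_l2Sq_patches_le hSe (fun K hK => (hbase i K hK).1)
        (fun K hK z hz => (hWP i z ⟨_, (hbase i K hK).1.1, hz⟩).1) hh hr hτr.le hdiam hball
        ((hGi i).2 (m + 1) le_rfl i').2.1.1).trans ?_
      refine mul_le_mul' ?_ (l2Sq_mono_set (subdomain_subset_union i) _)
      exact_mod_cast Nat.le_succ _
    · have e2 : ∑ K ∈ S i, ∑ z ∈ base i K, δ = ((S i).card * (d + 1) : ℕ) * δ := by
        rw [Finset.sum_congr rfl fun K hK => by
          rw [Finset.sum_const, (Mesh.mem_elements.1 (Mesh.mem_inner.1 (hbase i K hK).1.1).1).2],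
          Finset.sum_const, smul_smul, nsmul_eq_mul]
      rw [e2]
      calc _ ≤ ((𝒯.elements.card * (d + 1) : ℕ) : ℝ≥0∞) * δ := by
            refine mul_le_mul' ?_ le_rfl
            exact_mod_cast Nat.mul_le_mul_right _ (Finset.card_le_card hSe)
        _ = 1 * (((𝒯.elements.card * (d + 1) : ℕ) : ℝ≥0∞) * δ) := (one_mul _).symm
        _ ≤ _ := mul_le_mul' (by rw [hN]; exact_mod_cast Nat.le_add_left _ _) le_rfl
  calc _ ≤ ENNReal.ofReal C₃ * ∑ _i : Fin 2, ENNReal.ofReal (C₂ * (C₁ * h ^ (2 * m))) *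
        (N * (X + (𝒯.elements.card * (d + 1) : ℕ) * δ)) :=
        mul_le_mul' le_rfl (Finset.sum_le_sum fun i _ => hsum i)
    _ = _ := by
        rw [Finset.sum_const, Finset.card_univ, Fintype.card_fin, nsmul_eq_mul,
          show C₃ * (C₂ * C₁ * (2 * N)) * h ^ (2 * m) =
            C₃ * ((C₂ * (C₁ * h ^ (2 * m))) * (2 * N)) by ring,
          ENNReal.ofReal_mul hC₃, ENNReal.ofReal_mul (p := C₂ * (C₁ * h ^ (2 * m))) (by positivity),
          ENNReal.ofReal_mul (p := 2) (by norm_num), ENNReal.ofReal_natCast, ENNReal.ofReal_ofNat]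
        push_cast
        ring

end Main

end UnfittedFEM

theorem mainTheorem4 (d : ℕ) (hd : d = 2 ∨ d = 3)
    (Ω Ω₀ : Set (EuclideanSpace ℝ (Fin d)))
    (hΩ : UnfittedFEM.IsConvexPolytopalDomain Ω)
    (hΩ₀ : IsOpen Ω₀) (hsub : closure Ω₀ ⊆ Ω) (hΓ : UnfittedFEM.HasC2Boundary Ω₀)
    (σ : ℝ) :
    ∃ h₀ : ℝ, 0 < h₀ ∧ ∀ m : ℕ, 1 ≤ m → ∃ C : ℝ, 0 < C ∧
      ∀ (𝒯 : UnfittedFEM.Mesh Ω), 𝒯.IsQuasiUniform σ → 𝒯.size ≤ h₀ →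
      ∀ (κ : Fin 2 → UnfittedFEM.SpaceKind)
        (A : Fin 2 → Finset (EuclideanSpace ℝ (Fin d)) → Finset (EuclideanSpace ℝ (Fin d))),
        𝒯.IsAssignment Ω₀ A →
      ∀ u : EuclideanSpace ℝ (Fin d) → ℝ,
        UnfittedFEM.MemSobolev (m + 1) (Ω₀ ∪ (Ω \ closure Ω₀)) u →
        (⨅ v ∈ UnfittedFEM.extSpace 𝒯 Ω₀ m κ A,
            UnfittedFEM.energyNorm 𝒯 Ω₀ (fun x => u x - v x)) ≤
          ENNReal.ofReal (C * 𝒯.size ^ m) *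
            UnfittedFEM.sobolevNorm (m + 1) (Ω₀ ∪ (Ω \ closure Ω₀)) u := by
  have hd2 : 2 ≤ d := by omega
  obtain ⟨ρ, hρ⟩ := UnfittedFEM.exists_interfaceRadius hΩ.isOpen hΩ.isBounded hsub hΓ
  refine ⟨ρ / 6, by linarith [hρ.pos], fun m hm => ?_⟩
  obtain ⟨C, hC0, hC⟩ := UnfittedFEM.exists_mem_extSpace_energyNorm_sq_le hd2 hΩ hΩ₀ hsub hρ hm σ
  -- The previous constant bounds the square of the norm and may vanish; `C + 1` is positive and `C
  -- ≤ (C + 1)²`.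
  refine ⟨C + 1, by positivity, fun 𝒯 hσ hsize κ A hA u hu => ?_⟩
  have hh := UnfittedFEM.Mesh.size_pos (𝒯 := 𝒯) (by omega) hΩ.1
  obtain ⟨G, hG, hnorm⟩ := hu.exists_family (hΩ₀.union (hΩ.isOpen.sdiff isClosed_closure))
  obtain ⟨M, hM⟩ := hC 𝒯 hσ (by linarith) κ hA hG
  set X := ∑ i' : Fin (m + 1) → Fin d,
    UnfittedFEM.l2Sq volume (Ω₀ ∪ (Ω \ closure Ω₀)) (G (m + 1) i') with hX
  set I := ⨅ v ∈ UnfittedFEM.extSpace 𝒯 Ω₀ m κ A, UnfittedFEM.energyNorm 𝒯 Ω₀ (fun x => u x - v x)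
  -- The approximant depends on `δ`, but the infimum does not; hence `δ` may tend to zero.
  have h1 : ∀ δ : ℝ≥0∞, 0 < δ → I ^ 2 ≤ ENNReal.ofReal (C * 𝒯.size ^ (2 * m)) * (X + M * δ) :=
    fun δ hδ => by
      obtain ⟨v, hv, hle⟩ := hM hδ
      exact (pow_le_pow_left' (iInf₂_le v hv) 2).trans hle
  have h2 : I ^ 2 ≤ ENNReal.ofReal (C * 𝒯.size ^ (2 * m)) * X := by
    have ht : Tendsto (fun n : ℕ => ENNReal.ofReal (C * 𝒯.size ^ (2 * m)) *
        (X + M * (n : ℝ≥0∞)⁻¹)) atTop (𝓝 (ENNReal.ofReal (C * 𝒯.size ^ (2 * m)) * (X + M * 0))) :=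
      ENNReal.Tendsto.const_mul (tendsto_const_nhds.add (ENNReal.Tendsto.const_mul
        ENNReal.tendsto_inv_nat_nhds_zero (Or.inr (ENNReal.natCast_ne_top M))))
        (Or.inr ENNReal.ofReal_ne_top)
    rw [mul_zero, add_zero] at ht
    exact ge_of_tendsto ht (Eventually.of_forall fun n => h1 _ (by simp))
  have h3 : X ≤ UnfittedFEM.sobolevNorm (m + 1) (Ω₀ ∪ (Ω \ closure Ω₀)) u ^ 2 := by
    rw [hnorm]
    exact Finset.single_le_sum (f := fun j => ∑ i : Fin j → Fin d,
      UnfittedFEM.l2Sq volume (Ω₀ ∪ (Ω \ closure Ω₀)) (G j i)) (fun _ _ => bot_le)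
      (Finset.mem_range.2 (Nat.lt_succ_self (m + 1)))
  refine (ENNReal.pow_le_pow_left_iff two_ne_zero).1 ?_
  rw [mul_pow, ← ENNReal.ofReal_pow (by positivity)]
  refine h2.trans (mul_le_mul' (ENNReal.ofReal_le_ofReal ?_) h3)
  rw [mul_pow, ← pow_mul, mul_comm m 2]
  exact mul_le_mul_of_nonneg_right (by nlinarith) (by positivity)
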